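/- All functions are real valued. Let $\rho,k\in C^1[0,\infty)$ be positive with $\rho k\in C^2[0,\infty)$ and $(\rho k)'(0)=0$, and let $\gamma$ be a function on $[0,\infty)$; denote the even extensions of $\rho,k,\gamma$ to $\mathbb R$ by the same letters. Put $$\sigma(x)=\int_0^x\sqrt{\rho/k}\,d\xi,\quad Q_1=\sqrt{\tfrac k\rho}\,\frac{(k\rho)'}{4k\rho},\quad Q_2=\sqrt{\tfrac k\rho}\,Q_1'+Q_1^2,\quad q=Q_2-\gamma .$$ Assume $\sigma(x)\to+\infty$ as $x\to+\infty$, $q\in L^\infty(0,\infty)\cap C^1[0,\infty)$ and $\sqrt{\rho/k}\,q\,\sigma\in L^1(0,\infty)$. Spaces. Let $L^2_\rho=L^2(\mathbb R;\rho\,dx)$ and $\mathbb D\varphi=\sqrt{k/\rho}\,\varphi'+Q_1\varphi$ in the sense of distributions. Let $\mathbb H^1=\{\varphi\in L^2_\rho:\mathbb D\varphi\in L^2_\rho\}$ with norm $(\|\varphi\|^2_{L^2_\rho}+\|\mathbb D\varphi\|^2_{L^2_\rho})^{1/2}$, let $\mathbb H^{-1}$ be its dual, in which $f\in L^2_\rho$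 is identified with the functional $\varphi\mapsto\int f\varphi\rho\,dx$, put $\langle\!\langle\mathbb Df,\varphi\rangle\!\rangle=-\int f\,(\mathbb D\varphi)\,\rho\,dx$ for $f\in L^2_\rho$, $\varphi\in\mathbb H^1$, and let $\langle\!\langle\delta,\varphi\rangle\!\rangle=\varphi(0)$. Let $\widehat{\mathbb H}^1$ be the subspace of even functions in $\mathbb H^1$, and $\widehat H^1$ the same space for $\rho=k=1$, i.e. the even functions in $H^1(\mathbb R)$. Control system. For $T>0$, $u\in L^\infty(0,T)$ and $W^0\in\widehat{\mathbb H}^1$ consider $$W_t=\mathbb D^2W-qW-2\sqrt{(\rho k)(0)}\,u\,\delta\ \text{ on }\mathbb R\times(0,T),\qquad W(\cdot,0)=W^0.\tag{1}$$ A solution is a function $W\in C([0,T];\widehat{\mathbb H}^1)$ that is absolutely continuous as a function with values in $\mathbb H^{-1}$, satisfies the initial condition, and for almost every $t\in(0,T)$ has a derivative in $\mathbb H^{-1}$ for which the equation holds in $\mathbb H^{-1}$. Let $\mathcal R_T^{\rho k\gamma}(W^0)$ be the set of all $W^T\in\widehat{\mathbb H}^1$ for which there is a control $u\in L^\infty(0,T)$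 such that (1) has a unique solution $W$, and $W(\cdot,T)=W^T$. The state $W^0$ is controllable to $W^T$ in time $T$ if $W^T\in\mathcal R_T^{\rho k\gamma}(W^0)$, and approximately controllable to $W^T$ in time $T$ if $W^T$ lies in the closure of $\mathcal R_T^{\rho k\gamma}(W^0)$ in $\widehat{\mathbb H}^1$. For $\rho=k=1$, $\gamma=0$ system (1) is $$Z_t=Z_{\xi\xi}-2u\delta,\qquad Z(\cdot,0)=Z^0\in\widehat H^1,\tag{2}$$ and the corresponding reachable set is denoted by $\mathcal R_T^{110}(Z^0)$. Transformation operator. Let $r=q\circ\sigma^{-1}$ on $[0,\infty)$, and let $K\in C^2(\Omega)$, $\Omega=\{y_2>y_1>0\}$, be the kernel determined by $$K_{y_1y_1}-K_{y_2y_2}=r(y_1)K\ \text{ on }\Omega,\qquad K(y,y)=\frac12\int_y^\infty r(\xi)\,d\xi\quad(y>0),\qquad \lim_{y_1+y_2\to\infty}K(y_1,y_2)=0 ,$$ where the value on the diagonal is the limit from $\Omega$. For $g\in\widehat H^1$ put $$(\widehat{\mathbf T}_rg)(\lambda)=g(\lambda)+\int_{|\lambda|}^\infty K(|\lambda|,\xi)g(\xi)\,d\xi,\qquad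 \widehat{\mathbb T}g=\frac{(\widehat{\mathbf T}_rg)\circ\sigma}{\sqrt[4]{\rho k}} .$$ Theorem. The operator $\widehat{\mathbb T}$ is well defined from $\widehat H^1$ to $\widehat{\mathbb H}^1$ and bijective. Let $T>0$, $W^0,W^T\in\widehat{\mathbb H}^1$, $Z^0=\widehat{\mathbb T}^{-1}W^0$ and $Z^T=\widehat{\mathbb T}^{-1}W^T$. Then (i) $\mathcal R_T^{\rho k\gamma}(W^0)=\widehat{\mathbb T}\big(\mathcal R_T^{110}(Z^0)\big)$; (ii) $Z^0$ is controllable to $Z^T$ in time $T$ with respect to (2) if and only if $W^0$ is controllable to $W^T$ in time $T$ with respect to (1); (iii) $Z^0$ is approximately controllable to $Z^T$ in time $T$ with respect to (2) if and only if $W^0$ is approximately controllable to $W^T$ in time $T$ with respect to (1). -/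

import Mathlib

open MeasureTheory Set Filter Topology
open scoped ENNReal ContDiff

noncomputable section

/-! ### Coefficients of the heat operator -/

/-- `σ(x) = ∫₀ˣ √(ρ/k)`. -/
def heatSigma (ρ k : ℝ → ℝ) (x : ℝ) : ℝ :=
  ∫ ξ in (0 : ℝ)..x, √(ρ ξ / k ξ)

/-- `Q₁(ρ,k) = √(k/ρ) (kρ)' / (4kρ)`. -/
def heatQ₁ (ρ k : ℝ → ℝ) (x : ℝ) : ℝ :=
  √(k x / ρ x) * deriv (fun y => k y * ρ y) x / (4 * (k x * ρ x))

/-- `Q₂(ρ,k) = √(k/ρ) Q₁' + Q₁²`. -/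
def heatQ₂ (ρ k : ℝ → ℝ) (x : ℝ) : ℝ :=
  √(k x / ρ x) * deriv (heatQ₁ ρ k) x + heatQ₁ ρ k x ^ 2

/-- The coefficients `ρ, k, γ` on `[0,∞)`, identified with their even extensions to `ℝ`, with the
standing assumptions of the control problem. -/
structure HeatData where
  ρ : ℝ → ℝ
  k : ℝ → ℝ
  γ : ℝ → ℝ
  even_ρ : Function.Even ρ
  even_k : Function.Even k
  even_γ : Function.Even γ
  pos_ρ : ∀ x, 0 ≤ x → 0 < ρ x
  pos_k : ∀ x, 0 ≤ x → 0 < k x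
  contDiff_ρ : ContDiffOn ℝ 1 ρ (Ici 0)
  contDiff_k : ContDiffOn ℝ 1 k (Ici 0)
  contDiff_ρk : ContDiffOn ℝ 2 (fun x => ρ x * k x) (Ici 0)
  deriv_ρk : derivWithin (fun x => ρ x * k x) (Ici 0) 0 = 0
  sigma_atTop : Tendsto (heatSigma ρ k) atTop atTop
  bounded_q : MemLp (fun x => heatQ₂ ρ k x - γ x) ∞ (volume.restrict (Ioi 0))
  contDiff_q : ContDiffOn ℝ 1 (fun x => heatQ₂ ρ k x - γ x) (Ici 0)
  integrable_q : IntegrableOn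
    (fun x => √(ρ x / k x) * (heatQ₂ ρ k x - γ x) * heatSigma ρ k x) (Ioi 0)

/-- `g` is the derivative of `f` in the sense of distributions on `ℝ`, where `f` and `g` are
locally integrable. -/
def HasDistribDeriv (f g : ℝ → ℝ) : Prop :=
  LocallyIntegrable f ∧ LocallyIntegrable g ∧
    ∀ η : ℝ → ℝ, ContDiff ℝ ∞ η → HasCompactSupport η →
      ∫ x, f x * deriv η x = -∫ x, g x * η x

theorem HasDistribDeriv.congr {f g f' g' : ℝ → ℝ} (h : HasDistribDeriv f g)
    (hf : f =ᵐ[volume] f') (hg : g =ᵐ[volume] g') : HasDistribDeriv f' g' := by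
  refine ⟨h.1.congr hf, h.2.1.congr hg, fun η h1 h2 => ?_⟩
  have e1 : ∫ x, f' x * deriv η x = ∫ x, f x * deriv η x :=
    integral_congr_ae (by filter_upwards [hf] with x hx; rw [hx])
  have e2 : ∫ x, g' x * η x = ∫ x, g x * η x :=
    integral_congr_ae (by filter_upwards [hg] with x hx; rw [hx])
  rw [e1, e2, h.2.2 η h1 h2]

theorem HasDistribDeriv.zero : HasDistribDeriv (fun _ => 0) (fun _ => 0) :=
  ⟨locallyIntegrable_zero, locallyIntegrable_zero, fun η _ _ => by simp⟩

theorem HasDistribDeriv.add {f g f' g' : ℝ → ℝ} (h : HasDistribDeriv f g)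
    (h' : HasDistribDeriv f' g') :
    HasDistribDeriv (fun x => f x + f' x) (fun x => g x + g' x) := by
  refine ⟨h.1.add h'.1, h.2.1.add h'.2.1, fun η h1 h2 => ?_⟩
  have hc : Continuous (deriv η) := h1.continuous_deriv (by simp)
  have key : ∀ (u v : ℝ → ℝ), LocallyIntegrable u → Continuous v → HasCompactSupport v →
      Integrable (fun x => u x * v x) := fun u v hu hv hv' => by
    simpa [smul_eq_mul] using hu.integrable_smul_right_of_hasCompactSupport hv hv'
  simp only [add_mul]
  rw [integral_add (key _ _ h.1 hc h2.deriv) (key _ _ h'.1 hc h2.deriv),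
    integral_add (key _ _ h.2.1 h1.continuous h2) (key _ _ h'.2.1 h1.continuous h2),
    h.2.2 η h1 h2, h'.2.2 η h1 h2]
  ring

theorem HasDistribDeriv.const_mul {f g : ℝ → ℝ} (c : ℝ) (h : HasDistribDeriv f g) :
    HasDistribDeriv (fun x => c * f x) (fun x => c * g x) := by
  refine ⟨h.1.smul c, h.2.1.smul c, fun η h1 h2 => ?_⟩
  simp only [mul_assoc, integral_const_mul]
  rw [h.2.2 η h1 h2]
  ring

namespace HeatData

variable (D : HeatData)

/-- `σ`. -/
def σ : ℝ → ℝ := heatSigma D.ρ D.k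

/-- `Q₁(ρ,k)`. -/
def Q₁ : ℝ → ℝ := heatQ₁ D.ρ D.k

/-- The potential `q = Q₂(ρ,k) - γ`. -/
def q (x : ℝ) : ℝ := heatQ₂ D.ρ D.k x - D.γ x

theorem ρ_pos (x : ℝ) : 0 < D.ρ x := by
  rcases le_total 0 x with h | h
  · exact D.pos_ρ x h
  · rw [← D.even_ρ x]; exact D.pos_ρ (-x) (by linarith)

theorem continuous_ρ : Continuous D.ρ := by
  have h : D.ρ = fun x => D.ρ |x| := by
    funext x
    rcases le_total 0 x with hx | hx
    · rw [abs_of_nonneg hx]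
    · rw [abs_of_nonpos hx, D.even_ρ]
  rw [h]
  exact D.contDiff_ρ.continuousOn.comp_continuous continuous_abs (fun x => abs_nonneg x)

/-! ### Modified Sobolev spaces -/

/-- The measure `ρ dx`. -/
def μ : Measure ℝ := volume.withDensity (fun x => ENNReal.ofReal (D.ρ x))

theorem ae_volume {p : ℝ → Prop} (h : ∀ᵐ x ∂D.μ, p x) : ∀ᵐ x, p x :=
  (withDensity_absolutelyContinuous'
    (D.continuous_ρ.measurable.ennreal_ofReal).aemeasurable
    (Eventually.of_forall fun x => by simpa using D.ρ_pos x)).ae_le h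

/-- The space `L²_ρ(ℝ)`. -/
abbrev L2ρ : Type := Lp ℝ 2 D.μ

/-- `g = 𝔻_{ρk} f = √(k/ρ) f' + Q₁ f`, i.e. the distributional derivative of `f` is
`√(ρ/k) (g - Q₁ f)`. -/
def HasD (f g : ℝ → ℝ) : Prop :=
  HasDistribDeriv f (fun x => √(D.ρ x / D.k x) * (g x - D.Q₁ x * f x))

/-- The space `ℍ¹` of all `φ ∈ L²_ρ(ℝ)` with `𝔻_{ρk} φ ∈ L²_ρ(ℝ)`, realized as the graph of `𝔻_{ρk}`
in the Hilbert sum `L²_ρ ⊕ L²_ρ`: an element is the pair `(φ, 𝔻_{ρk} φ)`, with norm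
`(‖φ‖² + ‖𝔻_{ρk} φ‖²)^{1/2}`. -/
def H1 : Submodule ℝ (WithLp 2 (D.L2ρ × D.L2ρ)) where
  carrier := {w | D.HasD w.fst w.snd}
  zero_mem' := by
    refine HasDistribDeriv.congr HasDistribDeriv.zero ?_ ?_
    · filter_upwards [D.ae_volume (Lp.coeFn_zero ℝ 2 D.μ)] with x hx
      exact hx.symm
    · filter_upwards [D.ae_volume (Lp.coeFn_zero ℝ 2 D.μ)] with x hx
      rw [WithLp.zero_fst, WithLp.zero_snd, hx]
      simp
  add_mem' := by
    intro a b ha hb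
    refine HasDistribDeriv.congr (HasDistribDeriv.add ha hb) ?_ ?_
    · filter_upwards [D.ae_volume (Lp.coeFn_add a.fst b.fst)] with x hx
      exact hx.symm
    · filter_upwards [D.ae_volume (Lp.coeFn_add a.fst b.fst),
        D.ae_volume (Lp.coeFn_add a.snd b.snd)] with x hx hx'
      rw [WithLp.add_fst, WithLp.add_snd, hx, hx', Pi.add_apply, Pi.add_apply]
      ring
  smul_mem' := by
    intro c a ha
    refine HasDistribDeriv.congr (HasDistribDeriv.const_mul c ha) ?_ ?_
    · filter_upwards [D.ae_volume (Lp.coeFn_smul c a.fst)] with x hx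
      exact hx.symm
    · filter_upwards [D.ae_volume (Lp.coeFn_smul c a.fst),
        D.ae_volume (Lp.coeFn_smul c a.snd)] with x hx hx'
      rw [WithLp.smul_fst, WithLp.smul_snd, hx, hx', Pi.smul_apply, Pi.smul_apply,
        smul_eq_mul, smul_eq_mul]
      ring

/-- The value part of an element of `ℍ¹`, as an element of `L²_ρ(ℝ)`. -/
def val : D.H1 →L[ℝ] D.L2ρ := (WithLp.fstL 2 ℝ D.L2ρ D.L2ρ).comp D.H1.subtypeL

/-- `𝔻_{ρk} : ℍ¹ → L²_ρ(ℝ)`. -/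
def der : D.H1 →L[ℝ] D.L2ρ := (WithLp.sndL 2 ℝ D.L2ρ D.L2ρ).comp D.H1.subtypeL

/-- The closed subspace of all even functions in `ℍ¹`, which is the state space. -/
def EvenH1 : Submodule ℝ D.H1 where
  carrier := {w | ∀ᵐ x, D.val w (-x) = D.val w x}
  zero_mem' := by
    have h := D.ae_volume (Lp.coeFn_zero ℝ 2 D.μ)
    have h' := (Measure.measurePreserving_neg (volume : Measure ℝ)).quasiMeasurePreserving.ae h
    show ∀ᵐ x, D.val 0 (-x) = D.val 0 x
    rw [map_zero]
    filter_upwards [h, h'] with x hx hx'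
    rw [hx, hx', Pi.zero_apply, Pi.zero_apply]
  add_mem' := by
    intro a b ha hb
    have h := D.ae_volume (Lp.coeFn_add (D.val a) (D.val b))
    have h' := (Measure.measurePreserving_neg (volume : Measure ℝ)).quasiMeasurePreserving.ae h
    show ∀ᵐ x, D.val (a + b) (-x) = D.val (a + b) x
    rw [map_add]
    filter_upwards [h, h', ha, hb] with x hx hx' hxa hxb
    rw [hx, hx', Pi.add_apply, Pi.add_apply, hxa, hxb]
  smul_mem' := by
    intro c a ha
    have h := D.ae_volume (Lp.coeFn_smul c (D.val a))
    have h' := (Measure.measurePreserving_neg (volume : Measure ℝ)).quasiMeasurePreserving.ae h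
    show ∀ᵐ x, D.val (c • a) (-x) = D.val (c • a) x
    rw [map_smul]
    filter_upwards [h, h', ha] with x hx hx' hxa
    rw [hx, hx', Pi.smul_apply, Pi.smul_apply, hxa]

/-- A function representing a state. -/
def toFun (w : D.EvenH1) : ℝ → ℝ := D.val (w : D.H1)

/-- The space `ℍ⁻¹`, the dual of `ℍ¹` with the strong topology. -/
abbrev Hneg1 : Type := StrongDual ℝ D.H1

/-- The embedding of `ℍ¹` into `ℍ⁻¹` given by the pairing `⟪f, φ⟫ = ∫ f φ ρ dx`. -/
def embed (f : D.H1) : D.Hneg1 := (innerSL ℝ (D.val f)).comp D.val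

/-- `φ(0)` for `φ ∈ ℍ¹`: the value at `0` of the continuous representative of `φ`. This is
`⟪δ, φ⟫`. -/
def atZero (φ : D.H1) : ℝ :=
  (Classical.epsilon fun f : ℝ → ℝ => Continuous f ∧ D.val φ =ᵐ[volume] f) 0

/-! ### The control system and its reachable sets -/

/-- The value at `φ ∈ ℍ¹` of the distribution `𝔻²_{ρk} w - q w - 2 √((ρk)(0)) u δ`, where
`⟪𝔻_{ρk} f, φ⟫ = -⟪f, 𝔻_{ρk} φ⟫`. -/
def rhs (w : D.H1) (u : ℝ) (φ : D.H1) : ℝ :=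
  -(∫ x, D.der w x * D.der φ x ∂D.μ) - (∫ x, D.q x * D.val w x * D.val φ x ∂D.μ)
    - 2 * √(D.ρ 0 * D.k 0) * u * D.atZero φ

/-- `W : [0,T] → ℍ̂¹` is a solution of `W_t = 𝔻²_{ρk} W - q W - 2 √((ρk)(0)) u δ`, `W(·,0) = W⁰`:
it is continuous with values in `ℍ̂¹`, absolutely continuous with values in `ℍ⁻¹`, and for almost
every `t` its derivative in `ℍ⁻¹` exists and the equation holds in `ℍ⁻¹`. -/
structure IsSolution (T : ℝ) (u : ℝ → ℝ) (W0 : D.EvenH1) (W : ℝ → D.EvenH1) : Prop where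
  continuousOn : ContinuousOn W (Icc 0 T)
  absCont : AbsolutelyContinuousOnInterval (fun t => D.embed (W t)) 0 T
  equation : ∀ᵐ t ∂(volume.restrict (Ioo 0 T)),
    ∃ F : D.Hneg1, HasDerivAt (fun s => D.embed (W s)) F t ∧ ∀ φ : D.H1, F φ = D.rhs (W t) (u t) φ
  initial : W 0 = W0

/-- The set of all states `W(·,T)` reachable from `W⁰` by controls `u ∈ L^∞(0,T)` for which the
solution exists and is unique. -/
def reachable (T : ℝ) (W0 : D.EvenH1) : Set D.EvenH1 :=
  {WT | ∃ u : ℝ → ℝ, MemLp u ∞ (volume.restrict (Ioo 0 T)) ∧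
    ∃ W : ℝ → D.EvenH1, D.IsSolution T u W0 W ∧
      (∀ W' : ℝ → D.EvenH1, D.IsSolution T u W0 W' → EqOn W' W (Icc 0 T)) ∧ W T = WT}

/-- `W⁰` is controllable to `Wᵀ` in time `T`. -/
def Controllable (T : ℝ) (W0 WT : D.EvenH1) : Prop :=
  WT ∈ D.reachable T W0

/-- `W⁰` is approximately controllable to `Wᵀ` in time `T`. -/
def ApproxControllable (T : ℝ) (W0 WT : D.EvenH1) : Prop :=
  WT ∈ closure (D.reachable T W0)

end HeatData

/-! ### The constant coefficient data -/

theorem heatQ₁_one : heatQ₁ (fun _ => 1) (fun _ => 1) = fun _ => 0 := by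
  funext x; simp [heatQ₁]

theorem heatQ₂_one : heatQ₂ (fun _ => 1) (fun _ => 1) = fun _ => 0 := by
  funext x; simp [heatQ₂, heatQ₁_one]

theorem heatSigma_one : heatSigma (fun _ => 1) (fun _ => 1) = fun x => x := by
  funext x; simp [heatSigma]

/-- `ρ = k = 1`, `γ = 0`. Here `ℍ¹ = H¹(ℝ)`, and the control system is
`Z_t = Z_ξξ - 2uδ`, `Z(·,0) = Z⁰`. -/
def HeatData.flat : HeatData where
  ρ := fun _ => 1
  k := fun _ => 1
  γ := fun _ => 0
  even_ρ := fun _ => rfl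
  even_k := fun _ => rfl
  even_γ := fun _ => rfl
  pos_ρ := fun _ _ => one_pos
  pos_k := fun _ _ => one_pos
  contDiff_ρ := contDiffOn_const
  contDiff_k := contDiffOn_const
  contDiff_ρk := contDiffOn_const
  deriv_ρk := by simp
  sigma_atTop := by rw [heatSigma_one]; exact tendsto_id
  bounded_q := by simp [heatQ₂_one]
  contDiff_q := by simpa [heatQ₂_one] using contDiffOn_const
  integrable_q := by simp [heatQ₂_one]

/-! ### The transformation operator -/

/-- The domain `Ω = {(y₁,y₂) | y₂ > y₁ > 0}` of the kernel. -/
def kernelDomain : Set (ℝ × ℝ) := {p | 0 < p.1 ∧ p.1 < p.2}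

/-- `K` is the kernel of the transformation operator with potential `r`: it is of class `C²` on `Ω`,
`K_{y₁y₁} - K_{y₂y₂} = r(y₁) K` on `Ω`, `K(y,y) = ½ ∫_y^∞ r` for `y > 0` (as a limit from `Ω`), and
`K → 0` as `y₁ + y₂ → ∞` in `Ω`. -/
structure IsTransformKernel (r : ℝ → ℝ) (K : ℝ → ℝ → ℝ) : Prop where
  contDiff : ContDiffOn ℝ 2 (fun p : ℝ × ℝ => K p.1 p.2) kernelDomain
  equation : ∀ y₁ y₂ : ℝ, 0 < y₁ → y₁ < y₂ →
    iteratedDeriv 2 (fun s => K s y₂) y₁ - iteratedDeriv 2 (fun s => K y₁ s) y₂ = r y₁ * K y₁ y₂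
  diagonal : ∀ y : ℝ, 0 < y →
    Tendsto (fun p : ℝ × ℝ => K p.1 p.2) (𝓝[kernelDomain] (y, y)) (𝓝 ((∫ ξ in Ioi y, r ξ) / 2))
  atInfinity : ∀ ε : ℝ, 0 < ε → ∃ N : ℝ, ∀ y₁ y₂ : ℝ, 0 < y₁ → y₁ < y₂ → N < y₁ + y₂ →
    |K y₁ y₂| < ε

/-- The kernel with potential `r`. It is determined on `Ω`; its values elsewhere play no role. -/
def transformKernel (r : ℝ → ℝ) : ℝ → ℝ → ℝ := Classical.epsilon (IsTransformKernel r)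

/-- `(T̂_r g)(λ) = g(λ) + ∫_{|λ|}^∞ K(|λ|,ξ) g(ξ) dξ`. -/
def sturmTransform (r : ℝ → ℝ) (g : ℝ → ℝ) (l : ℝ) : ℝ :=
  g l + ∫ ξ in Ioi |l|, transformKernel r |l| ξ * g ξ

namespace HeatData

variable (D : HeatData)

/-- The transformed potential `r = q ∘ σ⁻¹`. -/
def r (l : ℝ) : ℝ := D.q (Function.invFun D.σ l)

/-- `𝐒 ψ = (ψ ∘ σ) / ⁴√(ρk)`. -/
def liouville (ψ : ℝ → ℝ) (x : ℝ) : ℝ := ψ (D.σ x) / (D.ρ x * D.k x) ^ (1 / 4 : ℝ)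

/-- The function `𝐒 T̂_r g`. -/
def transformFun (g : ℝ → ℝ) : ℝ → ℝ := D.liouville (sturmTransform D.r g)

/-- The transformation operator `𝕋̂ = 𝐒 T̂_r : Ĥ¹ → ℍ̂¹`: `𝕋̂ Z` is the element of `ℍ̂¹` represented
by the function `𝐒 T̂_r Z`. -/
def transform (Z : flat.EvenH1) : D.EvenH1 :=
  Classical.epsilon fun W : D.EvenH1 => D.toFun W =ᵐ[volume] D.transformFun (flat.toFun Z)

/-- The inverse operator `𝕋̂⁻¹ : ℍ̂¹ → Ĥ¹`. -/
def transformInv : D.EvenH1 → flat.EvenH1 := Function.invFun D.transform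

end HeatData

end

noncomputable section

/-! ### Functions of two real variables -/

/-! Both control systems are brought to the half-line and compared there. The Liouville substitution
`l = σ(x)`, combined with multiplication by the amplitude `⁴√(ρk)`, turns `𝔻` into `d/dl` and `L²_ρ`
isometrically into `L²(ℝ)`: the amplitude is an integrating factor for `𝔻`, and its square times
`√(ρ/k)` is `ρ`. Even states then become elements of `H¹(0,∞)`, and the point source at `0` becomes
a Neumann datum. System (1) reads `w' = ∂²w - r w` with `∂w(0) = v`, tested against `H¹(0,∞)`, where
`v` is the control times `⁴√(ρk)(0)` (`HeatData.isSolution_iff`). System (2) is the case `r = 0`.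

On the half-line the operator is `T = 1 + K` with a Volterra operator `K`. Its `L²` adjoint `T'`
also acts on `H¹(0,∞)` and keeps the value at `0`. Integration by parts and the wave equation for
the kernel give the weak intertwining relation `⟨(Tp)', q'⟩ + ⟨r Tp, q⟩ + ℓ(p) q(0) = ⟨p', (T'q)'⟩`
with a bounded functional `ℓ` on `H¹(0,∞)` (`TransformData.inner_der_equivT`). Hence `T` maps
solutions of the free equation with datum `v` to solutions of the perturbed equation with datum `v +
ℓ(w)`, and `T⁻¹` goes back with datum `v - ℓ(T⁻¹w)`. No feedback equation has to be solved, because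
the trajectory is given in both directions. Trajectories are continuous in `H¹`, so the correction
is a bounded function of time and the class of `L^∞` controls is preserved (`halfReachable_equivT`).
An energy estimate makes every solution unique (`IsHalfSolution.eq_zero`), so the uniqueness clause
in the reachable set costs nothing. Since the whole transformation is a linear homeomorphism,
closures of reachable sets correspond too.

The kernel needs four facts. In characteristic coordinates its problem is an integral equation of
Goursat type, solved on the whole plane by a contraction (`exists_goursat`, `exists_smoothKernel`).
It is determined on `Ω` (`IsTransformKernel.eqOn`), so the abstractly chosen `transformKernel`
agrees there with the constructed one. The finite first moment of `r` makes the kernel and its first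
derivatives square integrable over the sector (`memLp_upperPart`). Finally, `1 + K` is invertible on
`L²` because conjugation by a steep bounded weight makes `K` small (`isUnit_one_add_hsOp`); as `K`
maps `L²` into `H¹`, invertibility passes to `H¹`. -/

theorem hasFDerivAt_of_partials {f f₁ f₂ : ℝ → ℝ → ℝ}
    (h₁ : ∀ x y, HasDerivAt (fun s => f s y) (f₁ x y) x)
    (h₂ : ∀ x y, HasDerivAt (fun s => f x s) (f₂ x y) y)
    (c₁ : Continuous fun p : ℝ × ℝ => f₁ p.1 p.2) (c₂ : Continuous fun p : ℝ × ℝ => f₂ p.1 p.2)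
    (p : ℝ × ℝ) :
    HasFDerivAt (fun p : ℝ × ℝ => f p.1 p.2)
      (f₁ p.1 p.2 • ContinuousLinearMap.fst ℝ ℝ ℝ + f₂ p.1 p.2 • ContinuousLinearMap.snd ℝ ℝ ℝ)
      p := by
  have h := (hasStrictFDerivAt_uncurry_coprod (𝕜 := ℝ) (u := p) (f := f)
    (f₁ := fun x y => ContinuousLinearMap.toSpanSingleton ℝ (f₁ x y))
    (f₂ := fun x y => ContinuousLinearMap.toSpanSingleton ℝ (f₂ x y))
    (Eventually.of_forall fun v => (h₁ v.1 v.2).hasFDerivAt)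
    (Eventually.of_forall fun v => (h₂ v.1 v.2).hasFDerivAt)
    ((ContinuousLinearMap.toSpanSingletonLE ℝ ℝ ℝ).toLinearMap.continuous_of_finiteDimensional.comp c₁).continuousAt
    ((ContinuousLinearMap.toSpanSingletonLE ℝ ℝ ℝ).toLinearMap.continuous_of_finiteDimensional.comp c₂).continuousAt).hasFDerivAt
  refine h.congr_fderiv ?_
  ext <;> simp [Function.HasUncurry.uncurry]

theorem contDiff_succ_of_partials {n : ℕ} {f f₁ f₂ : ℝ → ℝ → ℝ}
    (h₁ : ∀ x y, HasDerivAt (fun s => f s y) (f₁ x y) x)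
    (h₂ : ∀ x y, HasDerivAt (fun s => f x s) (f₂ x y) y)
    (c₁ : ContDiff ℝ n fun p : ℝ × ℝ => f₁ p.1 p.2)
    (c₂ : ContDiff ℝ n fun p : ℝ × ℝ => f₂ p.1 p.2) :
    ContDiff ℝ (n + 1) (fun p : ℝ × ℝ => f p.1 p.2) := by
  rw [contDiff_succ_iff_hasFDerivAt]
  · refine ⟨_, ?_, hasFDerivAt_of_partials h₁ h₂ c₁.continuous c₂.continuous⟩
    exact (c₁.smul contDiff_const).add (c₂.smul contDiff_const)

/-! ### Tail integrals depending on a parameter -/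

section Tail

variable {r : ℝ → ℝ} {g g' : ℝ → ℝ → ℝ}

/-- Local boundedness of `g τ v` in `v`, uniformly in `τ`. -/
def LocBdd (g : ℝ → ℝ → ℝ) : Prop := ∀ v₀ : ℝ, ∃ C, ∀ᶠ v in 𝓝 v₀, ∀ τ, |g τ v| ≤ C

theorem integrable_mul_of_locBdd (hr : Integrable r) (hg : Continuous fun p : ℝ × ℝ => g p.1 p.2)
    (hb : LocBdd g) (v : ℝ) : Integrable fun τ => r τ * g τ v := by
  obtain ⟨C, hC⟩ := hb v
  refine hr.mul_bdd (c := C) (by fun_prop : Continuous fun τ => g τ v).aestronglyMeasurable ?_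
  exact Eventually.of_forall hC.self_of_nhds

theorem continuous_tail (hr : Integrable r) (hg : Continuous fun p : ℝ × ℝ => g p.1 p.2)
    (hb : LocBdd g) : Continuous fun p : ℝ × ℝ => ∫ τ in Ioi p.1, r τ * g τ p.2 := by
  rw [continuous_iff_continuousAt]
  rintro ⟨a, v⟩
  simp_rw [← integral_indicator measurableSet_Ioi]
  obtain ⟨C, hC⟩ := hb v
  refine continuousAt_of_dominated (bound := fun τ => |r τ| * C) ?_ ?_ (hr.abs.mul_const C) ?_
  · exact Eventually.of_forall fun p =>
      (integrable_mul_of_locBdd hr hg hb p.2).aestronglyMeasurable.indicator measurableSet_Ioi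
  · have : ∀ᶠ p : ℝ × ℝ in 𝓝 (a, v), ∀ τ, |g τ p.2| ≤ C :=
      (continuous_snd.tendsto (a, v)).eventually hC
    filter_upwards [this] with p hp
    refine Eventually.of_forall fun τ => (norm_indicator_le_norm_self _ _).trans ?_
    rw [Real.norm_eq_abs, abs_mul]
    exact mul_le_mul_of_nonneg_left (hp τ) (abs_nonneg _)
  -- For fixed `τ` the indicator of the tail is locally constant in `p` near `(a, v)` unless `τ =
  -- a`, which is a null event.
  · have : ∀ᵐ τ : ℝ, τ ≠ a := by simp [ae_iff, measure_singleton]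
    filter_upwards [this] with τ hτ
    rcases lt_or_gt_of_ne hτ with h | h
    · refine (continuousAt_const (y := (0:ℝ))).congr ?_
      have : ∀ᶠ p : ℝ × ℝ in 𝓝 (a, v), τ < p.1 :=
        (continuous_fst.tendsto (a, v)).eventually (lt_mem_nhds h)
      filter_upwards [this] with p hp
      rw [indicator_of_notMem (by simpa using hp.le)]
    · have hc : ContinuousAt (fun p : ℝ × ℝ => r τ * g τ p.2) (a, v) := by fun_prop
      refine hc.congr ?_
      have : ∀ᶠ p : ℝ × ℝ in 𝓝 (a, v), p.1 < τ :=
        (continuous_fst.tendsto (a, v)).eventually (gt_mem_nhds h)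
      filter_upwards [this] with p hp
      rw [indicator_of_mem (by simpa using hp)]

theorem hasDerivAt_integral_Ioi {f : ℝ → ℝ} (hf : Integrable f) {a : ℝ} (hc : ContinuousAt f a) :
    HasDerivAt (fun x => ∫ τ in Ioi x, f τ) (-f a) a := by
  have h : ∀ x, ∫ τ in Ioi x, f τ = (∫ τ in Ioi a, f τ) - ∫ τ in a..x, f τ := by
    intro x
    rw [intervalIntegral.integral_Ioi_sub_Ioi' hf.integrableOn hf.integrableOn |>.symm]
    ring
  rw [funext h, ← zero_sub]
  refine (hasDerivAt_const a _).sub ?_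
  exact intervalIntegral.integral_hasDerivAt_right hf.intervalIntegrable
    (hf.aestronglyMeasurable.stronglyMeasurableAtFilter) hc

/-- No derivative of `r` appears: the lower limit contributes only a boundary term and the parameter
acts on `g` alone. This is why the inner Goursat integral is studied as a function of its limit `a =
u - t`. -/
theorem contDiff_one_tail (hr : Integrable r) (hrc : Continuous r)
    (h₂ : ∀ x y, HasDerivAt (fun s => g x s) (g' x y) y)
    (hg : Continuous fun p : ℝ × ℝ => g p.1 p.2) (hg' : Continuous fun p : ℝ × ℝ => g' p.1 p.2)
    (hb : LocBdd g) (hb' : LocBdd g') :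
    ContDiff ℝ 1 (fun p : ℝ × ℝ => ∫ τ in Ioi p.1, r τ * g τ p.2) := by
  refine contDiff_succ_of_partials (n := 0) (f := fun a v => ∫ τ in Ioi a, r τ * g τ v)
    (f₁ := fun a v => -(r a * g a v)) (f₂ := fun a v => ∫ τ in Ioi a, r τ * g' τ v) ?_ ?_ ?_ ?_
  · intro a v
    exact hasDerivAt_integral_Ioi (integrable_mul_of_locBdd hr hg hb v)
      (by fun_prop)
  · intro a v
    obtain ⟨C, hC⟩ := hb' v
    refine (hasDerivAt_integral_of_dominated_loc_of_deriv_le (bound := fun τ => |r τ| * C)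
      (F' := fun v τ => r τ * g' τ v) hC ?_ ?_ ?_ ?_ ?_ ?_).2
    · exact Eventually.of_forall fun w =>
        (integrable_mul_of_locBdd hr hg hb w).integrableOn.aestronglyMeasurable
    · exact (integrable_mul_of_locBdd hr hg hb v).integrableOn
    · exact (integrable_mul_of_locBdd hr hg' hb' v).integrableOn.aestronglyMeasurable
    · refine Eventually.of_forall fun τ x hx => ?_
      rw [Real.norm_eq_abs, abs_mul]
      exact mul_le_mul_of_nonneg_left (hx τ) (abs_nonneg _)
    · exact (hr.abs.mul_const C).integrableOn
    · exact Eventually.of_forall fun τ x _ => (h₂ τ x).const_mul (r τ)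
  · exact contDiff_zero.2 (by fun_prop)
  · exact contDiff_zero.2 (continuous_tail hr hg' hb')

/-- Differentiation of `∫₀ᵛ h(u,t) dt`. -/
theorem hasDerivAt_intervalIntegral_param {h h' : ℝ → ℝ → ℝ}
    (h₁ : ∀ x y, HasDerivAt (fun s => h s y) (h' x y) x)
    (hc : Continuous fun p : ℝ × ℝ => h p.1 p.2) (hc' : Continuous fun p : ℝ × ℝ => h' p.1 p.2)
    (a b u : ℝ) :
    HasDerivAt (fun u => ∫ t in a..b, h u t) (∫ t in a..b, h' u t) u := by
  have hK : IsCompact (Icc (u - 1) (u + 1) ×ˢ uIcc a b) := isCompact_Icc.prod isCompact_uIcc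
  obtain ⟨C, hC⟩ := hK.exists_bound_of_continuousOn hc'.continuousOn
  refine (intervalIntegral.hasDerivAt_integral_of_dominated_loc_of_deriv_le (bound := fun _ => C)
    (F' := h') (s := Icc (u - 1) (u + 1)) (Icc_mem_nhds (by linarith) (by linarith))
    ?_ ?_ ?_ ?_ ?_ ?_).2
  · exact Eventually.of_forall fun x =>
      (by fun_prop : Continuous fun t => h x t).aestronglyMeasurable
  · exact (by fun_prop : Continuous fun t => h u t).intervalIntegrable _ _
  · exact (by fun_prop : Continuous fun t => h' u t).aestronglyMeasurable
  · exact Eventually.of_forall fun t ht x hx => hC (x, t) ⟨hx, uIoc_subset_uIcc ht⟩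
  · exact intervalIntegrable_const
  · exact Eventually.of_forall fun t _ x _ => h₁ x t

theorem contDiff_one_intervalIntegral {h h' : ℝ → ℝ → ℝ}
    (h₁ : ∀ x y, HasDerivAt (fun s => h s y) (h' x y) x)
    (hc : Continuous fun p : ℝ × ℝ => h p.1 p.2) (hc' : Continuous fun p : ℝ × ℝ => h' p.1 p.2) :
    ContDiff ℝ 1 (fun p : ℝ × ℝ => ∫ t in (0 : ℝ)..p.2, h p.1 t) := by
  refine contDiff_succ_of_partials (n := 0) (f := fun u v => ∫ t in (0 : ℝ)..v, h u t)
    (f₁ := fun u v => ∫ t in (0 : ℝ)..v, h' u t) (f₂ := h) ?_ ?_ ?_ (contDiff_zero.2 hc)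
  · exact fun u v => hasDerivAt_intervalIntegral_param h₁ hc hc' 0 v u
  · intro u v
    have : Continuous fun t => h u t := by fun_prop
    exact intervalIntegral.integral_hasDerivAt_right (this.intervalIntegrable _ _)
      this.aestronglyMeasurable.stronglyMeasurableAtFilter this.continuousAt
  · refine contDiff_zero.2 ?_
    have : Continuous (Function.uncurry fun (p : ℝ × ℝ) t => h' p.1 t) := by
      simp only [Function.uncurry_def]; fun_prop
    exact intervalIntegral.continuous_parametric_intervalIntegral_of_continuous this continuous_snd

end Tail

/-! ### Potentials with finite first moment -/

/-- A potential on the line with the properties used in the construction of the kernel. -/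
structure MomentPotential (r : ℝ → ℝ) : Prop where
  contDiff : ContDiff ℝ 1 r
  integrable : Integrable r
  bounded : ∃ M, ∀ x, |r x| ≤ M
  moment : IntegrableOn (fun x => x * r x) (Ioi 0)

/-- `∫ₓ^∞ |r|`. -/
def tailAbs (r : ℝ → ℝ) (x : ℝ) : ℝ := ∫ τ in Ioi x, |r τ|

/-- The weight `exp (2 ∫ₓ^∞ tailAbs r)`. -/
def tailWeight (r : ℝ → ℝ) (x : ℝ) : ℝ :=
  Real.exp (2 * ((∫ s in Ioi (0 : ℝ), tailAbs r s) - ∫ s in (0 : ℝ)..x, tailAbs r s))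

theorem tailAbs_nonneg (r : ℝ → ℝ) (x : ℝ) : 0 ≤ tailAbs r x :=
  integral_nonneg fun _ => abs_nonneg _

theorem tailWeight_pos (r : ℝ → ℝ) (x : ℝ) : 0 < tailWeight r x := Real.exp_pos _

namespace MomentPotential

variable {r : ℝ → ℝ} (hr : MomentPotential r)
include hr

theorem continuous : Continuous r := hr.contDiff.continuous

theorem tailAbs_antitone : Antitone (tailAbs r) := fun _ _ hxy =>
  setIntegral_mono_set hr.integrable.abs.integrableOn
    (Eventually.of_forall fun _ => abs_nonneg _) (Ioi_subset_Ioi hxy).eventuallyLE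

theorem hasDerivAt_tailAbs (x : ℝ) : HasDerivAt (tailAbs r) (-|r x|) x :=
  hasDerivAt_integral_Ioi hr.integrable.abs hr.continuous.abs.continuousAt

theorem continuous_tailAbs : Continuous (tailAbs r) :=
  continuous_iff_continuousAt.2 fun x => (hr.hasDerivAt_tailAbs x).continuousAt

/-- On the tail one has `x ≤ τ`, so the factor `x` can be moved under the integral and replaced by
`τ`. The resulting decay of order `1/x` gives both `K → 0` at infinity and the square integrability
of the kernel. -/
theorem mul_tailAbs_le {x : ℝ} (hx : 0 ≤ x) :
    x * tailAbs r x ≤ ∫ τ in Ioi (0 : ℝ), τ * |r τ| := by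
  have hi : IntegrableOn (fun τ => τ * |r τ|) (Ioi 0) := by
    refine hr.moment.abs.congr ?_
    filter_upwards [ae_restrict_mem measurableSet_Ioi] with τ hτ
    rw [abs_mul, abs_of_pos hτ]
  have h1 : x * tailAbs r x ≤ ∫ τ in Ioi x, τ * |r τ| := by
    rw [tailAbs, ← integral_const_mul]
    refine setIntegral_mono_on (hr.integrable.abs.const_mul x).integrableOn
      (hi.mono_set (Ioi_subset_Ioi hx)) measurableSet_Ioi fun τ hτ => ?_
    exact mul_le_mul_of_nonneg_right (le_of_lt hτ) (abs_nonneg _)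
  refine h1.trans (setIntegral_mono_set hi ?_ (Ioi_subset_Ioi hx).eventuallyLE)
  filter_upwards [ae_restrict_mem measurableSet_Ioi] with τ hτ
  exact mul_nonneg (le_of_lt hτ) (abs_nonneg _)

theorem integrableOn_tailAbs : IntegrableOn (tailAbs r) (Ioi 0) := by
  have hi : IntegrableOn (fun τ => τ * |r τ|) (Ioi 0) := by
    refine hr.moment.abs.congr ?_
    filter_upwards [ae_restrict_mem measurableSet_Ioi] with τ hτ
    rw [abs_mul, abs_of_pos hτ]
  set m := ∫ τ in Ioi (0 : ℝ), τ * |r τ| with hm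
  -- Integrating the derivative of `x * tailAbs r x` over `(0,n)` gives `∫ tailAbs = n * tailAbs r n
  -- + ∫ x |r|`. Each of the two terms is at most the first moment `m`.
  refine integrableOn_Ioi_of_intervalIntegral_norm_bounded (m + m) 0
    (fun n : ℕ => (hr.continuous_tailAbs.integrableOn_Icc).mono_set Ioc_subset_Icc_self)
    tendsto_natCast_atTop_atTop (Eventually.of_forall fun n => ?_)
  have hn : (0 : ℝ) ≤ n := n.cast_nonneg
  have e : ∀ x, ‖tailAbs r x‖ = tailAbs r x := fun x => by
    rw [Real.norm_of_nonneg (tailAbs_nonneg r x)]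
  simp_rw [e]
  have h1 : ∫ x in (0 : ℝ)..n, (1 * tailAbs r x + x * -|r x|) = n * tailAbs r n - 0 * tailAbs r 0 := by
    have hc := hr.continuous_tailAbs
    have hc' := hr.continuous
    exact intervalIntegral.integral_eq_sub_of_hasDerivAt (f := fun x => x * tailAbs r x)
      (fun x _ => (hasDerivAt_id x).mul (hr.hasDerivAt_tailAbs x))
      ((by fun_prop : Continuous _).intervalIntegrable _ _)
  have hc := hr.continuous_tailAbs
  have hc' := hr.continuous
  rw [intervalIntegral.integral_add ((by fun_prop : Continuous _).intervalIntegrable _ _)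
    ((by fun_prop : Continuous _).intervalIntegrable _ _)] at h1
  simp only [one_mul, mul_neg, intervalIntegral.integral_neg, zero_mul, sub_zero] at h1
  have h2 : ∫ x in (0 : ℝ)..n, x * |r x| ≤ m := by
    rw [intervalIntegral.integral_of_le hn]
    refine setIntegral_mono_set hi ?_ Ioc_subset_Ioi_self.eventuallyLE
    filter_upwards [ae_restrict_mem measurableSet_Ioi] with τ hτ
    exact mul_nonneg (le_of_lt hτ) (abs_nonneg _)
  linarith [hr.mul_tailAbs_le hn]

theorem hasDerivAt_tailWeight (x : ℝ) :
    HasDerivAt (tailWeight r) (-(2 * (tailAbs r x * tailWeight r x))) x := by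
  have h : HasDerivAt (fun x => ∫ s in (0 : ℝ)..x, tailAbs r s) (tailAbs r x) x :=
    intervalIntegral.integral_hasDerivAt_right (hr.continuous_tailAbs.intervalIntegrable _ _)
      hr.continuous_tailAbs.aestronglyMeasurable.stronglyMeasurableAtFilter
      hr.continuous_tailAbs.continuousAt
  refine ((h.const_sub _).const_mul 2).exp.congr_deriv ?_
  simp only [tailWeight]
  ring

theorem continuous_tailWeight : Continuous (tailWeight r) :=
  continuous_iff_continuousAt.2 fun x => (hr.hasDerivAt_tailWeight x).continuousAt

theorem tailWeight_antitone : Antitone (tailWeight r) :=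
  antitone_of_hasDerivAt_nonpos hr.hasDerivAt_tailWeight fun x => by
    simp only [Pi.zero_apply]
    have := mul_nonneg (tailAbs_nonneg r x) (tailWeight_pos r x).le
    linarith

theorem one_le_tailWeight {x : ℝ} (hx : 0 ≤ x) : 1 ≤ tailWeight r x := by
  rw [tailWeight, Real.one_le_exp_iff, intervalIntegral.integral_of_le hx]
  have := setIntegral_mono_set hr.integrableOn_tailAbs
    (Eventually.of_forall (tailAbs_nonneg r))
    (Ioc_subset_Ioi_self : Ioc 0 x ⊆ Ioi 0).eventuallyLE
  linarith

theorem hasDerivAt_half_tailWeight (u t : ℝ) :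
    HasDerivAt (fun t => tailWeight r (u - t) / 2) (tailAbs r (u - t) * tailWeight r (u - t)) t := by
  refine (((hr.hasDerivAt_tailWeight (u - t)).comp t ((hasDerivAt_id t).const_sub u)).div_const
    2).congr_deriv ?_
  ring

/-- The factor `2` in the exponent of the weight is chosen so that `tailAbs * tailWeight` integrates
to half the weight. The remaining half absorbs the inhomogeneous term in `abs_goursatStep_le`, and
the same gain of `1/2` closes the uniqueness argument. -/
theorem integral_tailAbs_mul_tailWeight (u a b : ℝ) :
    ∫ t in a..b, tailAbs r (u - t) * tailWeight r (u - t) =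
      tailWeight r (u - b) / 2 - tailWeight r (u - a) / 2 := by
  have h1 := hr.continuous_tailAbs
  have h2 := hr.continuous_tailWeight
  exact intervalIntegral.integral_eq_sub_of_hasDerivAt
    (fun t _ => hr.hasDerivAt_half_tailWeight u t)
    ((by fun_prop : Continuous _).intervalIntegrable _ _)

end MomentPotential

/-! ### The Goursat problem in characteristic coordinates -/

theorem LocBdd.of_le {g : ℝ → ℝ → ℝ} {B : ℝ → ℝ} (hB : Continuous B)
    (h : ∀ τ v, |g τ v| ≤ B v) : LocBdd g := fun v₀ =>
  ⟨B v₀ + 1, by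
    filter_upwards [hB.continuousAt.eventually (gt_mem_nhds (lt_add_one (B v₀)))] with v hv τ
    exact (h τ v).trans hv.le⟩

/-- The inner integral `∫_{u-t}^∞ r(τ) F(τ+t,t) dτ`, at `a = u - t`. -/
def goursatInner (r : ℝ → ℝ) (F : ℝ → ℝ → ℝ) (a t : ℝ) : ℝ := ∫ τ in Ioi a, r τ * F (τ + t) t

/-- `½ ∫ᵤ^∞ r + ∫₀ᵛ ∫ᵤ^∞ r(s-t) F(s,t) ds dt`. -/
def goursatStep (r : ℝ → ℝ) (F : ℝ → ℝ → ℝ) (u v : ℝ) : ℝ :=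
  (∫ τ in Ioi u, r τ) / 2 + ∫ t in (0 : ℝ)..v, goursatInner r F (u - t) t

/-- Since `cosh` is even and dominates `|sinh|`, one weight controls integrals from `0` in both
directions, with a gain `1/L` that makes the Goursat map contract on the whole plane. -/
theorem abs_integral_cosh_le {L : ℝ} (hL : 0 < L) (v : ℝ) :
    |∫ t in (0 : ℝ)..v, Real.cosh (L * t)| ≤ Real.cosh (L * v) / L := by
  have : ∫ t in (0 : ℝ)..v, Real.cosh (L * t) = Real.sinh (L * v) / L := by
    have := intervalIntegral.integral_eq_sub_of_hasDerivAt (a := 0) (b := v)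
      (f := fun t => Real.sinh (L * t) / L) (f' := fun t => Real.cosh (L * t)) (fun t _ => by
        refine ((((hasDerivAt_id t).const_mul L).sinh).div_const L).congr_deriv ?_
        simp only [id]
        field_simp) ((by fun_prop : Continuous _).intervalIntegrable _ _)
    simpa using this
  rw [this, abs_div, abs_of_pos hL]
  gcongr
  rw [abs_le]
  constructor
  · have := Real.exp_pos (L * v)
    have h := Real.cosh_add_sinh (L * v)
    linarith
  · have := Real.exp_pos (-(L * v))
    have h := Real.cosh_sub_sinh (L * v)
    linarith

section Goursat

variable {r : ℝ → ℝ} (hr : MomentPotential r) {F : ℝ → ℝ → ℝ} {B : ℝ → ℝ}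
include hr

theorem continuous_goursatInner (hF : Continuous fun p : ℝ × ℝ => F p.1 p.2)
    (hB : Continuous B) (h : ∀ u v, |F u v| ≤ B v) :
    Continuous fun p : ℝ × ℝ => goursatInner r F p.1 p.2 :=
  continuous_tail (g := fun τ t => F (τ + t) t) hr.integrable
    (hF.comp (by fun_prop : Continuous fun p : ℝ × ℝ => (p.1 + p.2, p.2)))
    (LocBdd.of_le hB fun τ v => h (τ + v) v)

theorem continuous_goursatStep (hF : Continuous fun p : ℝ × ℝ => F p.1 p.2)
    (hB : Continuous B) (h : ∀ u v, |F u v| ≤ B v) :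
    Continuous fun p : ℝ × ℝ => goursatStep r F p.1 p.2 := by
  have h1 : Continuous fun x => ∫ τ in Ioi x, r τ := continuous_iff_continuousAt.2 fun x =>
    (hasDerivAt_integral_Ioi hr.integrable hr.continuous.continuousAt).continuousAt
  have h2 := continuous_goursatInner hr hF hB h
  refine ((h1.comp continuous_fst).div_const 2).add ?_
  refine intervalIntegral.continuous_parametric_intervalIntegral_of_continuous
    (f := fun (p : ℝ × ℝ) t => goursatInner r F (p.1 - t) t) ?_ continuous_snd
  exact h2.comp (by fun_prop : Continuous fun q : (ℝ × ℝ) × ℝ => (q.1.1 - q.2, q.2))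

theorem abs_goursatInner_le {C : ℝ} {t : ℝ} (h : ∀ u, |F u t| ≤ C) (a : ℝ) :
    |goursatInner r F a t| ≤ (∫ τ, |r τ|) * C := by
  have hC : 0 ≤ C := (abs_nonneg _).trans (h 0)
  calc |goursatInner r F a t| ≤ ∫ τ in Ioi a, |r τ| * C := by
        rw [← Real.norm_eq_abs, goursatInner]
        refine norm_integral_le_of_norm_le (hr.integrable.abs.mul_const C).integrableOn ?_
        refine Eventually.of_forall fun τ => ?_
        rw [Real.norm_eq_abs, abs_mul]
        exact mul_le_mul_of_nonneg_left (h _) (abs_nonneg _)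
    _ ≤ ∫ τ, |r τ| * C := setIntegral_le_integral (hr.integrable.abs.mul_const C)
        (Eventually.of_forall fun τ => mul_nonneg (abs_nonneg _) hC)
    _ = _ := integral_mul_const _ _

theorem goursatInner_sub {G : ℝ → ℝ → ℝ} (hF : Continuous fun p : ℝ × ℝ => F p.1 p.2)
    (hG : Continuous fun p : ℝ × ℝ => G p.1 p.2)
    (hB : Continuous B) (h : ∀ u v, |F u v| ≤ B v) (h' : ∀ u v, |G u v| ≤ B v) (a t : ℝ) :
    goursatInner r F a t - goursatInner r G a t =
      goursatInner r (fun u v => F u v - G u v) a t := by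
  have hc : Continuous fun p : ℝ × ℝ => (p.1 + p.2, p.2) := by fun_prop
  have i1 := integrable_mul_of_locBdd (g := fun τ t => F (τ + t) t) hr.integrable
    (hF.comp hc) (LocBdd.of_le hB fun τ v => h (τ + v) v) t
  have i2 := integrable_mul_of_locBdd (g := fun τ t => G (τ + t) t) hr.integrable
    (hG.comp hc) (LocBdd.of_le hB fun τ v => h' (τ + v) v) t
  simp only [goursatInner]
  rw [← integral_sub i1.integrableOn i2.integrableOn]
  simp only [mul_sub]

/-- The bound in the sector `0 ≤ v ≤ u` that is preserved by `goursatStep`. -/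
theorem abs_goursatStep_le
    (hb : ∀ u v, 0 ≤ v → v ≤ u → |F u v| ≤ tailAbs r u * tailWeight r (u - v)) {u v : ℝ}
    (hv : 0 ≤ v) (hvu : v ≤ u) :
    |goursatStep r F u v| ≤ tailAbs r u * tailWeight r (u - v) := by
  have inner : ∀ t, t ∈ Icc 0 v → |goursatInner r F (u - t) t| ≤
      tailAbs r u * (tailAbs r (u - t) * tailWeight r (u - t)) := by
    rintro t ⟨ht0, htv⟩
    have e : tailAbs r u * (tailAbs r (u - t) * tailWeight r (u - t)) =
        ∫ τ in Ioi (u - t), |r τ| * (tailAbs r u * tailWeight r (u - t)) := by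
      rw [integral_mul_const, tailAbs, tailAbs]; ring
    rw [e, ← Real.norm_eq_abs, goursatInner]
    refine norm_integral_le_of_norm_le (hr.integrable.abs.mul_const _).integrableOn ?_
    filter_upwards [ae_restrict_mem measurableSet_Ioi] with τ hτ
    rw [mem_Ioi] at hτ
    rw [Real.norm_eq_abs, abs_mul]
    refine mul_le_mul_of_nonneg_left ((hb _ _ ht0 (by linarith)).trans ?_) (abs_nonneg _)
    exact mul_le_mul (hr.tailAbs_antitone (by linarith)) (hr.tailWeight_antitone (by linarith))
      (tailWeight_pos _ _).le (tailAbs_nonneg _ _)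
  have h1 : |(∫ τ in Ioi u, r τ) / 2| ≤ tailAbs r u / 2 := by
    rw [abs_div, abs_two]
    gcongr
    exact abs_integral_le_integral_abs
  have c1 := hr.continuous_tailAbs
  have c2 := hr.continuous_tailWeight
  have h2 : |∫ t in (0 : ℝ)..v, goursatInner r F (u - t) t| ≤
      tailAbs r u * (tailWeight r (u - v) / 2 - tailWeight r (u - 0) / 2) := by
    rw [← hr.integral_tailAbs_mul_tailWeight, ← intervalIntegral.integral_const_mul,
      ← Real.norm_eq_abs]
    refine intervalIntegral.norm_integral_le_of_norm_le hv
      (Eventually.of_forall fun t ht => inner t ⟨ht.1.le, ht.2⟩)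
      ((by fun_prop : Continuous _).intervalIntegrable _ _)
  have h3 := hr.one_le_tailWeight (x := u - v) (by linarith)
  have h4 := (tailWeight_pos r (u - 0)).le
  have h5 := tailAbs_nonneg r u
  have h6 := hr.one_le_tailWeight (x := u - 0) (by linarith)
  -- The inhomogeneous term costs `1/2` and the integral at most half of `tailWeight r (u - v)`,
  -- both times `tailAbs r u`. The sum is at most the full weight because the weight is at least `1`
  -- for `u - v ≥ 0`.
  refine (abs_add_le _ _).trans ((add_le_add h1 h2).trans ?_)
  nlinarith

/-- Banach's fixed point theorem in the supremum norm weighted by `cosh (L v)`; with `L = 2N + 1`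
the integral term has norm at most `N / L ≤ 1/2`. Solving on all of the plane avoids boundary issues
on the diagonal and on the axis. The sharper sector bound is not visible in this norm; it is
preserved by the iteration started at `0` and survives in the limit. -/
theorem exists_goursat : ∃ F : ℝ → ℝ → ℝ, (Continuous fun p : ℝ × ℝ => F p.1 p.2) ∧
    (∃ B : ℝ → ℝ, Continuous B ∧ ∀ u v, |F u v| ≤ B v) ∧
    (∀ u v, F u v = goursatStep r F u v) ∧
    ∀ u v, 0 ≤ v → v ≤ u → |F u v| ≤ tailAbs r u * tailWeight r (u - v) := by
  set N := ∫ τ, |r τ| with hN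
  have hN0 : 0 ≤ N := integral_nonneg fun _ => abs_nonneg _
  set L := 2 * N + 1 with hL
  have hL0 : 0 < L := by positivity
  have hNL : N / L ≤ 1 / 2 := by rw [div_le_iff₀ hL0]; linarith
  have hcosh : ∀ v, 0 < Real.cosh (L * v) := fun v => Real.cosh_pos _
  -- A bounded function `f` encodes the possibly unbounded candidate `cosh (L v) * f`, so the
  -- weighted space is complete for free.
  let F : BoundedContinuousFunction (ℝ × ℝ) ℝ → ℝ → ℝ → ℝ :=
    fun f u v => Real.cosh (L * v) * f (u, v)
  have Fc : ∀ f, Continuous fun p : ℝ × ℝ => F f p.1 p.2 := fun f => by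
    have := f.continuous
    simp only [F]; fun_prop
  have Fb : ∀ f u v, |F f u v| ≤ ‖f‖ * Real.cosh (L * v) := fun f u v => by
    rw [abs_mul, abs_of_pos (hcosh v), mul_comm]
    exact mul_le_mul_of_nonneg_right (f.norm_coe_le_norm _) (hcosh v).le
  have Bc : ∀ C, Continuous fun v => C * Real.cosh (L * v) := fun C => by fun_prop
  have est : ∀ (G : ℝ → ℝ → ℝ) (C : ℝ), 0 ≤ C → (∀ u v, |G u v| ≤ C * Real.cosh (L * v)) →
      ∀ u v, |∫ t in (0 : ℝ)..v, goursatInner r G (u - t) t| ≤ C / 2 * Real.cosh (L * v) := by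
    intro G C hC hG u v
    have h1 : |∫ t in (0 : ℝ)..v, goursatInner r G (u - t) t| ≤
        |∫ t in (0 : ℝ)..v, N * (C * Real.cosh (L * t))| := by
      rw [← Real.norm_eq_abs]
      refine intervalIntegral.norm_integral_le_abs_of_norm_le
        (g := fun t => N * (C * Real.cosh (L * t))) (Eventually.of_forall fun t => ?_) ((by fun_prop : Continuous _).intervalIntegrable _ _)
      exact abs_goursatInner_le hr (fun u => hG u t) (u - t)
    refine h1.trans ?_
    simp_rw [← mul_assoc]
    rw [intervalIntegral.integral_const_mul, abs_mul, abs_of_nonneg (mul_nonneg hN0 hC)]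
    calc N * C * |∫ t in (0 : ℝ)..v, Real.cosh (L * t)|
        ≤ N * C * (Real.cosh (L * v) / L) :=
          mul_le_mul_of_nonneg_left (abs_integral_cosh_le hL0 v) (mul_nonneg hN0 hC)
      _ = N / L * (C * Real.cosh (L * v)) := by ring
      _ ≤ 1 / 2 * (C * Real.cosh (L * v)) :=
          mul_le_mul_of_nonneg_right hNL (mul_nonneg hC (hcosh v).le)
      _ = _ := by ring
  let Φ : BoundedContinuousFunction (ℝ × ℝ) ℝ → BoundedContinuousFunction (ℝ × ℝ) ℝ := fun f =>
    BoundedContinuousFunction.ofNormedAddCommGroup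
      (fun p => goursatStep r (F f) p.1 p.2 / Real.cosh (L * p.2))
      ((continuous_goursatStep hr (Fc f) (Bc ‖f‖) (Fb f)).div₀ (by fun_prop)
        fun p => (hcosh p.2).ne')
      (N / 2 + ‖f‖ / 2) (by
        rintro ⟨u, v⟩
        rw [Real.norm_eq_abs, abs_div, abs_of_pos (hcosh v), div_le_iff₀ (hcosh v)]
        refine (abs_add_le _ _).trans ?_
        have h1 : |(∫ τ in Ioi u, r τ) / 2| ≤ N / 2 := by
          rw [abs_div, abs_two]
          gcongr
          exact abs_integral_le_integral_abs.trans (setIntegral_le_integral hr.integrable.abs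
            (Eventually.of_forall fun τ => abs_nonneg _))
        have h2 := est (F f) ‖f‖ (norm_nonneg _) (Fb f) u v
        have h3 := Real.one_le_cosh (L * v)
        have h4 : N / 2 ≤ N / 2 * Real.cosh (L * v) := le_mul_of_one_le_right (by positivity) h3
        linarith)
  have hΦ : ∀ f u v, F (Φ f) u v = goursatStep r (F f) u v := fun f u v => by
    show Real.cosh (L * v) * (goursatStep r (F f) u v / Real.cosh (L * v)) = _
    field_simp [(hcosh v).ne']
  have hcontr : ContractingWith (1 / 2) Φ := by
    refine ⟨by
      rw [← NNReal.coe_lt_coe]; norm_num, LipschitzWith.of_dist_le_mul fun f g => ?_⟩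
    rw [BoundedContinuousFunction.dist_le (by positivity)]
    rintro ⟨u, v⟩
    show |goursatStep r (F f) u v / _ - goursatStep r (F g) u v / _| ≤ _
    rw [← sub_div, abs_div, abs_of_pos (hcosh v), div_le_iff₀ (hcosh v)]
    have c1 := continuous_goursatInner hr (Fc f) (Bc ‖f‖) (Fb f)
    have c2 := continuous_goursatInner hr (Fc g) (Bc ‖g‖) (Fb g)
    have cm : Continuous fun t : ℝ => (u - t, t) := by fun_prop
    have c1' : Continuous fun t => goursatInner r (F f) (u - t) t := c1.comp cm
    have c2' : Continuous fun t => goursatInner r (F g) (u - t) t := c2.comp cm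
    have e : goursatStep r (F f) u v - goursatStep r (F g) u v =
        ∫ t in (0 : ℝ)..v, goursatInner r (fun u v => F f u v - F g u v) (u - t) t := by
      simp only [goursatStep]
      rw [add_sub_add_left_eq_sub, ← intervalIntegral.integral_sub
        (c1'.intervalIntegrable _ _) (c2'.intervalIntegrable _ _)]
      refine intervalIntegral.integral_congr fun t _ => ?_
      exact goursatInner_sub hr (Fc f) (Fc g) (Bc (‖f‖ + ‖g‖))
        (fun u v => (Fb f u v).trans (by
          have := mul_nonneg (norm_nonneg g) (hcosh v).le; linarith))
        (fun u v => (Fb g u v).trans (by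
          have := mul_nonneg (norm_nonneg f) (hcosh v).le; linarith)) _ _
    rw [e]
    refine (est _ (dist f g) dist_nonneg (fun u v => ?_) u v).trans (le_of_eq ?_)
    · simp only [F]
      rw [← mul_sub, abs_mul, abs_of_pos (hcosh v), mul_comm]
      refine mul_le_mul_of_nonneg_right ?_ (hcosh v).le
      rw [← Real.dist_eq]
      exact BoundedContinuousFunction.dist_coe_le_dist (u, v)
    · push_cast; ring
  have hfix := hcontr.fixedPoint_isFixedPt
  set f₀ := ContractingWith.fixedPoint Φ hcontr with hf₀
  refine ⟨F f₀, Fc f₀, ⟨_, Bc ‖f₀‖, Fb f₀⟩, fun u v => ?_, fun u v hv hvu => ?_⟩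
  · rw [← hΦ, hfix]
  · have hiter : ∀ n : ℕ, ∀ u v, 0 ≤ v → v ≤ u →
        |F (Φ^[n] 0) u v| ≤ tailAbs r u * tailWeight r (u - v) := by
      intro n
      induction n with
      | zero =>
        intro u v _ _
        simpa [F] using mul_nonneg (tailAbs_nonneg r u) (tailWeight_pos r (u - v)).le
      | succ n ih =>
        intro u v hv hvu
        rw [Function.iterate_succ_apply', hΦ]
        exact abs_goursatStep_le hr ih hv hvu
    -- The bound is a closed condition at each point, and uniform convergence of the encoded
    -- functions gives pointwise convergence of the candidates.
    have hlim := hcontr.tendsto_iterate_fixedPoint 0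
    have h1 : Tendsto (fun n => F (Φ^[n] 0) u v) atTop (𝓝 (F f₀ u v)) := by
      refine Tendsto.const_mul _ ?_
      rw [tendsto_iff_dist_tendsto_zero] at hlim ⊢
      exact squeeze_zero (fun _ => dist_nonneg)
        (fun n => BoundedContinuousFunction.dist_coe_le_dist (u, v)) hlim
    exact le_of_tendsto h1.abs (Eventually.of_forall fun n => hiter n u v hv hvu)

end Goursat

/-- A function of class `C²` on the plane with the properties of the kernel of the transformation
operator with potential `r`, together with its derivatives `∂₁K`, `∂₂K`, `∂₁²K`, `∂₂²K`. -/
structure SmoothKernel (r : ℝ → ℝ) (K K₁ K₂ K₁₁ K₂₂ : ℝ → ℝ → ℝ) : Prop where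
  contDiff : ContDiff ℝ 2 fun p : ℝ × ℝ => K p.1 p.2
  hasDerivAt₁ : ∀ x y, HasDerivAt (fun s => K s y) (K₁ x y) x
  hasDerivAt₂ : ∀ x y, HasDerivAt (fun s => K x s) (K₂ x y) y
  hasDerivAt₁₁ : ∀ x y, HasDerivAt (fun s => K₁ s y) (K₁₁ x y) x
  hasDerivAt₂₂ : ∀ x y, HasDerivAt (fun s => K₂ x s) (K₂₂ x y) y
  continuous₁ : Continuous fun p : ℝ × ℝ => K₁ p.1 p.2
  continuous₂ : Continuous fun p : ℝ × ℝ => K₂ p.1 p.2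
  continuous₁₁ : Continuous fun p : ℝ × ℝ => K₁₁ p.1 p.2
  continuous₂₂ : Continuous fun p : ℝ × ℝ => K₂₂ p.1 p.2
  equation : ∀ x y, K₁₁ x y - K₂₂ x y = r x * K x y
  diagonal : ∀ x, K x x = (∫ ξ in Ioi x, r ξ) / 2
  bound : ∃ C, 0 ≤ C ∧ ∀ x y, 0 ≤ x → x ≤ y → |K x y| ≤ C * tailAbs r ((x + y) / 2) ∧
    |K₁ x y| ≤ |r ((x + y) / 2)| + C * tailAbs r ((x + y) / 2) ∧
    |K₂ x y| ≤ |r ((x + y) / 2)| + C * tailAbs r ((x + y) / 2)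

/-- Derivatives along the lines `y₂ = const` and `y₁ = const` in characteristic coordinates. -/
theorem hasDerivAt_characteristic {G G₁ G₂ : ℝ → ℝ → ℝ}
    (h : ∀ p : ℝ × ℝ, HasFDerivAt (fun p : ℝ × ℝ => G p.1 p.2)
      (G₁ p.1 p.2 • ContinuousLinearMap.fst ℝ ℝ ℝ + G₂ p.1 p.2 • ContinuousLinearMap.snd ℝ ℝ ℝ) p)
    (x y : ℝ) :
    HasDerivAt (fun s => G ((s + y) / 2) ((y - s) / 2))
      ((G₁ ((x + y) / 2) ((y - x) / 2) - G₂ ((x + y) / 2) ((y - x) / 2)) / 2) x ∧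
    HasDerivAt (fun s => G ((x + s) / 2) ((s - x) / 2))
      ((G₁ ((x + y) / 2) ((y - x) / 2) + G₂ ((x + y) / 2) ((y - x) / 2)) / 2) y := by
  constructor
  · have h1 : HasDerivAt (fun s : ℝ => ((s + y) / 2, (y - s) / 2)) ((1 : ℝ) / 2, (-1 : ℝ) / 2) x :=
      (((hasDerivAt_id x).add_const y).div_const 2).prodMk
        (((hasDerivAt_id x).const_sub y).div_const 2)
    refine ((h ((x + y) / 2, (y - x) / 2)).comp_hasDerivAt x h1).congr_deriv ?_
    simp
    ring
  · have h1 : HasDerivAt (fun s : ℝ => ((x + s) / 2, (s - x) / 2)) ((1 : ℝ) / 2, (1 : ℝ) / 2) y :=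
      (((hasDerivAt_id y).const_add x).div_const 2).prodMk
        (((hasDerivAt_id y).sub_const x).div_const 2)
    refine ((h ((x + y) / 2, (y - x) / 2)).comp_hasDerivAt y h1).congr_deriv ?_
    simp
    ring

/-! ### Regularity of the Goursat solution and existence of a smooth kernel. -/

section

variable {r : ℝ → ℝ} (hr : MomentPotential r) {F : ℝ → ℝ → ℝ} {B : ℝ → ℝ}

/-- The derivative of a solution of the Goursat problem with respect to `u`. -/
def goursatDeriv (r : ℝ → ℝ) (F : ℝ → ℝ → ℝ) (u v : ℝ) : ℝ :=
  -r u / 2 - ∫ t in (0 : ℝ)..v, r (u - t) * F u t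

include hr

theorem hasDerivAt_goursatInner (hF : Continuous fun p : ℝ × ℝ => F p.1 p.2)
    (hB : Continuous B) (h : ∀ u v, |F u v| ≤ B v) (t u : ℝ) :
    HasDerivAt (fun u => goursatInner r F (u - t) t) (-(r (u - t) * F u t)) u := by
  have hc : Continuous fun p : ℝ × ℝ => (p.1 + p.2, p.2) := by fun_prop
  have i1 := integrable_mul_of_locBdd (g := fun τ t => F (τ + t) t) hr.integrable
    (hF.comp hc) (LocBdd.of_le hB fun τ v => h (τ + v) v) t
  have hrc := hr.continuous
  have hF' : Continuous fun τ => F (τ + t) t :=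
    hF.comp (by fun_prop : Continuous fun τ : ℝ => (τ + t, t))
  have := (hasDerivAt_integral_Ioi i1 (a := u - t) (by fun_prop)).comp u
    ((hasDerivAt_id u).sub_const t)
  refine this.congr_deriv ?_
  simp

theorem hasDerivAt_goursat_left (hF : Continuous fun p : ℝ × ℝ => F p.1 p.2)
    (hB : Continuous B) (h : ∀ u v, |F u v| ≤ B v) (he : ∀ u v, F u v = goursatStep r F u v)
    (u v : ℝ) : HasDerivAt (fun s => F s v) (goursatDeriv r F u v) u := by
  have hrc := hr.continuous
  have h1 : HasDerivAt (fun s => ∫ t in (0 : ℝ)..v, goursatInner r F (s - t) t)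
      (∫ t in (0 : ℝ)..v, -(r (u - t) * F u t)) u := by
    refine hasDerivAt_intervalIntegral_param (h := fun s t => goursatInner r F (s - t) t)
      (h' := fun s t => -(r (s - t) * F s t))
      (fun s t => hasDerivAt_goursatInner hr hF hB h t s) ?_ (by fun_prop) 0 v u
    exact (continuous_goursatInner hr hF hB h).comp
      (by fun_prop : Continuous fun p : ℝ × ℝ => (p.1 - p.2, p.2))
  have h2 := (hasDerivAt_integral_Ioi hr.integrable hrc.continuousAt (a := u)).div_const 2
  rw [show (fun s => F s v) = fun s => goursatStep r F s v from funext fun s => he s v]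
  refine (h2.add h1).congr_deriv ?_
  rw [goursatDeriv, intervalIntegral.integral_neg]
  ring

theorem hasDerivAt_goursat_right (hF : Continuous fun p : ℝ × ℝ => F p.1 p.2)
    (hB : Continuous B) (h : ∀ u v, |F u v| ≤ B v) (he : ∀ u v, F u v = goursatStep r F u v)
    (u v : ℝ) : HasDerivAt (fun s => F u s) (goursatInner r F (u - v) v) v := by
  have hc : Continuous fun t => goursatInner r F (u - t) t :=
    (continuous_goursatInner hr hF hB h).comp (by fun_prop : Continuous fun t : ℝ => (u - t, t))
  rw [show (fun s => F u s) = fun s => goursatStep r F u s from funext fun s => he u s]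
  exact (intervalIntegral.integral_hasDerivAt_right (hc.intervalIntegrable _ _)
    hc.aestronglyMeasurable.stronglyMeasurableAtFilter hc.continuousAt).const_add _

theorem continuous_goursatDeriv (hF : Continuous fun p : ℝ × ℝ => F p.1 p.2) :
    Continuous fun p : ℝ × ℝ => goursatDeriv r F p.1 p.2 := by
  have hrc := hr.continuous
  simp only [goursatDeriv]
  refine Continuous.sub (by fun_prop) ?_
  refine intervalIntegral.continuous_parametric_intervalIntegral_of_continuous
    (f := fun (p : ℝ × ℝ) t => r (p.1 - t) * F p.1 t) ?_ continuous_snd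
  simp only [Function.uncurry_def]
  fun_prop

/-- The fixed point equation already supplies both first derivatives of `F`. Differentiating `F (τ +
t) t` in `t` gives their sum, in which the inner integral reappears with limit `τ`, so the tail
integral can be differentiated once more. -/
theorem contDiff_goursatInner (hF : Continuous fun p : ℝ × ℝ => F p.1 p.2)
    (hB : Continuous B) (h : ∀ u v, |F u v| ≤ B v) (he : ∀ u v, F u v = goursatStep r F u v) :
    ContDiff ℝ 1 fun p : ℝ × ℝ => goursatInner r F (p.1 - p.2) p.2 := by
  have hrc := hr.continuous
  obtain ⟨M, hM⟩ := hr.bounded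
  have cI := continuous_goursatInner hr hF hB h
  have cD := continuous_goursatDeriv hr hF
  have hc : Continuous fun p : ℝ × ℝ => (p.1 + p.2, p.2) := by fun_prop
  have hcI : Continuous fun p : ℝ × ℝ => goursatInner r F (p.1 - p.2) p.2 :=
    cI.comp (by fun_prop : Continuous fun p : ℝ × ℝ => (p.1 - p.2, p.2))
  have hfd := hasFDerivAt_of_partials (hasDerivAt_goursat_left hr hF hB h he)
    (hasDerivAt_goursat_right hr hF hB h he) cD hcI
  have key : ContDiff ℝ 1 fun p : ℝ × ℝ => goursatInner r F p.1 p.2 := by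
    refine contDiff_one_tail (g := fun τ t => F (τ + t) t)
      (g' := fun τ t => goursatDeriv r F (τ + t) t + goursatInner r F τ t)
      hr.integrable hrc ?_ (hF.comp hc) ((cD.comp hc).add cI)
      (LocBdd.of_le hB fun τ v => h (τ + v) v) ?_
    · intro τ t
      have h1 : HasDerivAt (fun s : ℝ => (τ + s, s)) ((1 : ℝ), (1 : ℝ)) t :=
        ((hasDerivAt_id t).const_add τ).prodMk (hasDerivAt_id t)
      refine ((hfd (τ + t, t)).comp_hasDerivAt (f := fun s : ℝ => (τ + s, s)) t h1).congr_deriv ?_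
      simp
    -- The majorant must be independent of `τ`. The sup bound `M` of `r` handles the `u`-derivative,
    -- and the `L¹` norm of `r` handles the inner integral.
    · refine LocBdd.of_le (B := fun v => M / 2 + |∫ t in (0 : ℝ)..v, M * B t| + (∫ τ, |r τ|) * B v)
        ?_ ?_
      · have : Continuous fun v => ∫ t in (0 : ℝ)..v, M * B t :=
          intervalIntegral.continuous_primitive
            (fun a b => (by fun_prop : Continuous _).intervalIntegrable _ _) 0
        fun_prop
      · intro τ v
        refine (abs_add_le _ _).trans (add_le_add ?_
          (abs_goursatInner_le hr (fun u => h u v) τ))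
        refine (abs_sub _ _).trans (add_le_add ?_ ?_)
        · rw [abs_div, abs_neg, abs_two]
          gcongr
          exact hM _
        · rw [← Real.norm_eq_abs]
          refine intervalIntegral.norm_integral_le_abs_of_norm_le (g := fun t => M * B t)
            (Eventually.of_forall fun t => ?_)
            ((by fun_prop : Continuous _).intervalIntegrable _ _)
          rw [Real.norm_eq_abs, abs_mul]
          exact mul_le_mul (hM _) (h _ _) (abs_nonneg _) ((abs_nonneg _).trans (hM 0))
  exact key.comp (by fun_prop : ContDiff ℝ 1 fun p : ℝ × ℝ => (p.1 - p.2, p.2))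

/-- Here the differentiability of `r` is used: the integration runs over `t` at fixed `u`, so `u`
enters through `r (u - t)` itself and not through a limit of integration. -/
theorem contDiff_goursatDeriv (hF : Continuous fun p : ℝ × ℝ => F p.1 p.2)
    (hB : Continuous B) (h : ∀ u v, |F u v| ≤ B v) (he : ∀ u v, F u v = goursatStep r F u v) :
    ContDiff ℝ 1 fun p : ℝ × ℝ => goursatDeriv r F p.1 p.2 := by
  have hrc := hr.continuous
  have hrd : Continuous (deriv r) := hr.contDiff.continuous_deriv le_rfl
  have cD := continuous_goursatDeriv hr hF
  have hr1 : ∀ x, HasDerivAt r (deriv r x) x := fun x =>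
    (hr.contDiff.differentiable one_ne_zero x).hasDerivAt
  refine ContDiff.sub ?_ ?_
  · exact ((hr.contDiff.comp contDiff_fst).neg).div_const 2
  · refine contDiff_one_intervalIntegral (h := fun u t => r (u - t) * F u t)
      (h' := fun u t => deriv r (u - t) * F u t + r (u - t) * goursatDeriv r F u t) ?_
      (by fun_prop) (by fun_prop)
    intro u t
    have h1 : HasDerivAt (fun s => r (s - t)) (deriv r (u - t)) u :=
      (hr1 (u - t)).comp_sub_const u t
    exact h1.mul (hasDerivAt_goursat_left hr hF hB h he u t)

/-- With `u = (x + y)/2` and `v = (y - x)/2` the wave operator becomes minus the mixed derivative,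
and the integral equation says precisely that the mixed derivative of `F` is `-r(u - v) F`. Since `u
- v = x`, this is the kernel equation; the diagonal is `v = 0`. The estimates on the first
derivatives come from the sector bound on `F`. -/
theorem exists_smoothKernel : ∃ K K₁ K₂ K₁₁ K₂₂, SmoothKernel r K K₁ K₂ K₁₁ K₂₂ := by
  obtain ⟨F, hF, ⟨B, hB, h⟩, he, hb⟩ := exists_goursat hr
  set P : ℝ → ℝ → ℝ := fun u v => goursatInner r F (u - v) v with hP
  set D : ℝ → ℝ → ℝ := goursatDeriv r F with hD
  have hrc := hr.continuous
  have cP : ContDiff ℝ 1 fun p : ℝ × ℝ => P p.1 p.2 := contDiff_goursatInner hr hF hB h he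
  have cD : ContDiff ℝ 1 fun p : ℝ × ℝ => D p.1 p.2 := contDiff_goursatDeriv hr hF hB h he
  have hF1 := hasDerivAt_goursat_left hr hF hB h he
  have hF2 := hasDerivAt_goursat_right hr hF hB h he
  have dF := hasFDerivAt_of_partials hF1 hF2 cD.continuous cP.continuous
  have cF : ContDiff ℝ 2 fun p : ℝ × ℝ => F p.1 p.2 :=
    contDiff_succ_of_partials (n := 1) hF1 hF2 cD cP
  -- the derivatives of `P` and `D`
  have part : ∀ {G : ℝ → ℝ → ℝ}, (ContDiff ℝ 1 fun p : ℝ × ℝ => G p.1 p.2) →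
      (∀ u v, HasDerivAt (fun s => G s v) (fderiv ℝ (fun p : ℝ × ℝ => G p.1 p.2) (u, v) (1, 0)) u)
      ∧ (∀ u v, HasDerivAt (fun s => G u s)
        (fderiv ℝ (fun p : ℝ × ℝ => G p.1 p.2) (u, v) (0, 1)) v)
      ∧ (∀ e, Continuous fun p : ℝ × ℝ => fderiv ℝ (fun p : ℝ × ℝ => G p.1 p.2) p e) := by
    intro G hG
    refine ⟨fun u v => ?_, fun u v => ?_, fun e => ?_⟩
    · have h1 : HasDerivAt (fun s : ℝ => (s, v)) ((1 : ℝ), (0 : ℝ)) u :=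
        (hasDerivAt_id u).prodMk (hasDerivAt_const u v)
      exact ((hG.differentiable one_ne_zero (u, v)).hasFDerivAt).comp_hasDerivAt u h1
    · have h1 : HasDerivAt (fun s : ℝ => (u, s)) ((0 : ℝ), (1 : ℝ)) v :=
        (hasDerivAt_const v u).prodMk (hasDerivAt_id v)
      exact ((hG.differentiable one_ne_zero (u, v)).hasFDerivAt).comp_hasDerivAt v h1
    · exact (hG.continuous_fderiv one_ne_zero).clm_apply continuous_const
  obtain ⟨_, pP2, pPc⟩ := part cP
  obtain ⟨pD1, _, pDc⟩ := part cD
  -- The mixed derivative, reached explicitly in both orders: as the `u`-derivative of `P` and as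
  -- the `v`-derivative of `D`.
  set R : ℝ → ℝ → ℝ := fun u v => -(r (u - v) * F u v) with hR
  have cR : Continuous fun p : ℝ × ℝ => R p.1 p.2 := by simp only [hR]; fun_prop
  have hP1 : ∀ u v, HasDerivAt (fun s => P s v) (R u v) u := fun u v =>
    hasDerivAt_goursatInner hr hF hB h v u
  have hD2 : ∀ u v, HasDerivAt (fun s => D u s) (R u v) v := fun u v => by
    have hc : Continuous fun t => r (u - t) * F u t := by fun_prop
    refine ((intervalIntegral.integral_hasDerivAt_right (hc.intervalIntegrable 0 v)
      hc.aestronglyMeasurable.stronglyMeasurableAtFilter hc.continuousAt).const_sub _)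
  set P2 : ℝ → ℝ → ℝ := fun u v => fderiv ℝ (fun p : ℝ × ℝ => P p.1 p.2) (u, v) (0, 1)
  set D1 : ℝ → ℝ → ℝ := fun u v => fderiv ℝ (fun p : ℝ × ℝ => D p.1 p.2) (u, v) (1, 0)
  have cP2 : Continuous fun p : ℝ × ℝ => P2 p.1 p.2 := pPc (0, 1)
  have cD1 : Continuous fun p : ℝ × ℝ => D1 p.1 p.2 := pDc (1, 0)
  have dP := hasFDerivAt_of_partials hP1 pP2 cR cP2
  have dD := hasFDerivAt_of_partials pD1 hD2 cD1 cR
  have cm : Continuous fun p : ℝ × ℝ => ((p.1 + p.2) / 2, (p.2 - p.1) / 2) := by fun_prop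
  have cP' := cP.continuous.comp cm
  have cD' := cD.continuous.comp cm
  have cP2' := cP2.comp cm
  have cD1' := cD1.comp cm
  have cR' := cR.comp cm
  refine ⟨fun x y => F ((x + y) / 2) ((y - x) / 2),
    fun x y => (D ((x + y) / 2) ((y - x) / 2) - P ((x + y) / 2) ((y - x) / 2)) / 2,
    fun x y => (D ((x + y) / 2) ((y - x) / 2) + P ((x + y) / 2) ((y - x) / 2)) / 2,
    fun x y => ((D1 ((x + y) / 2) ((y - x) / 2) - R ((x + y) / 2) ((y - x) / 2)) / 2 -
      (R ((x + y) / 2) ((y - x) / 2) - P2 ((x + y) / 2) ((y - x) / 2)) / 2) / 2,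
    fun x y => ((D1 ((x + y) / 2) ((y - x) / 2) + R ((x + y) / 2) ((y - x) / 2)) / 2 +
      (R ((x + y) / 2) ((y - x) / 2) + P2 ((x + y) / 2) ((y - x) / 2)) / 2) / 2,
    ?_, ?_, ?_, ?_, ?_, ?_, ?_, ?_, ?_, ?_, ?_, ?_⟩
  · exact cF.comp (by fun_prop : ContDiff ℝ 2 fun p : ℝ × ℝ => ((p.1 + p.2) / 2, (p.2 - p.1) / 2))
  · exact fun x y => (hasDerivAt_characteristic dF x y).1
  · exact fun x y => (hasDerivAt_characteristic dF x y).2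
  · intro x y
    have h1 := (hasDerivAt_characteristic (G := D) (G₁ := D1) (G₂ := R) dD x y).1
    have h2 := (hasDerivAt_characteristic (G := P) (G₁ := R) (G₂ := P2) dP x y).1
    exact (h1.sub h2).div_const 2
  · intro x y
    have h1 := (hasDerivAt_characteristic (G := D) (G₁ := D1) (G₂ := R) dD x y).2
    have h2 := (hasDerivAt_characteristic (G := P) (G₁ := R) (G₂ := P2) dP x y).2
    exact (h1.add h2).div_const 2
  · exact (cD'.sub cP').div_const 2
  · exact (cD'.add cP').div_const 2
  · exact (((cD1'.sub cR').div_const 2).sub ((cR'.sub cP2').div_const 2)).div_const 2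
  · exact (((cD1'.add cR').div_const 2).add ((cR'.add cP2').div_const 2)).div_const 2
  · intro x y
    have e : (x + y) / 2 - (y - x) / 2 = x := by ring
    simp only [hR, e]
    ring
  · intro x
    simp only [add_self_div_two, sub_self, zero_div]
    rw [he]
    simp [goursatStep]
  · set A := tailAbs r 0
    set w := tailWeight r 0
    have hA : 0 ≤ A := tailAbs_nonneg r 0
    have hw : 1 ≤ w := hr.one_le_tailWeight le_rfl
    have hFb : ∀ u v, 0 ≤ v → v ≤ u → |F u v| ≤ w * tailAbs r u := fun u v hv hvu => by
      rw [mul_comm]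
      exact (hb u v hv hvu).trans (mul_le_mul_of_nonneg_left
        (hr.tailWeight_antitone (by linarith)) (tailAbs_nonneg r u))
    have hPb : ∀ u v, 0 ≤ v → v ≤ u → |P u v| ≤ A * w * tailAbs r u := fun u v hv hvu => by
      rw [← Real.norm_eq_abs]
      calc ‖P u v‖ ≤ ∫ τ in Ioi (u - v), |r τ| * (w * tailAbs r u) := by
            refine norm_integral_le_of_norm_le (hr.integrable.abs.mul_const _).integrableOn ?_
            filter_upwards [ae_restrict_mem measurableSet_Ioi] with τ hτ
            rw [mem_Ioi] at hτ
            rw [Real.norm_eq_abs, abs_mul]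
            refine mul_le_mul_of_nonneg_left ((hFb _ _ hv (by linarith)).trans ?_) (abs_nonneg _)
            exact mul_le_mul_of_nonneg_left (hr.tailAbs_antitone (by linarith)) (by linarith)
        _ = tailAbs r (u - v) * (w * tailAbs r u) := integral_mul_const _ _
        _ ≤ A * (w * tailAbs r u) := mul_le_mul_of_nonneg_right
            (hr.tailAbs_antitone (by linarith))
            (mul_nonneg (by linarith) (tailAbs_nonneg r u))
        _ = _ := by ring
    have hDb : ∀ u v, 0 ≤ v → v ≤ u → |D u v| ≤ |r u| / 2 + A * w * tailAbs r u :=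
      fun u v hv hvu => by
      refine (abs_sub _ _).trans (add_le_add ?_ ?_)
      · rw [abs_div, abs_neg, abs_two]
      · rw [← Real.norm_eq_abs]
        calc ‖∫ t in (0 : ℝ)..v, r (u - t) * F u t‖
            ≤ ∫ t in (0 : ℝ)..v, |r (u - t)| * (w * tailAbs r u) := by
              refine intervalIntegral.norm_integral_le_of_norm_le hv
                (Eventually.of_forall fun t ht => ?_)
                ((by fun_prop : Continuous _).intervalIntegrable _ _)
              rw [Real.norm_eq_abs, abs_mul]
              exact mul_le_mul_of_nonneg_left (hFb _ _ ht.1.le (ht.2.trans hvu)) (abs_nonneg _)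
          _ = (∫ t in (u - v)..(u - 0), |r t|) * (w * tailAbs r u) := by
              rw [intervalIntegral.integral_mul_const,
                intervalIntegral.integral_comp_sub_left (fun t => |r t|) u]
          _ ≤ A * (w * tailAbs r u) := by
              refine mul_le_mul_of_nonneg_right ?_
                (mul_nonneg (by linarith) (tailAbs_nonneg r u))
              rw [intervalIntegral.integral_of_le (by linarith)]
              refine setIntegral_mono_set hr.integrable.abs.integrableOn
                (Eventually.of_forall fun _ => abs_nonneg _) (LE.le.eventuallyLE ?_)
              intro t ht
              exact lt_of_le_of_lt (by linarith) ht.1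
          _ = _ := by ring
    have hw0 : 0 ≤ A * w := mul_nonneg hA (by linarith)
    -- One constant for three estimates: `w` serves `F`, and `A * w` serves the half sums of `D` and
    -- `P`.
    refine ⟨A * w + w, by linarith, fun x y hx hxy => ?_⟩
    have h1 : 0 ≤ (y - x) / 2 := by linarith
    have h2 : (y - x) / 2 ≤ (x + y) / 2 := by linarith
    set u := (x + y) / 2
    set v := (y - x) / 2
    have f1 := hFb u v h1 h2
    have f2 := abs_le.1 (hPb u v h1 h2)
    have f3 := abs_le.1 (hDb u v h1 h2)
    have f4 := tailAbs_nonneg r u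
    have f5 := abs_nonneg (r u)
    have f6 : 0 ≤ w * tailAbs r u := mul_nonneg (by linarith) f4
    have f7 : 0 ≤ A * w * tailAbs r u := mul_nonneg hw0 f4
    rw [add_mul]
    refine ⟨by linarith, abs_le.2 ⟨?_, ?_⟩, abs_le.2 ⟨?_, ?_⟩⟩ <;> linarith

end

/-! ### Characterization and uniqueness of the kernel on `Ω`. -/

theorem isOpen_kernelDomain : IsOpen kernelDomain :=
  (isOpen_lt continuous_const continuous_fst).inter (isOpen_lt continuous_fst continuous_snd)

theorem IsTransformKernel.congr {r r' : ℝ → ℝ} {K : ℝ → ℝ → ℝ} (h : IsTransformKernel r K)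
    (hr : EqOn r r' (Ioi 0)) : IsTransformKernel r' K where
  contDiff := h.contDiff
  equation y₁ y₂ h₁ h₂ := by rw [h.equation y₁ y₂ h₁ h₂, hr h₁]
  diagonal y hy := by
    rw [← setIntegral_congr_fun measurableSet_Ioi fun x (hx : y < x) => hr (hy.trans hx)]
    exact h.diagonal y hy
  atInfinity := h.atInfinity

theorem SmoothKernel.isTransformKernel {r : ℝ → ℝ} (hr : MomentPotential r)
    {K K₁ K₂ K₁₁ K₂₂ : ℝ → ℝ → ℝ} (h : SmoothKernel r K K₁ K₂ K₁₁ K₂₂) :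
    IsTransformKernel r K where
  contDiff := h.contDiff.contDiffOn
  equation y₁ y₂ _ _ := by
    have e1 : deriv (fun s => K s y₂) = fun s => K₁ s y₂ :=
      funext fun s => (h.hasDerivAt₁ s y₂).deriv
    have e2 : deriv (fun s => K y₁ s) = fun s => K₂ y₁ s :=
      funext fun s => (h.hasDerivAt₂ y₁ s).deriv
    rw [iteratedDeriv_succ, iteratedDeriv_one, iteratedDeriv_succ, iteratedDeriv_one, e1, e2,
      (h.hasDerivAt₁₁ y₁ y₂).deriv, (h.hasDerivAt₂₂ y₁ y₂).deriv]
    exact h.equation y₁ y₂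
  diagonal y _ := by
    rw [← h.diagonal y]
    exact (h.contDiff.continuous.tendsto (y, y)).mono_left nhdsWithin_le_nhds
  atInfinity ε hε := by
    obtain ⟨C, hC, hb⟩ := h.bound
    set m := ∫ τ in Ioi (0 : ℝ), τ * |r τ| with hm
    have hm0 : 0 ≤ m := by
      refine setIntegral_nonneg measurableSet_Ioi fun τ hτ => mul_nonneg (le_of_lt hτ) (abs_nonneg _)
    -- The kernel is at most `C * tailAbs r u` at `u = (y₁ + y₂)/2`, and `u * tailAbs r u ≤ m`. So
    -- it suffices that `u * ε` exceeds `C * m`; the factor `2` turns the bound on `u` into one on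
    -- `y₁ + y₂`.
    refine ⟨2 * ((C * m + 1) / ε), fun y₁ y₂ h₁ h₂ hN => ?_⟩
    have hu : (C * m + 1) / ε < (y₁ + y₂) / 2 := by linarith
    refine (hb y₁ y₂ h₁.le h₂.le).1.trans_lt ?_
    set u := (y₁ + y₂) / 2
    have hu0 : 0 < u := lt_of_le_of_lt (by positivity) hu
    rw [div_lt_iff₀ hε] at hu
    have h3 := hr.mul_tailAbs_le hu0.le
    have h4 : u * (C * tailAbs r u) ≤ C * m := by
      calc u * (C * tailAbs r u) = C * (u * tailAbs r u) := by ring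
        _ ≤ _ := mul_le_mul_of_nonneg_left h3 hC
    by_contra hcon
    push Not at hcon
    have := mul_le_mul_of_nonneg_left hcon hu0.le
    linarith

/-- The mixed second derivative of a kernel in characteristic coordinates. -/
theorem IsTransformKernel.exists_mixed {r : ℝ → ℝ} {K : ℝ → ℝ → ℝ} (h : IsTransformKernel r K) :
    ∃ a : ℝ → ℝ → ℝ, ∀ s t, 0 < t → t < s →
      HasDerivAt (fun t => K (s - t) (s + t)) (a s t) t ∧
      HasDerivAt (fun s => a s t) (-(r (s - t) * K (s - t) (s + t))) s := by
  set G : ℝ × ℝ → ℝ := fun p => K p.1 p.2 with hG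
  have cd : ∀ p ∈ kernelDomain, ContDiffAt ℝ 2 G p := fun p hp =>
    h.contDiff.contDiffAt (isOpen_kernelDomain.mem_nhds hp)
  have d1 : ∀ p ∈ kernelDomain, HasFDerivAt G (fderiv ℝ G p) p := fun p hp =>
    ((cd p hp).differentiableAt two_ne_zero).hasFDerivAt
  have d2 : ∀ p ∈ kernelDomain, HasFDerivAt (fderiv ℝ G) (fderiv ℝ (fderiv ℝ G) p) p :=
    fun p hp => (((cd p hp).fderiv_right (m := 1) (by norm_num)).differentiableAt
      one_ne_zero).hasFDerivAt
  refine ⟨fun s t => fderiv ℝ G (s - t, s + t) (-1, 1), fun s t ht hts => ?_⟩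
  have hp : (s - t, s + t) ∈ kernelDomain := ⟨by simpa using hts, by simp; linarith⟩
  constructor
  · have h1 : HasDerivAt (fun t : ℝ => (s - t, s + t)) ((-1 : ℝ), (1 : ℝ)) t :=
      ((hasDerivAt_id t).const_sub s).prodMk ((hasDerivAt_id t).const_add s)
    exact (d1 _ hp).comp_hasDerivAt (f := fun t : ℝ => (s - t, s + t)) t h1
  · have h1 : HasDerivAt (fun s : ℝ => (s - t, s + t)) ((1 : ℝ), (1 : ℝ)) s :=
      ((hasDerivAt_id s).sub_const t).prodMk ((hasDerivAt_id s).add_const t)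
    have h2 := (d2 _ hp).comp_hasDerivAt (f := fun s : ℝ => (s - t, s + t)) s h1
    have h3 : HasDerivAt (fun s => fderiv ℝ G (s - t, s + t) (-1, 1))
        (fderiv ℝ (fderiv ℝ G) (s - t, s + t) (1, 1) (-1, 1)) s :=
      h2.clm_apply (hasDerivAt_const s ((-1 : ℝ), (1 : ℝ))) |>.congr_deriv (by simp)
    refine h3.congr_deriv ?_
    have hsym : IsSymmSndFDerivAt ℝ G (s - t, s + t) :=
      (cd _ hp).isSymmSndFDerivAt (by simp)
    set y₁ := s - t
    set y₂ := s + t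
    set H := fderiv ℝ (fderiv ℝ G) (y₁, y₂)
    have e11 : iteratedDeriv 2 (fun x => K x y₂) y₁ = H (1, 0) (1, 0) := by
      rw [iteratedDeriv_succ, iteratedDeriv_one]
      have ev : deriv (fun x => K x y₂) =ᶠ[𝓝 y₁] fun x => fderiv ℝ G (x, y₂) (1, 0) := by
        have : ∀ᶠ x in 𝓝 y₁, (x, y₂) ∈ kernelDomain :=
          (by fun_prop : ContinuousAt (fun x : ℝ => (x, y₂)) y₁).eventually
            (isOpen_kernelDomain.mem_nhds hp)
        filter_upwards [this] with x hx
        have g1 : HasDerivAt (fun x : ℝ => (x, y₂)) ((1 : ℝ), (0 : ℝ)) x :=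
          (hasDerivAt_id x).prodMk (hasDerivAt_const x y₂)
        exact ((d1 _ hx).comp_hasDerivAt (f := fun x : ℝ => (x, y₂)) x g1).deriv
      rw [ev.deriv_eq]
      have g1 : HasDerivAt (fun x : ℝ => (x, y₂)) ((1 : ℝ), (0 : ℝ)) y₁ :=
        (hasDerivAt_id y₁).prodMk (hasDerivAt_const y₁ y₂)
      have g2 := ((d2 _ hp).comp_hasDerivAt (f := fun x : ℝ => (x, y₂)) y₁ g1).clm_apply
        (hasDerivAt_const y₁ ((1 : ℝ), (0 : ℝ)))
      refine g2.deriv.trans ?_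
      simp [H]
    have e22 : iteratedDeriv 2 (fun x => K y₁ x) y₂ = H (0, 1) (0, 1) := by
      rw [iteratedDeriv_succ, iteratedDeriv_one]
      have ev : deriv (fun x => K y₁ x) =ᶠ[𝓝 y₂] fun x => fderiv ℝ G (y₁, x) (0, 1) := by
        have : ∀ᶠ x in 𝓝 y₂, (y₁, x) ∈ kernelDomain :=
          (by fun_prop : ContinuousAt (fun x : ℝ => (y₁, x)) y₂).eventually
            (isOpen_kernelDomain.mem_nhds hp)
        filter_upwards [this] with x hx
        have g1 : HasDerivAt (fun x : ℝ => (y₁, x)) ((0 : ℝ), (1 : ℝ)) x :=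
          (hasDerivAt_const x y₁).prodMk (hasDerivAt_id x)
        exact ((d1 _ hx).comp_hasDerivAt (f := fun x : ℝ => (y₁, x)) x g1).deriv
      rw [ev.deriv_eq]
      have g1 : HasDerivAt (fun x : ℝ => (y₁, x)) ((0 : ℝ), (1 : ℝ)) y₂ :=
        (hasDerivAt_const y₂ y₁).prodMk (hasDerivAt_id y₂)
      have g2 := ((d2 _ hp).comp_hasDerivAt (f := fun x : ℝ => (y₁, x)) y₂ g1).clm_apply
        (hasDerivAt_const y₂ ((0 : ℝ), (1 : ℝ)))
      refine g2.deriv.trans ?_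
      simp [H]
    have heq := h.equation y₁ y₂ hp.1 hp.2
    rw [e11, e22] at heq
    -- Along the two characteristic directions the Hessian form is `-K₁₁ + K₂₂`, the mixed terms
    -- cancelling by symmetry.
    have i1 : ((1 : ℝ), (1 : ℝ)) = (1, 0) + (0, 1) := by simp
    have i2 : ((-1 : ℝ), (1 : ℝ)) = -(1, 0) + (0, 1) := by simp
    have hs := hsym.eq (1, 0) (0, 1)
    rw [i1, i2, map_add, map_add, add_apply, add_apply,
      map_neg, map_neg]
    linarith

/-- The kernel is determined in `Ω`. -/
theorem IsTransformKernel.eqOn {r : ℝ → ℝ} (hr : MomentPotential r) {K K' : ℝ → ℝ → ℝ}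
    (h : IsTransformKernel r K) (h' : IsTransformKernel r K') {y₁ y₂ : ℝ} (h₁ : 0 < y₁)
    (h₂ : y₁ < y₂) : K y₁ y₂ = K' y₁ y₂ := by
  obtain ⟨a, ha⟩ := h.exists_mixed
  obtain ⟨a', ha'⟩ := h'.exists_mixed
  set L : ℝ → ℝ → ℝ := fun s t => K (s - t) (s + t) - K' (s - t) (s + t) with hL
  set b : ℝ → ℝ → ℝ := fun s t => a s t - a' s t with hb
  have hLt : ∀ s t, 0 < t → t < s → HasDerivAt (fun t => L s t) (b s t) t := fun s t ht hts =>
    (ha s t ht hts).1.sub (ha' s t ht hts).1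
  have hbs : ∀ s t, 0 < t → t < s → HasDerivAt (fun s => b s t) (-(r (s - t) * L s t)) s :=
    fun s t ht hts => ((ha s t ht hts).2.sub (ha' s t ht hts).2).congr_deriv (by
      simp only [hL]; ring)
  set u₀ := (y₁ + y₂) / 2 with hu₀
  set v₀ := (y₂ - y₁) / 2 with hv₀
  have hv0 : 0 < v₀ := by rw [hv₀]; linarith
  have hvu : v₀ < u₀ := by rw [hv₀, hu₀]; linarith
  set w := tailWeight r with hw
  have hwpos : ∀ x, 0 < w x := tailWeight_pos r
  -- A maximum argument for the difference `L` of two kernels. Let `S` be the maximum of `|L|/w` on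
  -- a rectangle reaching almost to the diagonal and far to infinity. Integrating the mixed
  -- derivative bounds the second difference of `L` over a subrectangle by `S w/2`. Three of its
  -- corners have `|L| ≤ η`, so `S w ≤ 3η + S w/2` at the maximum point, whence `S ≤ 6η`.
  suffices hmain : ∀ η > 0, |L u₀ v₀| ≤ 6 * η * w (u₀ - v₀) by
    have hz : |L u₀ v₀| ≤ 0 := by
      refine le_of_forall_pos_le_add fun ε hε => ?_
      have := hmain (ε / (6 * w (u₀ - v₀))) (div_pos hε (mul_pos (by norm_num) (hwpos _)))
      refine this.trans (le_of_eq ?_)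
      have := (hwpos (u₀ - v₀)).ne'
      field_simp
      simp
    have hz' : L u₀ v₀ = 0 := abs_eq_zero.1 (le_antisymm hz (abs_nonneg _))
    have e1 : u₀ - v₀ = y₁ := by rw [hu₀, hv₀]; ring
    have e2 : u₀ + v₀ = y₂ := by rw [hu₀, hv₀]; ring
    simp only [hL, e1, e2] at hz'
    linarith
  intro η hη
  -- smallness at infinity
  obtain ⟨N₁, hN₁⟩ := h.atInfinity (η / 2) (by linarith)
  obtain ⟨N₂, hN₂⟩ := h'.atInfinity (η / 2) (by linarith)
  -- On the line `s = N` the coordinates add up to `2N`, which has to exceed `N₁` and `N₂`; the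
  -- absolute values cover negative thresholds.
  set N := max u₀ (max N₁ N₂ + 1 + |N₁| + |N₂|) with hN
  have hNu : u₀ ≤ N := le_max_left _ _
  have hNsmall : ∀ t, 0 < t → t ≤ v₀ → |L N t| ≤ η := by
    intro t ht htv
    have hN' : max N₁ N₂ + 1 + |N₁| + |N₂| ≤ N := le_max_right _ _
    have g1 := le_max_left N₁ N₂
    have g2 := le_max_right N₁ N₂
    have g3 := neg_abs_le N₁
    have g4 := neg_abs_le N₂
    have g5 := le_abs_self N₁
    have g6 := le_abs_self N₂
    have q1 := hN₁ (N - t) (N + t) (by linarith) (by linarith) (by linarith)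
    have q2 := hN₂ (N - t) (N + t) (by linarith) (by linarith) (by linarith)
    refine (abs_sub _ _).trans (by linarith)
  -- smallness at the diagonal
  have hdom : ∀ s t, 0 < t → t < s → (s - t, s + t) ∈ kernelDomain := fun s t ht hts =>
    ⟨by simpa using hts, by simp; linarith⟩
  set G : ℝ × ℝ → ℝ := fun p => K p.1 p.2 - K' p.1 p.2 with hG
  have hGc : ContinuousOn G kernelDomain := h.contDiff.continuousOn.sub h'.contDiff.continuousOn
  set m : ℝ × ℝ → ℝ × ℝ := fun p => (p.1 - p.2, p.1 + p.2) with hm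
  have hmc : Continuous m := by fun_prop
  -- The diagonal condition is a limit at each single point. Since it is a limit in both variables,
  -- extension by `0` is continuous on a compact rectangle, and uniform continuity provides one `ε`
  -- valid for all `s`.
  set E : ℝ × ℝ → ℝ := fun p => if 0 < p.2 then L p.1 p.2 else 0 with hE
  have hEc : ContinuousOn E (Icc u₀ N ×ˢ Icc 0 v₀) := by
    rintro ⟨s, t⟩ ⟨hs, ht⟩
    simp only [mem_Icc] at hs ht
    rcases ht.1.eq_or_lt with h0 | h0
    · subst h0
      have hs0 : 0 < s := by linarith
      have hlim : Tendsto G (𝓝[kernelDomain] (s, s)) (𝓝 0) := by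
        have := (h.diagonal s hs0).sub (h'.diagonal s hs0)
        simpa using this
      have hE0 : E (s, 0) = 0 := by simp [hE]
      rw [ContinuousWithinAt, hE0, Metric.tendsto_nhds]
      intro ε hε
      have h1 := (Metric.tendsto_nhds.1 hlim) ε hε
      rw [eventually_nhdsWithin_iff] at h1 ⊢
      have h2 : Tendsto m (𝓝 (s, 0)) (𝓝 (s, s)) := by
        have := hmc.tendsto (s, 0)
        simpa [hm] using this
      filter_upwards [h2.eventually h1] with p hp hpm
      simp only [mem_prod, mem_Icc] at hpm
      by_cases hp2 : 0 < p.2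
      · have := hp (hdom p.1 p.2 hp2 (by linarith [hpm.1.1, hpm.2.2]))
        simpa [hE, hp2] using this
      · simpa [hE, hp2] using hε
    · have hc : ContinuousAt (G ∘ m) (s, t) :=
        (hGc.continuousAt (isOpen_kernelDomain.mem_nhds (hdom s t h0 (by linarith)))).comp
          (f := m) hmc.continuousAt
      refine (hc.congr ?_).continuousWithinAt
      have : ∀ᶠ p : ℝ × ℝ in 𝓝 (s, t), 0 < p.2 :=
        (continuous_snd.tendsto (s, t)).eventually (lt_mem_nhds h0)
      filter_upwards [this] with p hp
      simp [hE, hp, hG, hm, hL]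
  have hEu := (isCompact_Icc.prod isCompact_Icc).uniformContinuousOn_of_continuous hEc
  obtain ⟨δ, hδ, hEδ⟩ := Metric.uniformContinuousOn_iff.1 hEu η hη
  set ε := min (δ / 2) v₀ with hε
  have hε0 : 0 < ε := lt_min (by linarith) hv0
  have hεv : ε ≤ v₀ := min_le_right _ _
  have hεδ : ε < δ := (min_le_left _ _).trans_lt (by linarith)
  have hεsmall : ∀ s, u₀ ≤ s → s ≤ N → |L s ε| ≤ η := by
    intro s hs hsN
    have := hEδ (s, ε) ⟨⟨hs, hsN⟩, hε0.le, hεv⟩ (s, 0) ⟨⟨hs, hsN⟩, le_rfl, hv0.le⟩ (by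
      simpa [Prod.dist_eq, abs_of_pos hε0] using ⟨hδ, hεδ⟩)
    have h2 : E (s, ε) = L s ε := by simp only [hE]; rw [if_pos hε0]
    have h3 : E (s, 0) = 0 := by simp [hE]
    rw [h2, h3, Real.dist_eq, sub_zero] at this
    exact this.le
  -- the maximum of `|L| / w`
  have hLc : ContinuousOn (fun p : ℝ × ℝ => |L p.1 p.2| / w (p.1 - p.2))
      (Icc u₀ N ×ˢ Icc ε v₀) := by
    have hwc := hr.continuous_tailWeight
    refine ContinuousOn.div ?_ (by fun_prop) fun p _ => (hwpos _).ne'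
    refine ContinuousOn.abs ?_
    refine hGc.comp (f := m) hmc.continuousOn ?_
    rintro ⟨s, t⟩ ⟨hs, ht⟩
    simp only [mem_Icc] at hs ht
    exact hdom s t (by linarith) (by linarith)
  obtain ⟨⟨u, v⟩, ⟨hu, hv⟩, hmax⟩ := (isCompact_Icc.prod isCompact_Icc).exists_isMaxOn
    (⟨(u₀, v₀), ⟨le_rfl, hNu⟩, hεv, le_rfl⟩ : (Icc u₀ N ×ˢ Icc ε v₀).Nonempty) hLc
  simp only [mem_Icc] at hu hv
  set S := |L u v| / w (u - v) with hS
  have hS0 : 0 ≤ S := div_nonneg (abs_nonneg _) (hwpos _).le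
  have hLS : ∀ s t, u₀ ≤ s → s ≤ N → ε ≤ t → t ≤ v₀ → |L s t| ≤ S * w (s - t) := by
    intro s t h1 h2 h3 h4
    have := hmax (a := (s, t)) ⟨⟨h1, h2⟩, h3, h4⟩
    simp only [mem_ofPred_eq] at this
    exact (div_le_iff₀ (hwpos _)).1 this
  have step1 : ∀ t, ε ≤ t → t ≤ v₀ → |b N t - b u t| ≤ S * (tailAbs r (u - t) * w (u - t)) := by
    intro t ht htv
    have key := image_norm_le_of_norm_deriv_right_le_deriv_boundary (a := u) (b := N)
      (f := fun s => b s t - b u t) (f' := fun s => -(r (s - t) * L s t))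
      (B := fun s => S * w (u - t) * (tailAbs r (u - t) - tailAbs r (s - t)))
      (B' := fun s => S * w (u - t) * |r (s - t)|)
      (fun s hs => ((hbs s t (by linarith) (by linarith [hs.1])).sub_const
        _).continuousAt.continuousWithinAt)
      (fun s hs => ((hbs s t (by linarith) (by linarith [hs.1])).sub_const
        _).hasDerivWithinAt)
      (by simp)
      (fun s => by
        have := ((((hr.hasDerivAt_tailAbs (s - t)).comp_sub_const s t).const_sub
          (tailAbs r (u - t))).const_mul (S * w (u - t)))
        simpa using this)
      (fun s hs => by
        rw [norm_neg, norm_mul, Real.norm_eq_abs, Real.norm_eq_abs, mul_comm]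
        refine mul_le_mul_of_nonneg_right ?_ (abs_nonneg _)
        refine (hLS s t (by linarith [hs.1]) hs.2.le ht htv).trans ?_
        exact mul_le_mul_of_nonneg_left (hr.tailWeight_antitone (by linarith [hs.1])) hS0)
      (⟨hu.2, le_rfl⟩ : N ∈ Icc u N)
    refine key.trans ?_
    have q1 := tailAbs_nonneg r (N - t)
    have q2 : 0 ≤ S * w (u - t) := mul_nonneg hS0 (hwpos _).le
    nlinarith
  have step2 : |L N v - L u v - (L N ε - L u ε)| ≤ S * (w (u - v) / 2) := by
    have hNε : ∀ t, t ≤ v₀ → t < N := fun t ht => by linarith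
    -- No regularity of `b` in `t` has been recorded, so it is not integrated: the mean value
    -- inequality needs only the pointwise bound `step1` and an explicit antiderivative of it.
    have key := image_norm_le_of_norm_deriv_right_le_deriv_boundary (a := ε) (b := v)
      (f := fun t => L N t - L u t - (L N ε - L u ε)) (f' := fun t => b N t - b u t)
      (B := fun t => S * (w (u - t) / 2 - w (u - ε) / 2))
      (B' := fun t => S * (tailAbs r (u - t) * w (u - t)))
      (fun t ht => (((hLt N t (by linarith [ht.1]) (by linarith [ht.2])).sub
        (hLt u t (by linarith [ht.1]) (by linarith [ht.2]))).sub_const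
        _).continuousAt.continuousWithinAt)
      (fun t ht => (((hLt N t (by linarith [ht.1]) (by linarith [ht.2])).sub
        (hLt u t (by linarith [ht.1]) (by linarith [ht.2]))).sub_const
        _).hasDerivWithinAt)
      (by simp)
      (fun t => ((hr.hasDerivAt_half_tailWeight u t).sub_const _).const_mul S)
      (fun t ht => step1 t ht.1 (by linarith [ht.2]))
      (⟨hv.1, le_rfl⟩ : v ∈ Icc ε v)
    refine key.trans ?_
    have q1 := hwpos (u - ε)
    nlinarith
  have hSle : S ≤ 6 * η := by
    have q1 := hNsmall v (by linarith) hv.2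
    have q2 := hNsmall ε hε0 hεv
    have q3 := hεsmall u hu.1 hu.2
    have q4 : |L u v| = S * w (u - v) := (div_mul_cancel₀ _ (hwpos _).ne').symm
    have q5 : 1 ≤ w (u - v) := hr.one_le_tailWeight (by linarith)
    have q6 : |L u v| ≤ 3 * η + S * (w (u - v) / 2) := by
      rw [abs_le] at *
      constructor <;> linarith [q1.1, q1.2, q2.1, q2.2, q3.1, q3.2, step2.1, step2.2]
    nlinarith
  exact (hLS u₀ v₀ le_rfl hNu hεv le_rfl).trans
    (mul_le_mul_of_nonneg_right hSle (hwpos _).le)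

/-- If `r` agrees on `(0,∞)` with a potential of finite first moment, its kernel is given by a
function that is smooth on the plane. -/
theorem exists_smoothKernel_eq_transformKernel {r r' : ℝ → ℝ} (hr' : MomentPotential r')
    (h : EqOn r r' (Ioi 0)) : ∃ K K₁ K₂ K₁₁ K₂₂, SmoothKernel r' K K₁ K₂ K₁₁ K₂₂ ∧
      ∀ x y, 0 < x → x < y → transformKernel r x y = K x y := by
  obtain ⟨K, K₁, K₂, K₁₁, K₂₂, hK⟩ := exists_smoothKernel hr'
  refine ⟨K, K₁, K₂, K₁₁, K₂₂, hK, fun x y hx hy => ?_⟩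
  have h1 : IsTransformKernel r (transformKernel r) :=
    Classical.epsilon_spec ⟨K, (hK.isTransformKernel hr').congr fun x hx => (h hx).symm⟩
  exact (h1.congr h).eqOn hr' (hK.isTransformKernel hr') hx hy

/-! ### Operators on `L²` -/

section Operators

variable {α β : Type*} [MeasurableSpace α] [MeasurableSpace β] {μ : Measure α} {ν : Measure β}

theorem eLpNorm_two_sq (f : α → ℝ) : eLpNorm f 2 μ ^ 2 = ∫⁻ x, ‖f x‖ₑ ^ 2 ∂μ := by
  rw [eLpNorm_eq_lintegral_rpow_enorm_toReal two_ne_zero ENNReal.ofNat_ne_top, ← ENNReal.rpow_natCast,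
    ← ENNReal.rpow_mul]
  simp

/-- Weighted composition operators `f ↦ m · (f ∘ τ)` on `L²`. -/
theorem exists_weightedComp {m : α → ℝ} {τ : α → β} (hm : Measurable m)
    (hτ : Measure.QuasiMeasurePreserving τ μ ν) {C : ℝ} (hC : 0 ≤ C)
    (h : ∀ g : β → ℝ≥0∞, Measurable g →
      ∫⁻ x, ‖m x‖ₑ ^ 2 * g (τ x) ∂μ ≤ ENNReal.ofReal C ^ 2 * ∫⁻ y, g y ∂ν) :
    ∃ A : Lp ℝ 2 ν →L[ℝ] Lp ℝ 2 μ, ∀ f, A f =ᵐ[μ] fun x => m x * f (τ x) := by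
  have hb : ∀ f : Lp ℝ 2 ν, eLpNorm (fun x => m x * f (τ x)) 2 μ ≤
      ENNReal.ofReal C * eLpNorm f 2 ν := by
    intro f
    have h1 := h (fun y => ‖f y‖ₑ ^ 2) ((Lp.stronglyMeasurable f).measurable.enorm.pow_const 2)
    have h2 : eLpNorm (fun x => m x * f (τ x)) 2 μ ^ 2 ≤ (ENNReal.ofReal C * eLpNorm f 2 ν) ^ 2 := by
      rw [mul_pow, eLpNorm_two_sq, eLpNorm_two_sq]
      refine le_trans (le_of_eq ?_) h1
      simp only [enorm_mul, mul_pow]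
    exact (ENNReal.pow_le_pow_left_iff two_ne_zero).1 h2
  have hmem : ∀ f : Lp ℝ 2 ν, MemLp (fun x => m x * f (τ x)) 2 μ := fun f =>
    ⟨hm.aestronglyMeasurable.mul ((Lp.aestronglyMeasurable f).comp_quasiMeasurePreserving hτ),
      (hb f).trans_lt (ENNReal.mul_lt_top ENNReal.ofReal_lt_top (Lp.eLpNorm_lt_top f))⟩
  let A : Lp ℝ 2 ν →ₗ[ℝ] Lp ℝ 2 μ :=
    { toFun := fun f => (hmem f).toLp
      map_add' := fun f g => by
        ext1
        filter_upwards [(hmem (f + g)).coeFn_toLp, (hmem f).coeFn_toLp, (hmem g).coeFn_toLp,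
          Lp.coeFn_add (hmem f).toLp (hmem g).toLp, hτ.ae (Lp.coeFn_add f g)] with x h1 h2 h3 h4 h5
        rw [h1, h4, Pi.add_apply, h2, h3, h5, Pi.add_apply]
        ring
      map_smul' := fun c f => by
        ext1
        filter_upwards [(hmem (c • f)).coeFn_toLp, (hmem f).coeFn_toLp,
          Lp.coeFn_smul c (hmem f).toLp, hτ.ae (Lp.coeFn_smul c f)] with x h1 h2 h3 h4
        rw [h1, RingHom.id_apply, h3, Pi.smul_apply, h2, h4, Pi.smul_apply, smul_eq_mul,
          smul_eq_mul]
        ring }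
  refine ⟨A.mkContinuous C fun f => ?_, fun f => (hmem f).coeFn_toLp⟩
  show ‖(hmem f).toLp‖ ≤ C * ‖f‖
  rw [Lp.norm_toLp, Lp.norm_def, ← ENNReal.toReal_ofReal hC, ← ENNReal.toReal_mul]
  exact ENNReal.toReal_mono (ENNReal.mul_lt_top ENNReal.ofReal_lt_top (Lp.eLpNorm_lt_top f)).ne
    (hb f)

/-- Multiplication by a bounded function on `L²`. -/
theorem exists_mulOp {m : α → ℝ} (hm : Measurable m) {C : ℝ} (hb : ∀ᵐ x ∂μ, |m x| ≤ C) :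
    ∃ A : Lp ℝ 2 μ →L[ℝ] Lp ℝ 2 μ, ∀ f, A f =ᵐ[μ] fun x => m x * f x := by
  refine exists_weightedComp (C := max C 0) hm (Measure.QuasiMeasurePreserving.id μ)
    (le_max_right _ _) fun g hg => ?_
  rw [← lintegral_const_mul _ hg]
  refine lintegral_mono_ae ?_
  filter_upwards [hb] with x hx
  gcongr
  rw [Real.enorm_eq_ofReal_abs]
  exact ENNReal.ofReal_le_ofReal (hx.trans (le_max_left _ _))

theorem inner_eq_integral (f g : Lp ℝ 2 μ) : inner ℝ f g = ∫ x, f x * g x ∂μ := by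
  rw [L2.inner_def]
  exact integral_congr_ae (Eventually.of_forall fun x => by simp [mul_comm])

theorem norm_sq_eq_integral (f : Lp ℝ 2 μ) : ‖f‖ ^ 2 = ∫ x, f x ^ 2 ∂μ := by
  rw [← real_inner_self_eq_norm_sq, inner_eq_integral]
  simp only [sq]

theorem sq_integral_mul_le {f : α → ℝ} (hf : MemLp f 2 μ) (g : Lp ℝ 2 μ) :
    (∫ x, f x * g x ∂μ) ^ 2 ≤ (∫ x, f x ^ 2 ∂μ) * ‖g‖ ^ 2 := by
  have h1 : ∫ x, f x * g x ∂μ = inner ℝ hf.toLp g := by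
    rw [inner_eq_integral]
    exact integral_congr_ae (by filter_upwards [hf.coeFn_toLp] with x hx; rw [hx])
  have h2 : ∫ x, f x ^ 2 ∂μ = ‖hf.toLp‖ ^ 2 := by
    rw [norm_sq_eq_integral]
    exact integral_congr_ae (by filter_upwards [hf.coeFn_toLp] with x hx; rw [hx])
  rw [h1, h2, ← mul_pow, ← sq_abs]
  exact pow_le_pow_left₀ (abs_nonneg _) (abs_real_inner_le_norm _ _) 2

variable [SFinite μ] {k : α → α → ℝ}

theorem ae_memLp_section (hk : MemLp (fun p : α × α => k p.1 p.2) 2 (μ.prod μ)) :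
    ∀ᵐ x ∂μ, MemLp (k x) 2 μ := by
  have h1 := hk.integrable_sq.prod_right_ae
  filter_upwards [h1, hk.1.prodMk_left] with x hx hx'
  exact (memLp_two_iff_integrable_sq hx').2 hx

/-- Cauchy–Schwarz in `y` for almost every `x`, followed by integration in `x`. The norm bound is
what lets dominated convergence of kernels force small operators. -/
theorem exists_hsOp (hk : MemLp (fun p : α × α => k p.1 p.2) 2 (μ.prod μ)) :
    ∃ A : Lp ℝ 2 μ →L[ℝ] Lp ℝ 2 μ, (∀ f, A f =ᵐ[μ] fun x => ∫ y, k x y * f y ∂μ) ∧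
      ‖A‖ ≤ √(∫ p, k p.1 p.2 ^ 2 ∂(μ.prod μ)) := by
  have hsec := ae_memLp_section hk
  have hsq : Integrable (fun x => ∫ y, k x y ^ 2 ∂μ) μ := hk.integrable_sq.integral_prod_left
  have hmeas : ∀ f : Lp ℝ 2 μ, AEStronglyMeasurable (fun x => ∫ y, k x y * f y ∂μ) μ := fun f =>
    (hk.1.mul ((Lp.aestronglyMeasurable f).comp_snd)).integral_prod_right'
  have hbd : ∀ f : Lp ℝ 2 μ, ∀ᵐ x ∂μ, (∫ y, k x y * f y ∂μ) ^ 2 ≤ (∫ y, k x y ^ 2 ∂μ) * ‖f‖ ^ 2 :=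
    fun f => by
    filter_upwards [hsec] with x hx
    exact sq_integral_mul_le hx f
  have hmem : ∀ f : Lp ℝ 2 μ, MemLp (fun x => ∫ y, k x y * f y ∂μ) 2 μ := fun f => by
    refine (memLp_two_iff_integrable_sq (hmeas f)).2 ?_
    refine (hsq.mul_const (‖f‖ ^ 2)).mono' ((hmeas f).pow 2) ?_
    filter_upwards [hbd f] with x hx
    rwa [Real.norm_of_nonneg (sq_nonneg _)]
  have hint : ∀ f : Lp ℝ 2 μ, ∀ᵐ x ∂μ, Integrable (fun y => k x y * f y) μ := fun f => by
    filter_upwards [hsec] with x hx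
    exact hx.integrable_mul (Lp.memLp f)
  let A : Lp ℝ 2 μ →ₗ[ℝ] Lp ℝ 2 μ :=
    { toFun := fun f => (hmem f).toLp
      map_add' := fun f g => by
        ext1
        filter_upwards [(hmem (f + g)).coeFn_toLp, (hmem f).coeFn_toLp, (hmem g).coeFn_toLp,
          Lp.coeFn_add (hmem f).toLp (hmem g).toLp, hint f, hint g] with x h1 h2 h3 h4 h5 h6
        rw [h1, h4, Pi.add_apply, h2, h3, ← integral_add h5 h6]
        refine integral_congr_ae ?_
        filter_upwards [Lp.coeFn_add f g] with y hy
        rw [hy, Pi.add_apply]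
        ring
      map_smul' := fun c f => by
        ext1
        filter_upwards [(hmem (c • f)).coeFn_toLp, (hmem f).coeFn_toLp,
          Lp.coeFn_smul c (hmem f).toLp] with x h1 h2 h3
        rw [h1, RingHom.id_apply, h3, Pi.smul_apply, h2, smul_eq_mul, ← integral_const_mul]
        refine integral_congr_ae ?_
        filter_upwards [Lp.coeFn_smul c f] with y hy
        rw [hy, Pi.smul_apply, smul_eq_mul]
        ring }
  have hA : ∀ f, ‖A f‖ ≤ √(∫ p, k p.1 p.2 ^ 2 ∂(μ.prod μ)) * ‖f‖ := fun f => by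
    refine le_of_sq_le_sq ?_ (by positivity)
    rw [mul_pow, Real.sq_sqrt (integral_nonneg fun _ => sq_nonneg _), norm_sq_eq_integral,
      integral_prod _ hk.integrable_sq, ← integral_mul_const]
    refine integral_mono_ae (Lp.memLp (A f)).integrable_sq (hsq.mul_const _) ?_
    filter_upwards [(hmem f).coeFn_toLp, hbd f] with x h1 h2
    show (((hmem f).toLp : Lp ℝ 2 μ) x) ^ 2 ≤ _
    rwa [h1]
  exact ⟨A.mkContinuous _ hA, fun f => (hmem f).coeFn_toLp,
    A.mkContinuous_norm_le (Real.sqrt_nonneg _) hA⟩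

/-- The integral operator with a square integrable kernel. -/
def hsOp (hk : MemLp (fun p : α × α => k p.1 p.2) 2 (μ.prod μ)) : Lp ℝ 2 μ →L[ℝ] Lp ℝ 2 μ :=
  (exists_hsOp hk).choose

theorem hsOp_coe (hk : MemLp (fun p : α × α => k p.1 p.2) 2 (μ.prod μ)) (f : Lp ℝ 2 μ) :
    hsOp hk f =ᵐ[μ] fun x => ∫ y, k x y * f y ∂μ :=
  (exists_hsOp hk).choose_spec.1 f

theorem norm_hsOp_le (hk : MemLp (fun p : α × α => k p.1 p.2) 2 (μ.prod μ)) :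
    ‖hsOp hk‖ ≤ √(∫ p, k p.1 p.2 ^ 2 ∂(μ.prod μ)) :=
  (exists_hsOp hk).choose_spec.2

theorem inner_hsOp (hk : MemLp (fun p : α × α => k p.1 p.2) 2 (μ.prod μ))
    (hk' : MemLp (fun p : α × α => k p.2 p.1) 2 (μ.prod μ)) (f g : Lp ℝ 2 μ) :
    inner ℝ (hsOp hk f) g = inner ℝ f (hsOp (k := fun x y => k y x) hk' g) := by
  have hfg : MemLp (fun p : α × α => g p.1 * f p.2) 2 (μ.prod μ) := by
    refine (memLp_two_iff_integrable_sq ((Lp.aestronglyMeasurable g).comp_fst.mul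
      (Lp.aestronglyMeasurable f).comp_snd)).2 ?_
    simp only [Pi.mul_apply, mul_pow]
    exact (Lp.memLp g).integrable_sq.mul_prod (Lp.memLp f).integrable_sq
  have hi : Integrable (fun p : α × α => k p.1 p.2 * (g p.1 * f p.2)) (μ.prod μ) :=
    hk.integrable_mul hfg
  rw [inner_eq_integral, inner_eq_integral]
  calc ∫ x, hsOp hk f x * g x ∂μ = ∫ x, ∫ y, k x y * (g x * f y) ∂μ ∂μ := by
        refine integral_congr_ae ?_
        filter_upwards [hsOp_coe hk f] with x hx
        rw [hx, ← integral_mul_const]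
        congr 1
        ext y
        ring
    _ = ∫ y, ∫ x, k x y * (g x * f y) ∂μ ∂μ := integral_integral_swap hi
    _ = _ := by
        refine integral_congr_ae ?_
        filter_upwards [hsOp_coe (k := fun x y => k y x) hk' g] with y hy
        rw [hy, ← integral_const_mul]
        congr 1
        ext x
        ring

theorem adjoint_hsOp (hk : MemLp (fun p : α × α => k p.1 p.2) 2 (μ.prod μ))
    (hk' : MemLp (fun p : α × α => k p.2 p.1) 2 (μ.prod μ)) :
    ContinuousLinearMap.adjoint (hsOp hk) = hsOp (k := fun x y => k y x) hk' := by
  symm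
  rw [ContinuousLinearMap.eq_adjoint_iff]
  intro x y
  rw [real_inner_comm, ← inner_hsOp hk hk', real_inner_comm]

end Operators

/-! ### Volterra operators on the half-line -/

/-- Lebesgue measure on `(0,∞)`. -/
abbrev halfLine : Measure ℝ := volume.restrict (Ioi 0)

/-- `L²(0,∞)`. -/
abbrev HalfL2 : Type := Lp ℝ 2 halfLine

/-- Conjugation by `exp (n φ)` multiplies the kernel by `exp (n (φ y - φ x))`. As `φ` is strictly
decreasing on `(0,∞)` and the kernel lives on `x < y`, the new kernels are dominated by `|k|` and
tend to `0` pointwise. So their Hilbert–Schmidt norms tend to `0`, and for some `n` the Neumann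
series applies. Boundedness of `φ` on the infinite half-line makes the weight and its reciprocal
bounded multipliers, so invertibility transfers back. -/
theorem isUnit_one_add_hsOp {k : ℝ → ℝ → ℝ}
    (hk : MemLp (fun p : ℝ × ℝ => k p.1 p.2) 2 (halfLine.prod halfLine))
    (h0 : ∀ x y, y ≤ x → k x y = 0) : IsUnit (1 + hsOp hk) := by
  set φ : ℝ → ℝ := fun x => (1 + |x|)⁻¹ with hφ
  have hφc : Continuous φ := by
    refine Continuous.inv₀ (by fun_prop) fun x => ?_
    positivity
  have hφ0 : ∀ x, 0 ≤ φ x := fun x => by positivity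
  have hφ1 : ∀ x, φ x ≤ 1 := fun x => inv_le_one_of_one_le₀ (by
    have := abs_nonneg x; linarith)
  set w : ℕ → ℝ → ℝ := fun n x => Real.exp (n * φ x) with hw
  have hwc : ∀ n, Continuous (w n) := fun n => by simp only [hw]; fun_prop
  set kn : ℕ → ℝ → ℝ → ℝ := fun n x y => (w n x)⁻¹ * k x y * w n y with hkn
  have hpos : ∀ᵐ p : ℝ × ℝ ∂(halfLine.prod halfLine), 0 < p.1 ∧ 0 < p.2 := by
    rw [Measure.prod_restrict]
    exact ae_restrict_mem (measurableSet_Ioi.prod measurableSet_Ioi)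
  have hle : ∀ n, ∀ᵐ p : ℝ × ℝ ∂(halfLine.prod halfLine), |kn n p.1 p.2| ≤ |k p.1 p.2| := by
    intro n
    filter_upwards [hpos] with p hp
    rcases le_or_gt p.2 p.1 with hle | hlt
    · simp [hkn, h0 _ _ hle]
    · have : kn n p.1 p.2 = k p.1 p.2 * Real.exp (n * (φ p.2 - φ p.1)) := by
        simp only [hkn, hw]
        rw [← Real.exp_neg, mul_comm (Real.exp _), mul_assoc, ← Real.exp_add]
        ring_nf
      rw [this, abs_mul, Real.abs_exp]
      refine mul_le_of_le_one_right (abs_nonneg _) (Real.exp_le_one_iff.2 ?_)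
      refine mul_nonpos_of_nonneg_of_nonpos n.cast_nonneg (sub_nonpos.2 ?_)
      simp only [hφ, abs_of_pos hp.1, abs_of_pos hp.2]
      have := hp.1
      gcongr
  have hmeas : ∀ n, AEStronglyMeasurable (fun p : ℝ × ℝ => kn n p.1 p.2)
      (halfLine.prod halfLine) := fun n => by
    have h1 : Continuous fun p : ℝ × ℝ => (w n p.1)⁻¹ :=
      ((hwc n).comp continuous_fst).inv₀ fun p => (Real.exp_pos _).ne'
    exact (h1.aestronglyMeasurable.mul hk.1).mul
      ((hwc n).comp continuous_snd).aestronglyMeasurable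
  have hknm : ∀ n, MemLp (fun p : ℝ × ℝ => kn n p.1 p.2) 2 (halfLine.prod halfLine) := fun n =>
    hk.mono (hmeas n) (hle n)
  -- the weighted kernels tend to zero
  have hlim : Tendsto (fun n => ∫ p, kn n p.1 p.2 ^ 2 ∂(halfLine.prod halfLine)) atTop (𝓝 0) := by
    have : (0 : ℝ) = ∫ _ : ℝ × ℝ, (0 : ℝ) ∂(halfLine.prod halfLine) := by simp
    rw [this]
    refine tendsto_integral_of_dominated_convergence (fun p => k p.1 p.2 ^ 2)
      (fun n => (hmeas n).pow 2) hk.integrable_sq (fun n => ?_) ?_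
    · filter_upwards [hle n] with p hp
      rw [Real.norm_of_nonneg (sq_nonneg _)]
      exact sq_le_sq.2 hp
    · filter_upwards [hpos] with p hp
      rcases le_or_gt p.2 p.1 with hle | hlt
      · simp [hkn, h0 _ _ hle]
      · have : ∀ n : ℕ, kn n p.1 p.2 ^ 2 = k p.1 p.2 ^ 2 * Real.exp (2 * (φ p.2 - φ p.1)) ^ n := by
          intro n
          have : kn n p.1 p.2 = k p.1 p.2 * Real.exp (n * (φ p.2 - φ p.1)) := by
            simp only [hkn, hw]
            rw [← Real.exp_neg, mul_comm (Real.exp _), mul_assoc, ← Real.exp_add]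
            ring_nf
          rw [this, mul_pow, ← Real.exp_nat_mul, ← Real.exp_nat_mul]
          congr 2
          push_cast
          ring
        simp_rw [this]
        have hd : φ p.2 < φ p.1 := by
          simp only [hφ, abs_of_pos hp.1, abs_of_pos hp.2]
          have := hp.1
          gcongr
        have := (tendsto_pow_atTop_nhds_zero_of_lt_one (Real.exp_pos (2 * (φ p.2 - φ p.1))).le
          (Real.exp_lt_one_iff.2 (by linarith))).const_mul (k p.1 p.2 ^ 2)
        simpa using this
  obtain ⟨n, hn⟩ := (hlim.eventually (gt_mem_nhds one_pos)).exists
  have hnorm : ‖hsOp (hknm n)‖ < 1 := by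
    refine (norm_hsOp_le (hknm n)).trans_lt ?_
    rwa [Real.sqrt_lt' one_pos, one_pow]
  have hunit : IsUnit (1 + hsOp (hknm n)) := by
    have := isUnit_one_sub_of_norm_lt_one (x := -hsOp (hknm n)) (by rwa [norm_neg])
    rwa [sub_neg_eq_add] at this
  -- conjugation by the weight
  obtain ⟨a, ha⟩ := exists_mulOp (μ := halfLine) (m := w n) (hwc n).measurable (C := Real.exp n)
    (Eventually.of_forall fun x => by
      rw [Real.abs_exp, Real.exp_le_exp]
      exact mul_le_of_le_one_right n.cast_nonneg (hφ1 x))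
  obtain ⟨b, hb⟩ := exists_mulOp (μ := halfLine) (m := fun x => (w n x)⁻¹)
    (hwc n).measurable.inv (C := 1) (Eventually.of_forall fun x => by
      rw [← Real.exp_neg, Real.abs_exp, Real.exp_le_one_iff]
      have := mul_nonneg (n.cast_nonneg (α := ℝ)) (hφ0 x)
      linarith)
  have hab : a * b = 1 := by
    ext1 f
    ext1
    show a (b f) =ᵐ[halfLine] f
    filter_upwards [ha (b f), hb f] with x h1 h2
    rw [h1, h2, mul_inv_cancel_left₀ (Real.exp_pos _).ne']
  have hba : b * a = 1 := by
    ext1 f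
    ext1
    show b (a f) =ᵐ[halfLine] f
    filter_upwards [hb (a f), ha f] with x h1 h2
    rw [h1, h2, inv_mul_cancel_left₀ (Real.exp_pos _).ne']
  have hconj : hsOp (hknm n) = b * hsOp hk * a := by
    ext1 f
    ext1
    show hsOp (hknm n) f =ᵐ[halfLine] b (hsOp hk (a f))
    filter_upwards [hb (hsOp hk (a f)), hsOp_coe hk (a f), hsOp_coe (hknm n) f] with x h1 h2 h3
    rw [h1, h2, h3, ← integral_const_mul]
    refine integral_congr_ae ?_
    filter_upwards [ha f] with y hy
    rw [hy]
    ring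
  have hu1 : IsUnit a := ⟨⟨a, b, hab, hba⟩, rfl⟩
  have hu2 : IsUnit b := ⟨⟨b, a, hba, hab⟩, rfl⟩
  have : 1 + hsOp hk = a * (1 + hsOp (hknm n)) * b := by
    rw [hconj]
    calc 1 + hsOp hk = a * b + (a * b) * hsOp hk * (a * b) := by rw [hab, one_mul, mul_one]
      _ = _ := by noncomm_ring
  rw [this]
  exact (hu1.mul hunit).mul hu2

/-! ### Primitives of locally integrable functions -/

/-- Integration by parts for primitives. -/
theorem integral_primitive_mul {f g : ℝ → ℝ} {a b : ℝ} (hf : IntervalIntegrable f volume a b)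
    (hg : IntervalIntegrable g volume a b) (c d : ℝ) :
    ∫ x in a..b, (f x * (d + ∫ t in a..x, g t) + (c + ∫ t in a..x, f t) * g x) =
      (c + ∫ t in a..b, f t) * (d + ∫ t in a..b, g t) - c * d := by
  have key : ∀ {f : ℝ → ℝ} (hf : IntervalIntegrable f volume a b) (c : ℝ),
      AbsolutelyContinuousOnInterval (fun x => c + ∫ t in a..x, f t) a b := fun hf c =>
    ((contDiff_const (c := c)).contDiffOn (n := 1)).absolutelyContinuousOnInterval.fun_add
      (hf.absolutelyContinuousOnInterval_intervalIntegral left_mem_uIcc)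
  have hd : ∀ {f : ℝ → ℝ} (hf : IntervalIntegrable f volume a b) (c : ℝ),
      ∀ᵐ x, x ∈ uIoc a b → deriv (fun x => c + ∫ t in a..x, f t) x = f x := fun hf c => by
    filter_upwards [hf.ae_hasDerivAt_integral] with x hx hxm
    exact ((hx (uIoc_subset_uIcc hxm) a left_mem_uIcc).const_add c).deriv
  have h := (key hf c).integral_deriv_mul_eq_sub (key hg d)
  simp only [intervalIntegral.integral_same, add_zero] at h
  rw [← h]
  refine intervalIntegral.integral_congr_ae ?_
  filter_upwards [hd hf c, hd hg d] with x h1 h2 hx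
  rw [h1 hx, h2 hx]

theorem continuousOn_Ici_primitive {g : ℝ → ℝ}
    (hg : ∀ x, 0 ≤ x → IntervalIntegrable g volume 0 x) :
    ContinuousOn (fun x => ∫ t in (0 : ℝ)..x, g t) (Ici 0) := by
  intro x hx
  have hx' : (0 : ℝ) ≤ x := hx
  have h1 := intervalIntegral.continuousOn_primitive_interval (a := 0) (b := x + 1)
    (by simpa [intervalIntegrable_iff, uIoc_of_le (by linarith : (0 : ℝ) ≤ x + 1),
      uIcc_of_le (by linarith : (0 : ℝ) ≤ x + 1), integrableOn_Icc_iff_integrableOn_Ioc]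
      using hg (x + 1) (by linarith) : IntegrableOn g (uIcc 0 (x + 1)))
  rw [uIcc_of_le (by linarith)] at h1
  refine (h1 x ⟨hx, by linarith⟩).mono_of_mem_nhdsWithin ?_
  filter_upwards [self_mem_nhdsWithin, mem_nhdsWithin_of_mem_nhds (Iio_mem_nhds (lt_add_one x))]
    with y h2 h3
  exact ⟨h2, le_of_lt h3⟩

theorem ae_eq_zero_of_primitive_eq_zero {g : ℝ → ℝ}
    (hg : ∀ x, 0 ≤ x → IntervalIntegrable g volume 0 x)
    (h : ∀ x, 0 ≤ x → ∫ t in (0 : ℝ)..x, g t = 0) : g =ᵐ[halfLine] 0 := by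
  have h1 : ∀ᵐ x, ∀ n : ℕ, x ∈ uIcc (0 : ℝ) n → ∀ c ∈ uIcc (0 : ℝ) n,
      HasDerivAt (fun x => ∫ t in c..x, g t) (g x) x :=
    ae_all_iff.2 fun n => (hg n n.cast_nonneg).ae_hasDerivAt_integral
  filter_upwards [ae_restrict_of_ae h1, ae_restrict_mem measurableSet_Ioi] with x hx hx0
  obtain ⟨n, hn⟩ := exists_nat_gt x
  have h2 := hx n (by rw [uIcc_of_le n.cast_nonneg]; exact ⟨le_of_lt hx0, hn.le⟩) 0 left_mem_uIcc
  have h3 : (fun x => ∫ t in (0 : ℝ)..x, g t) =ᶠ[𝓝 x] fun _ => 0 := by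
    filter_upwards [Ioi_mem_nhds hx0] with y hy using h y (le_of_lt hy)
  exact h2.unique ((hasDerivAt_const x (0 : ℝ)).congr_of_eventuallyEq h3)

theorem eqOn_Ici_of_ae_halfLine {F G : ℝ → ℝ} (hF : ContinuousOn F (Ici 0))
    (hG : ContinuousOn G (Ici 0)) (h : F =ᵐ[halfLine] G) : EqOn F G (Ici 0) := by
  refine Measure.eqOn_of_ae_eq (μ := volume) ?_ hF hG (by simp)
  rwa [← restrict_Ioi_eq_restrict_Ici]

/-! ### The Sobolev space on the half-line -/

theorem HalfL2.intervalIntegrable (f : HalfL2) {a b : ℝ} (ha : 0 ≤ a) (hb : 0 ≤ b) :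
    IntervalIntegrable f volume a b := by
  have h1 : MemLp f 2 (volume.restrict (uIoc a b)) := by
    have : volume.restrict (uIoc a b) = halfLine.restrict (uIoc a b) := by
      rw [Measure.restrict_restrict measurableSet_uIoc]
      congr 1
      refine (inter_eq_left.2 fun x hx => ?_).symm
      exact lt_of_le_of_lt (le_min ha hb) hx.1
    rw [this]
    exact (Lp.memLp f).restrict _
  have : IsFiniteMeasure (volume.restrict (uIoc a b)) := ⟨by simp [uIoc]⟩
  exact intervalIntegrable_iff.2 (h1.integrable (by norm_num))

theorem integral_congr_halfLine {f g : ℝ → ℝ} (h : f =ᵐ[halfLine] g) {a b : ℝ} (ha : 0 ≤ a)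
    (hb : 0 ≤ b) : ∫ t in a..b, f t = ∫ t in a..b, g t := by
  refine intervalIntegral.integral_congr_ae ?_
  have h' := (ae_restrict_iff' (measurableSet_Ioi)).1 h
  filter_upwards [h'] with x hx hxm
  exact hx (lt_of_le_of_lt (le_min ha hb) hxm.1)

/-- `f = c + ∫₀ˣ g` on `(0,∞)`. -/
def IsPrimitive (f g : HalfL2) (c : ℝ) : Prop := f =ᵐ[halfLine] fun x => c + ∫ t in (0 : ℝ)..x, g t

theorem IsPrimitive.add {f g f' g' : HalfL2} {c c' : ℝ} (h : IsPrimitive f g c)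
    (h' : IsPrimitive f' g' c') : IsPrimitive (f + f') (g + g') (c + c') := by
  filter_upwards [h, h', Lp.coeFn_add f f', ae_restrict_mem measurableSet_Ioi] with x h1 h2 h3 hx
  rw [h3, Pi.add_apply, h1, h2, integral_congr_halfLine (Lp.coeFn_add g g') le_rfl (le_of_lt hx)]
  simp only [Pi.add_apply]
  rw [intervalIntegral.integral_add (g.intervalIntegrable le_rfl (le_of_lt hx))
    (g'.intervalIntegrable le_rfl (le_of_lt hx))]
  ring

theorem IsPrimitive.smul {f g : HalfL2} {c : ℝ} (a : ℝ) (h : IsPrimitive f g c) :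
    IsPrimitive (a • f) (a • g) (a * c) := by
  filter_upwards [h, Lp.coeFn_smul a f, ae_restrict_mem measurableSet_Ioi] with x h1 h3 hx
  rw [h3, Pi.smul_apply, h1, integral_congr_halfLine (Lp.coeFn_smul a g) le_rfl (le_of_lt hx)]
  simp only [Pi.smul_apply, smul_eq_mul]
  rw [intervalIntegral.integral_const_mul]
  ring

theorem IsPrimitive.zero : IsPrimitive 0 0 0 := by
  filter_upwards [Lp.coeFn_zero ℝ 2 halfLine, ae_restrict_mem measurableSet_Ioi] with x h1 hx
  rw [h1, integral_congr_halfLine (Lp.coeFn_zero ℝ 2 halfLine) le_rfl (le_of_lt hx)]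
  simp

theorem IsPrimitive.unique {f g g' : HalfL2} {c c' : ℝ} (h : IsPrimitive f g c)
    (h' : IsPrimitive f g' c') : c = c' ∧ g = g' := by
  have hc := fun (g : HalfL2) (c : ℝ) =>
    (continuousOn_const (c := c)).add (continuousOn_Ici_primitive fun x hx =>
      g.intervalIntegrable le_rfl hx)
  have he := eqOn_Ici_of_ae_halfLine (hc g c) (hc g' c') (h.symm.trans h')
  have h0 : c = c' := by simpa using he (x := 0) (mem_Ici.2 le_rfl)
  refine ⟨h0, ?_⟩
  ext1
  have hz : (fun x => g x - g' x) =ᵐ[halfLine] 0 := by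
    refine ae_eq_zero_of_primitive_eq_zero (fun x hx => (g.intervalIntegrable le_rfl hx).sub
      (g'.intervalIntegrable le_rfl hx)) fun x hx => ?_
    rw [intervalIntegral.integral_sub (g.intervalIntegrable le_rfl hx)
      (g'.intervalIntegrable le_rfl hx)]
    have := he (x := x) hx
    simp only [Pi.add_apply] at this
    linarith
  filter_upwards [hz] with x hx
  exact sub_eq_zero.1 hx

/-- `H¹(0,∞)`, realized as the graph of the derivative. -/
def HalfH1 : Submodule ℝ (HalfL2 × HalfL2) where
  carrier := {p | ∃ c, IsPrimitive p.1 p.2 c}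
  zero_mem' := ⟨0, IsPrimitive.zero⟩
  add_mem' := by
    rintro p p' ⟨c, h⟩ ⟨c', h'⟩
    exact ⟨c + c', h.add h'⟩
  smul_mem' := by
    rintro a p ⟨c, h⟩
    exact ⟨a * c, h.smul a⟩

namespace HalfH1

/-- The function. -/
def val : HalfH1 →L[ℝ] HalfL2 := (ContinuousLinearMap.fst ℝ HalfL2 HalfL2).comp HalfH1.subtypeL

/-- The derivative. -/
def der : HalfH1 →L[ℝ] HalfL2 := (ContinuousLinearMap.snd ℝ HalfL2 HalfL2).comp HalfH1.subtypeL

theorem memLp_indicator_Ioc {f : ℝ → ℝ} (hf : Continuous f) :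
    MemLp ((Ioc 0 1).indicator f) 2 halfLine := by
  refine (memLp_indicator_iff_restrict measurableSet_Ioc).2 ?_
  rw [Measure.restrict_restrict measurableSet_Ioc,
    inter_eq_left.2 (Ioc_subset_Ioi_self : Ioc (0 : ℝ) 1 ⊆ Ioi 0)]
  obtain ⟨C, hC⟩ := (isCompact_Icc (a := (0 : ℝ)) (b := 1)).exists_bound_of_continuousOn
    hf.continuousOn
  refine MemLp.of_bound hf.aestronglyMeasurable C ?_
  filter_upwards [ae_restrict_mem measurableSet_Ioc] with x hx
  exact hC x (Ioc_subset_Icc_self hx)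

theorem inner_indicator_Ioc {f : ℝ → ℝ} (hf : Continuous f) (g : HalfL2) :
    inner ℝ ((memLp_indicator_Ioc hf).toLp) g = ∫ x in (0 : ℝ)..1, f x * g x := by
  rw [inner_eq_integral, intervalIntegral.integral_of_le zero_le_one]
  have : ∫ x in Ioc (0 : ℝ) 1, f x * g x = ∫ x in Ioc (0 : ℝ) 1, f x * g x ∂halfLine := by
    rw [Measure.restrict_restrict measurableSet_Ioc,
      inter_eq_left.2 (Ioc_subset_Ioi_self : Ioc (0 : ℝ) 1 ⊆ Ioi 0)]
  rw [this, ← integral_indicator measurableSet_Ioc]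
  refine integral_congr_ae ?_
  filter_upwards [(memLp_indicator_Ioc hf).coeFn_toLp] with x hx
  rw [hx]
  by_cases hm : x ∈ Ioc (0 : ℝ) 1 <;> simp [hm]

/-- The value at `0`. -/
def trace : HalfH1 →L[ℝ] ℝ :=
  (innerSL ℝ ((memLp_indicator_Ioc (continuous_const (y := (1 : ℝ)))).toLp)).comp val +
    (innerSL ℝ ((memLp_indicator_Ioc (f := fun x => x - 1) (by fun_prop)).toLp)).comp der

/-- Integration by parts on `(0,1)` against `x - 1`, which vanishes at `1` and is `-1` at `0`. This
expresses the boundary value through two inner products, so its continuity on `H¹` is evident. -/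
theorem trace_eq {p : HalfH1} {c : ℝ} (h : IsPrimitive (val p) (der p) c) : trace p = c := by
  show inner ℝ _ (val p) + inner ℝ _ (der p) = c
  rw [inner_indicator_Ioc continuous_const, inner_indicator_Ioc (by fun_prop)]
  have h1 := integral_primitive_mul ((der p).intervalIntegrable le_rfl zero_le_one)
    (intervalIntegrable_const (c := (1 : ℝ))) c (-1)
  simp only [intervalIntegral.integral_const, smul_eq_mul, mul_one, sub_zero, neg_add_cancel,
    mul_zero, zero_sub, mul_neg, neg_neg] at h1
  rw [intervalIntegral.integral_add] at h1
  · rw [add_comm] at h1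
    rw [← h1]
    congr 1
    · simp only [one_mul]
      exact integral_congr_halfLine h le_rfl zero_le_one
    · refine intervalIntegral.integral_congr fun x _ => ?_
      ring
  · exact ((der p).intervalIntegrable le_rfl zero_le_one).mul_continuousOn (by fun_prop)
  · refine ContinuousOn.intervalIntegrable ?_
    rw [uIcc_of_le zero_le_one]
    exact (continuousOn_const.add (continuousOn_Ici_primitive fun x hx =>
      (der p).intervalIntegrable le_rfl hx)).mono Icc_subset_Ici_self

theorem isPrimitive (p : HalfH1) : IsPrimitive (val p) (der p) (trace p) := by
  obtain ⟨c, hc⟩ := p.2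
  rw [trace_eq (p := p) hc]
  exact hc

theorem ext_val {p q : HalfH1} (h : val p = val q) : p = q := by
  have h1 := isPrimitive p
  rw [h] at h1
  exact Subtype.ext (Prod.ext h (h1.unique (isPrimitive q)).2)

/-- The continuous representative. -/
def rep (p : HalfH1) (x : ℝ) : ℝ := trace p + ∫ t in (0 : ℝ)..x, der p t

theorem continuousOn_rep (p : HalfH1) : ContinuousOn (rep p) (Ici 0) :=
  continuousOn_const.add (continuousOn_Ici_primitive fun _ hx =>
    (der p).intervalIntegrable le_rfl hx)

/-- The boundary term at infinity vanishes: the product of the representatives has a limit because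
the integral of its derivative converges, and the product is integrable, so the limit is `0`. -/
theorem inner_der_add_inner (p q : HalfH1) :
    inner ℝ (der p) (val q) + inner ℝ (val p) (der q) = -(trace p * trace q) := by
  have i1 : Integrable (fun x => der p x * val q x) halfLine :=
    (Lp.memLp (der p)).integrable_mul (Lp.memLp (val q))
  have i2 : Integrable (fun x => val p x * der q x) halfLine :=
    (Lp.memLp (val p)).integrable_mul (Lp.memLp (der q))
  have i3 : Integrable (fun x => val p x * val q x) halfLine :=
    (Lp.memLp (val p)).integrable_mul (Lp.memLp (val q))
  have i4 : IntegrableOn (fun x => rep p x * rep q x) (Ioi 0) := by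
    refine i3.congr ?_
    filter_upwards [isPrimitive p, isPrimitive q] with x h1 h2
    rw [h1, h2, rep, rep]
  rw [inner_eq_integral, inner_eq_integral, ← integral_add i1 i2]
  have hlim := intervalIntegral_tendsto_integral_Ioi (0 : ℝ) (i1.add i2) tendsto_id
  simp only [id] at hlim
  have hlim2 : Tendsto (fun x => rep p x * rep q x) atTop
      (𝓝 ((∫ x in Ioi (0 : ℝ), (der p x * val q x + val p x * der q x)) +
        trace p * trace q)) := by
    refine (hlim.add_const _).congr' ?_
    filter_upwards [eventually_ge_atTop 0] with N hN
    have := integral_primitive_mul ((der p).intervalIntegrable le_rfl hN)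
      ((der q).intervalIntegrable le_rfl hN) (trace p) (trace q)
    rw [rep, rep, ← eq_sub_iff_add_eq, ← this]
    refine integral_congr_halfLine ?_ le_rfl hN
    filter_upwards [isPrimitive p, isPrimitive q] with x h1 h2
    rw [Pi.add_apply, h1, h2]
  have hz := IntegrableAtFilter.eq_zero_of_tendsto (μ := volume) (l := atTop)
    ⟨Ioi 0, Ioi_mem_atTop 0, i4⟩ (by
      intro s hs
      obtain ⟨b, hb⟩ := mem_atTop_sets.1 hs
      rw [← top_le_iff, ← Real.volume_Ici (a := b)]
      exact measure_mono hb) hlim2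
  linarith

end HalfH1

/-! ### Kernels supported in a sector -/

/-- The restriction of a kernel to the sector `x < y`. -/
def upperPart (A : ℝ → ℝ → ℝ) (x y : ℝ) : ℝ := if x < y then A x y else 0

theorem upperPart_of_le (A : ℝ → ℝ → ℝ) {x y : ℝ} (h : y ≤ x) : upperPart A x y = 0 :=
  if_neg (not_lt.2 h)

theorem upperPart_of_lt (A : ℝ → ℝ → ℝ) {x y : ℝ} (h : x < y) : upperPart A x y = A x y := if_pos h

theorem measurable_upperPart {A : ℝ → ℝ → ℝ} (hA : Continuous fun p : ℝ × ℝ => A p.1 p.2) :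
    Measurable fun p : ℝ × ℝ => upperPart A p.1 p.2 :=
  Measurable.ite (measurableSet_lt measurable_fst measurable_snd) hA.measurable measurable_const

theorem MomentPotential.integrableOn_tailAbs_half {r : ℝ → ℝ} (hr : MomentPotential r) :
    IntegrableOn (fun y => tailAbs r (y / 2)) (Ioi 0) := by
  have := (integrableOn_Ioi_comp_mul_right_iff (tailAbs r) 0 (a := 1 / 2) (by norm_num)).2
    (by simpa using hr.integrableOn_tailAbs)
  simpa [div_eq_mul_inv] using this

section Bounds

variable {r : ℝ → ℝ} (hr : MomentPotential r) {A : ℝ → ℝ → ℝ}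
  (hA : Continuous fun p : ℝ × ℝ => A p.1 p.2) {C : ℝ}
  (hb : ∀ x y, 0 ≤ x → x ≤ y → |A x y| ≤ |r ((x + y) / 2)| + C * tailAbs r ((x + y) / 2))
include hr hb

/-- One factor of `r` is traded for its sup bound, since `r` is controlled in `L¹` and `L^∞`. The
tail is evaluated at `y/2 ≤ (x + y)/2` to remove the dependence on `x`. -/
theorem sq_upperPart_le {M : ℝ} (hM : ∀ x, |r x| ≤ M) {x y : ℝ} (hx : 0 ≤ x) :
    upperPart A x y ^ 2 ≤ 2 * (M * |r ((x + y) / 2)| + C ^ 2 * tailAbs r (y / 2) ^ 2) := by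
  have hM0 : 0 ≤ M := (abs_nonneg _).trans (hM 0)
  rcases lt_or_ge x y with h | h
  · rw [upperPart_of_lt _ h]
    have h1 := hb x y hx h.le
    have h2 : tailAbs r ((x + y) / 2) ≤ tailAbs r (y / 2) := hr.tailAbs_antitone (by linarith)
    have h3 := tailAbs_nonneg r ((x + y) / 2)
    set a := |r ((x + y) / 2)| with ha
    have ha0 : 0 ≤ a := abs_nonneg _
    have haM : a ≤ M := hM _
    set b := tailAbs r ((x + y) / 2)
    have h4 : A x y ^ 2 ≤ (a + C * b) ^ 2 := by
      rw [← sq_abs]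
      exact pow_le_pow_left₀ (abs_nonneg _) h1 2
    have h5 : b ^ 2 ≤ tailAbs r (y / 2) ^ 2 := pow_le_pow_left₀ h3 h2 2
    have h6 : a ^ 2 ≤ M * a := by nlinarith
    have h7 : C ^ 2 * b ^ 2 ≤ C ^ 2 * tailAbs r (y / 2) ^ 2 :=
      mul_le_mul_of_nonneg_left h5 (sq_nonneg C)
    nlinarith [sq_nonneg (a - C * b)]
  · rw [upperPart_of_le _ h]
    rw [zero_pow two_ne_zero]
    positivity

include hA

/-- Square integrability on the product gives only almost every section. Every section is needed,
above all the one at `x = 0`, which enters the boundary functional. -/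
theorem memLp_upperPart_section {x : ℝ} (hx : 0 ≤ x) : MemLp (upperPart A x) 2 halfLine := by
  obtain ⟨M, hM⟩ := hr.bounded
  have hm : Measurable (upperPart A x) := (measurable_upperPart hA).comp measurable_prodMk_left
  refine (memLp_two_iff_integrable_sq hm.aestronglyMeasurable).2 ?_
  have i1 : Integrable (fun y => |r ((x + y) / 2)|) halfLine :=
    (((hr.integrable.abs.comp_div two_ne_zero).comp_add_left x)).integrableOn
  refine Integrable.mono' (((i1.const_mul M).add
    (hr.integrableOn_tailAbs_half.const_mul (C ^ 2 * tailAbs r 0))).const_mul 2)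
    (hm.pow_const 2).aestronglyMeasurable ?_
  filter_upwards [ae_restrict_mem measurableSet_Ioi] with y hy
  rw [Real.norm_of_nonneg (sq_nonneg _)]
  refine (sq_upperPart_le hr hb hM hx).trans ?_
  simp only [Pi.add_apply]
  have h1 : tailAbs r (y / 2) ≤ tailAbs r 0 := hr.tailAbs_antitone (by
    have : (0 : ℝ) < y := hy
    positivity)
  have h2 := tailAbs_nonneg r (y / 2)
  have h3 : C ^ 2 * (tailAbs r (y / 2) ^ 2) ≤ C ^ 2 * (tailAbs r 0 * tailAbs r (y / 2)) :=
    mul_le_mul_of_nonneg_left (by nlinarith) (sq_nonneg C)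
  linarith

/-- Integrate first in `x ∈ (0,y)`. The `r`-term yields a multiple of `tailAbs r (y/2)` after
substitution. The other term yields `y * tailAbs r (y/2) ^ 2`, where the first moment bound absorbs
`y` and one tail. What is left is integrable in `y`, again by the first moment. -/
theorem memLp_upperPart : MemLp (fun p : ℝ × ℝ => upperPart A p.1 p.2) 2 (halfLine.prod halfLine) := by
  obtain ⟨M, hM⟩ := hr.bounded
  have hM0 : 0 ≤ M := (abs_nonneg _).trans (hM 0)
  set m := ∫ τ in Ioi (0 : ℝ), τ * |r τ|
  have hm := measurable_upperPart hA
  refine ⟨hm.aestronglyMeasurable, ?_⟩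
  have hc1 := hr.continuous
  suffices h : eLpNorm (fun p : ℝ × ℝ => upperPart A p.1 p.2) 2 (halfLine.prod halfLine) ^ 2 < ⊤ by
    exact (ENNReal.pow_lt_top_iff.1 h).resolve_right two_ne_zero
  rw [eLpNorm_two_sq, lintegral_prod_symm _ (hm.enorm.pow_const 2).aemeasurable]
  have key : ∀ y : ℝ, 0 < y → ∫⁻ x, ‖upperPart A x y‖ₑ ^ 2 ∂halfLine ≤
      ENNReal.ofReal (4 * (M + C ^ 2 * m) * tailAbs r (y / 2)) := by
    intro y hy
    set G : ℝ → ℝ := fun x => 2 * (M * |r ((x + y) / 2)| + C ^ 2 * tailAbs r (y / 2) ^ 2) with hG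
    have hG0 : ∀ x, 0 ≤ G x := fun x => by positivity
    have hGc : Continuous G := by fun_prop
    have h1 : ∫⁻ x, ‖upperPart A x y‖ₑ ^ 2 ∂halfLine ≤
        ∫⁻ x, (Ioc 0 y).indicator (fun x => ENNReal.ofReal (G x)) x ∂halfLine := by
      refine lintegral_mono_ae ?_
      filter_upwards [ae_restrict_mem measurableSet_Ioi] with x hx
      rcases lt_or_ge x y with h | h
      · rw [indicator_of_mem (show x ∈ Ioc 0 y from ⟨hx, h.le⟩), Real.enorm_eq_ofReal_abs,
          ← ENNReal.ofReal_pow (abs_nonneg _), sq_abs]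
        exact ENNReal.ofReal_le_ofReal (sq_upperPart_le hr hb hM (le_of_lt hx))
      · rw [upperPart_of_le _ h]
        simp
    refine h1.trans ?_
    rw [lintegral_indicator measurableSet_Ioc, Measure.restrict_restrict measurableSet_Ioc,
      inter_eq_left.2 (Ioc_subset_Ioi_self : Ioc (0 : ℝ) y ⊆ Ioi 0),
      ← ofReal_integral_eq_lintegral_ofReal (hGc.integrableOn_Icc.mono_set Ioc_subset_Icc_self)
        (Eventually.of_forall hG0)]
    refine ENNReal.ofReal_le_ofReal ?_
    rw [← intervalIntegral.integral_of_le hy.le]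
    simp only [hG]
    rw [intervalIntegral.integral_const_mul, intervalIntegral.integral_add
      ((by fun_prop : Continuous _).intervalIntegrable _ _)
      ((by fun_prop : Continuous _).intervalIntegrable _ _), intervalIntegral.integral_const_mul,
      intervalIntegral.integral_const]
    have h2 : ∫ x in (0 : ℝ)..y, |r ((x + y) / 2)| = 2 * ∫ x in (y / 2)..y, |r x| := by
      have := intervalIntegral.integral_comp_div_add (a := 0) (b := y) (c := 2)
        (fun x => |r x|) two_ne_zero (y / 2)
      simp only [zero_div, zero_add, add_halves, smul_eq_mul] at this
      rw [← this]
      refine intervalIntegral.integral_congr fun x _ => ?_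
      simp only [add_div]
    have h3 : ∫ x in (y / 2)..y, |r x| ≤ tailAbs r (y / 2) := by
      rw [intervalIntegral.integral_of_le (by linarith)]
      exact setIntegral_mono_set hr.integrable.abs.integrableOn
        (Eventually.of_forall fun _ => abs_nonneg _) Ioc_subset_Ioi_self.eventuallyLE
    have h4 := hr.mul_tailAbs_le (x := y / 2) (by linarith)
    have h5 := tailAbs_nonneg r (y / 2)
    rw [h2]
    simp only [sub_zero, smul_eq_mul]
    have h6 : M * (2 * ∫ x in (y / 2)..y, |r x|) ≤ M * (2 * tailAbs r (y / 2)) := by gcongr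
    have h7 : y / 2 * tailAbs r (y / 2) * tailAbs r (y / 2) ≤ m * tailAbs r (y / 2) :=
      mul_le_mul_of_nonneg_right h4 h5
    have h8 := mul_le_mul_of_nonneg_left h7 (sq_nonneg C)
    nlinarith
  have h2 : ∫⁻ y, ∫⁻ x, ‖upperPart A x y‖ₑ ^ 2 ∂halfLine ∂halfLine ≤
      ∫⁻ y, ENNReal.ofReal (4 * (M + C ^ 2 * m) * tailAbs r (y / 2)) ∂halfLine := by
    refine lintegral_mono_ae ?_
    filter_upwards [ae_restrict_mem measurableSet_Ioi] with y hy using key y hy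
  have h3 : Integrable (fun y => 4 * (M + C ^ 2 * m) * tailAbs r (y / 2)) halfLine :=
    hr.integrableOn_tailAbs_half.const_mul _
  exact h2.trans_lt h3.lintegral_lt_top

end Bounds

/-! ### Leibniz rules -/

/-- `∫₀ˣ B(y,x) f(y) dy` as a primitive. -/
theorem integral_leibniz {B B₂ : ℝ → ℝ → ℝ} (hB : ∀ x y, HasDerivAt (fun s => B x s) (B₂ x y) y)
    (hc : Continuous fun p : ℝ × ℝ => B p.1 p.2) (hc₂ : Continuous fun p : ℝ × ℝ => B₂ p.1 p.2)
    {f : ℝ → ℝ} {x : ℝ} (hx : 0 ≤ x) (hf : IntervalIntegrable f volume 0 x) :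
    ∫ y in (0 : ℝ)..x, B y x * f y =
      ∫ s in (0 : ℝ)..x, (B s s * f s + ∫ y in (0 : ℝ)..s, B₂ y s * f y) := by
  set μ : Measure ℝ := volume.restrict (Ioc 0 x) with hμ
  have hf' : Integrable f μ := (intervalIntegrable_iff_integrableOn_Ioc_of_le hx).1 hf
  obtain ⟨C, hC⟩ := (isCompact_Icc.prod isCompact_Icc :
    IsCompact (Icc 0 x ×ˢ Icc 0 x)).exists_bound_of_continuousOn hc₂.continuousOn
  have hi : Integrable (fun p : ℝ × ℝ => upperPart B₂ p.1 p.2 * f p.1) (μ.prod μ) := by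
    have h1 : Integrable (fun p : ℝ × ℝ => f p.1 * 1) (μ.prod μ) :=
      hf'.mul_prod (integrable_const 1)
    simp only [mul_one] at h1
    refine h1.bdd_mul (c := C) (measurable_upperPart hc₂).aestronglyMeasurable ?_
    rw [hμ, Measure.prod_restrict]
    filter_upwards [ae_restrict_mem (measurableSet_Ioc.prod measurableSet_Ioc)] with p hp
    have hp' : p ∈ Icc 0 x ×ˢ Icc 0 x :=
      ⟨Ioc_subset_Icc_self hp.1, Ioc_subset_Icc_self hp.2⟩
    rcases lt_or_ge p.1 p.2 with h | h
    · rw [upperPart_of_lt _ h]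
      exact hC p hp'
    · rw [upperPart_of_le _ h, norm_zero]
      exact (norm_nonneg _).trans (hC p hp')
  -- Fubini on the triangle `0 < y < s ≤ x`, since `f` is merely integrable. Integrating in `s`
  -- first produces `B(y,x) - B(y,y)`.
  have hswap := integral_integral_swap (f := fun y s => upperPart B₂ y s * f y) hi
  have hBd : IntervalIntegrable (fun y => B y y * f y) volume 0 x :=
    hf.continuousOn_mul (by fun_prop)
  have e1 : ∀ y ∈ Ioc 0 x, ∫ s, upperPart B₂ y s * f y ∂μ = (B y x - B y y) * f y := by
    intro y hy
    rw [integral_mul_const]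
    congr 1
    have h1 : ∫ s, upperPart B₂ y s ∂μ = ∫ s in Ioc y x, B₂ y s := by
      have : ∀ s, upperPart B₂ y s = (Ioi y).indicator (fun s => B₂ y s) s := fun s => by
        simp [upperPart, indicator_apply]
      simp_rw [this]
      rw [integral_indicator measurableSet_Ioi, hμ, Measure.restrict_restrict measurableSet_Ioi]
      congr 2
      ext s
      simp only [mem_inter_iff, mem_Ioi, mem_Ioc]
      constructor
      · exact fun h => ⟨h.1, h.2.2⟩
      · exact fun h => ⟨h.1, hy.1.trans h.1, h.2⟩
    rw [h1, ← intervalIntegral.integral_of_le hy.2]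
    exact intervalIntegral.integral_eq_sub_of_hasDerivAt (fun s _ => hB y s)
      ((by fun_prop : Continuous fun s => B₂ y s).intervalIntegrable _ _)
  have e2 : ∀ s ∈ Ioc 0 x, ∫ y, upperPart B₂ y s * f y ∂μ = ∫ y in (0 : ℝ)..s, B₂ y s * f y := by
    intro s hs
    rw [intervalIntegral.integral_of_le hs.1.le]
    have : ∀ y, upperPart B₂ y s * f y = (Iio s).indicator (fun y => B₂ y s * f y) y := fun y => by
      by_cases h : y < s <;> simp [upperPart, h]
    simp_rw [this]
    rw [integral_indicator measurableSet_Iio, hμ, Measure.restrict_restrict measurableSet_Iio,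
      ← integral_Ioc_eq_integral_Ioo.symm]
    congr 2
    ext y
    simp only [mem_inter_iff, mem_Iio, mem_Ioc, mem_Ioo]
    constructor
    · exact fun h => ⟨h.2.1, h.1⟩
    · exact fun h => ⟨h.2, h.1, h.2.le.trans hs.2⟩
  have hin : IntervalIntegrable (fun s => ∫ y in (0 : ℝ)..s, B₂ y s * f y) volume 0 x := by
    rw [intervalIntegrable_iff_integrableOn_Ioc_of_le hx]
    refine (hi.integral_prod_right).congr ?_
    filter_upwards [ae_restrict_mem measurableSet_Ioc] with s hs using e2 s hs
  rw [intervalIntegral.integral_add hBd hin]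
  have e3 : ∫ s in (0 : ℝ)..x, ∫ y in (0 : ℝ)..s, B₂ y s * f y =
      ∫ y in (0 : ℝ)..x, (B y x * f y - B y y * f y) := by
    rw [intervalIntegral.integral_of_le hx, intervalIntegral.integral_of_le hx,
      ← setIntegral_congr_fun measurableSet_Ioc e2, ← hswap]
    refine (setIntegral_congr_fun measurableSet_Ioc e1).trans ?_
    simp only [sub_mul]
  rw [e3, intervalIntegral.integral_sub (hf.continuousOn_mul (by fun_prop)) hBd]
  ring

/-- A potential together with its smooth kernel. -/
structure TransformData where
  r : ℝ → ℝ
  K : ℝ → ℝ → ℝ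
  K₁ : ℝ → ℝ → ℝ
  K₂ : ℝ → ℝ → ℝ
  K₁₁ : ℝ → ℝ → ℝ
  K₂₂ : ℝ → ℝ → ℝ
  hr : MomentPotential r
  hK : SmoothKernel r K K₁ K₂ K₁₁ K₂₂

namespace TransformData

variable (S : TransformData)

theorem continuousK : Continuous fun p : ℝ × ℝ => S.K p.1 p.2 := S.hK.contDiff.continuous

theorem exists_bound : ∃ C, ∀ A, A = S.K ∨ A = S.K₁ ∨ A = S.K₂ → ∀ x y, 0 ≤ x → x ≤ y →
    |A x y| ≤ |S.r ((x + y) / 2)| + C * tailAbs S.r ((x + y) / 2) := by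
  obtain ⟨C, hC, h⟩ := S.hK.bound
  refine ⟨C, fun A hA x y hx hxy => ?_⟩
  obtain ⟨h1, h2, h3⟩ := h x y hx hxy
  rcases hA with rfl | rfl | rfl
  · exact h1.trans (le_add_of_nonneg_left (abs_nonneg _))
  · exact h2
  · exact h3

theorem memLpK :
    MemLp (fun p : ℝ × ℝ => upperPart S.K p.1 p.2) 2 (halfLine.prod halfLine) :=
  memLp_upperPart S.hr S.continuousK (S.exists_bound.choose_spec _ (Or.inl rfl))

theorem memLpK₁ :
    MemLp (fun p : ℝ × ℝ => upperPart S.K₁ p.1 p.2) 2 (halfLine.prod halfLine) :=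
  memLp_upperPart S.hr S.hK.continuous₁ (S.exists_bound.choose_spec _ (Or.inr (Or.inl rfl)))

theorem memLpK₂ :
    MemLp (fun p : ℝ × ℝ => upperPart S.K₂ p.1 p.2) 2 (halfLine.prod halfLine) :=
  memLp_upperPart S.hr S.hK.continuous₂ (S.exists_bound.choose_spec _ (Or.inr (Or.inr rfl)))

theorem memLpK_section {x : ℝ} (hx : 0 ≤ x) : MemLp (upperPart S.K x) 2 halfLine :=
  memLp_upperPart_section S.hr S.continuousK (S.exists_bound.choose_spec _ (Or.inl rfl)) hx

theorem memLpK₁_section {x : ℝ} (hx : 0 ≤ x) : MemLp (upperPart S.K₁ x) 2 halfLine :=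
  memLp_upperPart_section S.hr S.hK.continuous₁
    (S.exists_bound.choose_spec _ (Or.inr (Or.inl rfl))) hx

theorem _root_.MeasureTheory.MemLp.swap_halfLine {A : ℝ → ℝ → ℝ}
    (h : MemLp (fun p : ℝ × ℝ => A p.1 p.2) 2 (halfLine.prod halfLine)) :
    MemLp (fun p : ℝ × ℝ => A p.2 p.1) 2 (halfLine.prod halfLine) :=
  h.comp_measurePreserving Measure.measurePreserving_swap

/-- `f ↦ ∫ₓ^∞ K(x,ξ) f(ξ) dξ`. -/
def opK : HalfL2 →L[ℝ] HalfL2 := hsOp S.memLpK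

/-- `f ↦ ∫ₓ^∞ ∂₁K(x,ξ) f(ξ) dξ`. -/
def opK₁ : HalfL2 →L[ℝ] HalfL2 := hsOp S.memLpK₁

/-- `f ↦ ∫₀ˣ K(y,x) f(y) dy`. -/
def opK' : HalfL2 →L[ℝ] HalfL2 := hsOp (k := fun x y => upperPart S.K y x) S.memLpK.swap_halfLine

/-- `f ↦ ∫₀ˣ ∂₁K(y,x) f(y) dy`. -/
def opK₁' : HalfL2 →L[ℝ] HalfL2 := hsOp (k := fun x y => upperPart S.K₁ y x) S.memLpK₁.swap_halfLine

/-- `f ↦ ∫₀ˣ ∂₂K(y,x) f(y) dy`. -/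
def opK₂' : HalfL2 →L[ℝ] HalfL2 := hsOp (k := fun x y => upperPart S.K₂ y x) S.memLpK₂.swap_halfLine

theorem exists_opd : ∃ A : HalfL2 →L[ℝ] HalfL2, ∀ f, A f =ᵐ[halfLine] fun x => S.K x x * f x := by
  refine exists_mulOp (C := (∫ τ, |S.r τ|) / 2)
    (S.continuousK.comp (by fun_prop : Continuous fun x : ℝ => (x, x))).measurable
    (Eventually.of_forall fun x => ?_)
  rw [S.hK.diagonal x, abs_div, abs_two]
  gcongr
  exact abs_integral_le_integral_abs.trans (setIntegral_le_integral S.hr.integrable.abs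
    (Eventually.of_forall fun _ => abs_nonneg _))

/-- Multiplication by `K(x,x)`. -/
def opd : HalfL2 →L[ℝ] HalfL2 := S.exists_opd.choose

theorem opd_coe (f : HalfL2) : S.opd f =ᵐ[halfLine] fun x => S.K x x * f x :=
  S.exists_opd.choose_spec f

theorem exists_opr : ∃ A : HalfL2 →L[ℝ] HalfL2, ∀ f, A f =ᵐ[halfLine] fun x => S.r x * f x :=
  exists_mulOp S.hr.continuous.measurable (Eventually.of_forall S.hr.bounded.choose_spec)

/-- Multiplication by `r`. -/
def opr : HalfL2 →L[ℝ] HalfL2 := S.exists_opr.choose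

theorem opr_coe (f : HalfL2) : S.opr f =ᵐ[halfLine] fun x => S.r x * f x :=
  S.exists_opr.choose_spec f

theorem integral_lower {A : ℝ → ℝ → ℝ} (f : ℝ → ℝ) {x : ℝ} (hx : 0 < x) :
    ∫ y, upperPart A y x * f y ∂halfLine = ∫ y in (0 : ℝ)..x, A y x * f y := by
  rw [intervalIntegral.integral_of_le hx.le]
  have : ∀ y, upperPart A y x * f y = (Iio x).indicator (fun y => A y x * f y) y := fun y => by
    by_cases h : y < x <;> simp [upperPart, h]
  simp_rw [this]
  rw [integral_indicator measurableSet_Iio, Measure.restrict_restrict measurableSet_Iio,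
    integral_Ioc_eq_integral_Ioo]
  congr 2
  ext y
  simp [and_comm]

theorem opK'_coe (f : HalfL2) :
    S.opK' f =ᵐ[halfLine] fun x => ∫ y in (0 : ℝ)..x, S.K y x * f y := by
  filter_upwards [hsOp_coe (k := fun x y => upperPart S.K y x) S.memLpK.swap_halfLine f,
    ae_restrict_mem measurableSet_Ioi] with x h hx
  exact h.trans (integral_lower f hx)

theorem opK₁'_coe (f : HalfL2) :
    S.opK₁' f =ᵐ[halfLine] fun x => ∫ y in (0 : ℝ)..x, S.K₁ y x * f y := by
  filter_upwards [hsOp_coe (k := fun x y => upperPart S.K₁ y x) S.memLpK₁.swap_halfLine f,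
    ae_restrict_mem measurableSet_Ioi] with x h hx
  exact h.trans (integral_lower f hx)

theorem opK₂'_coe (f : HalfL2) :
    S.opK₂' f =ᵐ[halfLine] fun x => ∫ y in (0 : ℝ)..x, S.K₂ y x * f y := by
  filter_upwards [hsOp_coe (k := fun x y => upperPart S.K₂ y x) S.memLpK₂.swap_halfLine f,
    ae_restrict_mem measurableSet_Ioi] with x h hx
  exact h.trans (integral_lower f hx)

theorem inner_opK (f g : HalfL2) : inner ℝ (S.opK f) g = inner ℝ f (S.opK' g) :=
  inner_hsOp _ _ f g

theorem inner_opK₁ (f g : HalfL2) : inner ℝ (S.opK₁ f) g = inner ℝ f (S.opK₁' g) :=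
  inner_hsOp _ _ f g

theorem inner_mul {A : HalfL2 →L[ℝ] HalfL2} {m : ℝ → ℝ}
    (h : ∀ f, A f =ᵐ[halfLine] fun x => m x * f x) (f g : HalfL2) :
    inner ℝ (A f) g = inner ℝ f (A g) := by
  rw [inner_eq_integral, inner_eq_integral]
  refine integral_congr_ae ?_
  filter_upwards [h f, h g] with x h1 h2
  rw [h1, h2]
  ring

theorem isUnit_opK : IsUnit (1 + S.opK) :=
  isUnit_one_add_hsOp S.memLpK fun _ _ h => upperPart_of_le _ h

/-- This kernel is supported on the opposite side of the diagonal, so invertibility is inherited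
from the adjoint. -/
theorem isUnit_opK' : IsUnit (1 + S.opK') := by
  have h : S.opK' = star S.opK := (adjoint_hsOp _ _).symm
  rw [h, ← star_one, ← star_add]
  exact S.isUnit_opK.star

/-! ### Derivatives of the integral operators -/

/-- The diagonal values are differentiated twice over, once by the formula for `K(x,x)` and once by
the chain rule, and the two results are compared. -/
theorem hasDerivAt_diag (x : ℝ) :
    HasDerivAt (fun x => S.K x x) (-(S.r x / 2)) x ∧ S.K₁ x x + S.K₂ x x = -(S.r x / 2) := by
  have h1 : HasDerivAt (fun x => S.K x x) (-(S.r x / 2)) x := by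
    rw [funext S.hK.diagonal]
    refine ((hasDerivAt_integral_Ioi S.hr.integrable
      S.hr.continuous.continuousAt).div_const 2).congr_deriv ?_
    ring
  refine ⟨h1, ?_⟩
  have h2 := hasFDerivAt_of_partials S.hK.hasDerivAt₁ S.hK.hasDerivAt₂ S.hK.continuous₁
    S.hK.continuous₂ (x, x)
  have h3 := h2.comp_hasDerivAt (f := fun x : ℝ => (x, x)) x
    ((hasDerivAt_id x).prodMk (hasDerivAt_id x))
  have := HasDerivAt.unique h3 h1
  simpa using this

theorem isPrimitive_opK' (f : HalfL2) : IsPrimitive (S.opK' f) (S.opd f + S.opK₂' f) 0 := by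
  filter_upwards [S.opK'_coe f, ae_restrict_mem measurableSet_Ioi] with x h hx
  have hx' : (0 : ℝ) ≤ x := le_of_lt hx
  rw [h, zero_add, integral_leibniz S.hK.hasDerivAt₂ S.continuousK S.hK.continuous₂ hx'
    (f.intervalIntegrable le_rfl hx')]
  refine integral_congr_halfLine ?_ le_rfl hx'
  filter_upwards [Lp.coeFn_add (S.opd f) (S.opK₂' f), S.opd_coe f, S.opK₂'_coe f] with s h1 h2 h3
  rw [h1, Pi.add_apply, h2, h3]

/-- For `f` only in `L²` the Leibniz rule is proved in integrated form. By Fubini, integrating `∂₁K`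
over `t ∈ (0,x)`, `t < ξ` gives `K(min(x,ξ),ξ) - K(0,ξ)`; the part `ξ ≤ x` is the diagonal term. -/
theorem isPrimitive_opK (f : HalfL2) : IsPrimitive (S.opK f) (S.opK₁ f - S.opd f)
    (∫ ξ, upperPart S.K 0 ξ * f ξ ∂halfLine) := by
  filter_upwards [hsOp_coe S.memLpK f, ae_restrict_mem measurableSet_Ioi] with x h hx
  have hx' : (0 : ℝ) ≤ x := le_of_lt hx
  rw [opK, h]
  have hic : ∀ {x : ℝ}, 0 ≤ x → Integrable (fun ξ => upperPart S.K x ξ * f ξ) halfLine :=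
    fun hx => (S.memLpK_section hx).integrable_mul (Lp.memLp f)
  have hf1 := (S.opK₁ f).intervalIntegrable le_rfl hx'
  have hf2 := (S.opd f).intervalIntegrable le_rfl hx'
  have e0 : ∫ t in (0 : ℝ)..x, (S.opK₁ f - S.opd f) t =
      (∫ t in (0 : ℝ)..x, S.opK₁ f t) - ∫ t in (0 : ℝ)..x, S.opd f t := by
    rw [← intervalIntegral.integral_sub hf1 hf2]
    exact integral_congr_halfLine (Lp.coeFn_sub _ _) le_rfl hx'
  set μ : Measure ℝ := volume.restrict (Ioc 0 x) with hμ
  have hle : μ.prod halfLine ≤ halfLine.prod halfLine := by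
    rw [hμ, Measure.prod_restrict, Measure.prod_restrict]
    exact Measure.restrict_mono (Set.prod_mono Ioc_subset_Ioi_self le_rfl) le_rfl
  have hi : Integrable (fun p : ℝ × ℝ => upperPart S.K₁ p.1 p.2 * f p.2) (μ.prod halfLine) := by
    have h1 : MemLp (fun p : ℝ × ℝ => upperPart S.K₁ p.1 p.2) 2 (μ.prod halfLine) :=
      S.memLpK₁.mono_measure hle
    have h2 : MemLp (fun p : ℝ × ℝ => f p.2) 2 (μ.prod halfLine) := by
      refine (memLp_two_iff_integrable_sq (Lp.aestronglyMeasurable f).comp_snd).2 ?_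
      have := (integrable_const (μ := μ) (1 : ℝ)).mul_prod (Lp.memLp f).integrable_sq
      simpa using this
    exact h1.integrable_mul h2
  have e1 : ∫ t in (0 : ℝ)..x, S.opK₁ f t =
      ∫ ξ, (S.K (min x ξ) ξ - S.K 0 ξ) * f ξ ∂halfLine := by
    have h1 : ∫ t in (0 : ℝ)..x, S.opK₁ f t = ∫ t, ∫ ξ, upperPart S.K₁ t ξ * f ξ ∂halfLine ∂μ := by
      rw [← intervalIntegral.integral_of_le hx']
      exact integral_congr_halfLine (hsOp_coe S.memLpK₁ f) le_rfl hx'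
    rw [h1, integral_integral_swap (f := fun t ξ => upperPart S.K₁ t ξ * f ξ) hi]
    refine integral_congr_ae ?_
    filter_upwards [ae_restrict_mem measurableSet_Ioi] with ξ hξ
    rw [mem_Ioi] at hξ hx
    rw [integral_mul_const]
    congr 1
    have h2 : ∀ t, upperPart S.K₁ t ξ = (Iio ξ).indicator (fun t => S.K₁ t ξ) t := fun t => by
      by_cases h : t < ξ <;> simp [upperPart, h]
    simp_rw [h2]
    have hm : 0 ≤ min x ξ := le_min hx' hξ.le
    have h3 : ∫ t in (0 : ℝ)..(min x ξ), S.K₁ t ξ = S.K (min x ξ) ξ - S.K 0 ξ := by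
      have hc := S.hK.continuous₁
      exact intervalIntegral.integral_eq_sub_of_hasDerivAt (fun t _ => S.hK.hasDerivAt₁ t ξ)
        ((by fun_prop : Continuous fun t => S.K₁ t ξ).intervalIntegrable _ _)
    rw [← h3, intervalIntegral.integral_of_le hm, integral_indicator measurableSet_Iio, hμ,
      Measure.restrict_restrict measurableSet_Iio]
    refine setIntegral_congr_set ?_
    have h4 : (Iio ξ ∩ Ioc 0 x : Set ℝ) =ᵐ[volume] (Iic ξ ∩ Ioc 0 x : Set ℝ) :=
      Iio_ae_eq_Iic.inter (ae_eq_refl _)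
    have h5 : (Iic ξ ∩ Ioc 0 x : Set ℝ) = Ioc 0 (min x ξ) := by
      ext t
      simp only [mem_inter_iff, mem_Iic, mem_Ioc, le_min_iff]
      tauto
    rwa [h5] at h4
  have e2 : ∫ t in (0 : ℝ)..x, S.opd f t =
      ∫ ξ, (Iic x).indicator (fun ξ => S.K ξ ξ * f ξ) ξ ∂halfLine := by
    rw [integral_indicator measurableSet_Iic, Measure.restrict_restrict measurableSet_Iic,
      inter_comm, Ioi_inter_Iic, ← intervalIntegral.integral_of_le hx']
    exact integral_congr_halfLine (S.opd_coe f) le_rfl hx'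
  have hid : Integrable (fun ξ => (Iic x).indicator (fun ξ => S.K ξ ξ * f ξ) ξ) halfLine := by
    rw [integrable_indicator_iff measurableSet_Iic, IntegrableOn,
      Measure.restrict_restrict measurableSet_Iic, inter_comm, Ioi_inter_Iic]
    have hc := S.continuousK
    exact (intervalIntegrable_iff_integrableOn_Ioc_of_le hx').1
      ((f.intervalIntegrable le_rfl hx').continuousOn_mul (by fun_prop))
  -- The minimum is `x` beyond `x` and `ξ` before it, so the three terms are the operator at `x`,
  -- the diagonal integral and the operator at `0`.
  have e3 : ∀ᵐ ξ ∂halfLine, (S.K (min x ξ) ξ - S.K 0 ξ) * f ξ = upperPart S.K x ξ * f ξ +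
      (Iic x).indicator (fun ξ => S.K ξ ξ * f ξ) ξ - upperPart S.K 0 ξ * f ξ := by
    filter_upwards [ae_restrict_mem measurableSet_Ioi] with ξ hξ
    rw [upperPart_of_lt S.K hξ]
    rcases lt_or_ge x ξ with h1 | h1
    · rw [upperPart_of_lt _ h1, min_eq_left h1.le, indicator_of_notMem (by simpa using h1)]
      ring
    · rw [upperPart_of_le _ h1, min_eq_right h1, indicator_of_mem (by simpa using h1)]
      ring
  have i1 := hic hx'
  have i0 := hic (le_refl (0 : ℝ))
  rw [e0, e1, e2, integral_congr_ae e3]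
  have e4 : ∫ ξ, (upperPart S.K x ξ * f ξ + (Iic x).indicator (fun ξ => S.K ξ ξ * f ξ) ξ -
      upperPart S.K 0 ξ * f ξ) ∂halfLine = (∫ ξ, upperPart S.K x ξ * f ξ ∂halfLine) +
      (∫ ξ, (Iic x).indicator (fun ξ => S.K ξ ξ * f ξ) ξ ∂halfLine) -
      ∫ ξ, upperPart S.K 0 ξ * f ξ ∂halfLine := by
    rw [← integral_add i1 hid]
    exact integral_sub (i1.add hid) i0
  rw [e4]
  ring

end TransformData

/-! ### Operators `1 + A` on `H¹(0,∞)` with `A` mapping `L²` into `H¹`. -/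

namespace HalfH1

/-- The element of `H¹(0,∞)` with the given function and derivative. -/
def mk {f g : HalfL2} {c : ℝ} (h : IsPrimitive f g c) : HalfH1 := ⟨(f, g), c, h⟩

theorem val_mk {f g : HalfL2} {c : ℝ} (h : IsPrimitive f g c) : val (mk h) = f := rfl

theorem der_mk {f g : HalfL2} {c : ℝ} (h : IsPrimitive f g c) : der (mk h) = g := rfl

theorem trace_mk {f g : HalfL2} {c : ℝ} (h : IsPrimitive f g c) : trace (mk h) = c :=
  trace_eq (p := mk h) h

/-- An operator into `H¹(0,∞)` from its two components. -/
def lift (A B : HalfL2 →L[ℝ] HalfL2) (h : ∀ f, ∃ c, IsPrimitive (A f) (B f) c) :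
    HalfL2 →L[ℝ] HalfH1 :=
  (A.prod B).codRestrict HalfH1 h

variable {A B : HalfL2 →L[ℝ] HalfL2} (h : ∀ f, ∃ c, IsPrimitive (A f) (B f) c)

theorem val_lift (f : HalfL2) : val (lift A B h f) = A f := rfl

theorem der_lift (f : HalfL2) : der (lift A B h f) = B f := rfl

theorem trace_lift {f : HalfL2} {c : ℝ} (hc : IsPrimitive (A f) (B f) c) :
    trace (lift A B h f) = c :=
  trace_eq (p := lift A B h f) hc

/-- The operator `1 + A` on `H¹(0,∞)`, if it is invertible on `L²(0,∞)`. -/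
def oneAddEquiv (hA : IsUnit (1 + A)) : HalfH1 ≃L[ℝ] HalfH1 :=
  ContinuousLinearEquiv.equivOfInverse
    (ContinuousLinearMap.id ℝ HalfH1 + (lift A B h).comp val)
    -- The identity `(1 + A)⁻¹ = 1 - A (1 + A)⁻¹` keeps the inverse inside `H¹`, because the outer
    -- `A` maps `L²` into `H¹`.
    (ContinuousLinearMap.id ℝ HalfH1 - (lift A B h).comp ((Ring.inverse (1 + A)).comp val))
    (fun p => by
      have h1 : Ring.inverse (1 + A) (val p + A (val p)) = val p :=
        congrArg (fun S : HalfL2 →L[ℝ] HalfL2 => S (val p)) (Ring.inverse_mul_cancel _ hA)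
      simp only [sub_apply, add_apply, ContinuousLinearMap.coe_id', id_eq,
        ContinuousLinearMap.comp_apply, map_add, val_lift]
      have h2 := congrArg (lift A B h) h1
      rw [map_add, map_add] at h2
      rw [← h2]
      abel)
    (fun p => by
      have h1 : Ring.inverse (1 + A) (val p) + A (Ring.inverse (1 + A) (val p)) = val p :=
        congrArg (fun S : HalfL2 →L[ℝ] HalfL2 => S (val p)) (Ring.mul_inverse_cancel _ hA)
      simp only [sub_apply, add_apply, ContinuousLinearMap.coe_id', id_eq,
        ContinuousLinearMap.comp_apply, map_sub, val_lift]
      have h2 := congrArg (lift A B h) h1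
      rw [map_add] at h2
      rw [← h2]
      abel)

theorem oneAddEquiv_apply (hA : IsUnit (1 + A)) (p : HalfH1) :
    oneAddEquiv h hA p = p + lift A B h (val p) := rfl

theorem val_oneAddEquiv (hA : IsUnit (1 + A)) (p : HalfH1) :
    val (oneAddEquiv h hA p) = val p + A (val p) := by
  rw [oneAddEquiv_apply, map_add, val_lift]

theorem der_oneAddEquiv (hA : IsUnit (1 + A)) (p : HalfH1) :
    der (oneAddEquiv h hA p) = der p + B (val p) := by
  rw [oneAddEquiv_apply, map_add, der_lift]

end HalfH1

/-! ### The intertwining relation on the half-line. -/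

namespace TransformData

variable (S : TransformData)

/-- The function `∂₁K(0,·)`. -/
def κ : HalfL2 := (S.memLpK₁_section le_rfl).toLp

theorem κ_coe : S.κ =ᵐ[halfLine] S.K₁ 0 := by
  filter_upwards [(S.memLpK₁_section le_rfl).coeFn_toLp, ae_restrict_mem measurableSet_Ioi]
    with x hx h0
  exact hx.trans (upperPart_of_lt _ h0)

/-- This is the second derivative of `K'q`, which exists in `L²` although `q` has only one
derivative. Under the integral, `∂₂²K` is replaced by `∂₁²K - rK`, and the former is integrated by
parts in `y`. The boundary term at `y = 0` produces `∂₁K(0,·)` times the trace. The diagonal terms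
combine through `∂₁K + ∂₂K = -r/2` with the derivative of `K(s,s) q(s)` into `-r q`. -/
theorem isPrimitive_opd_add_opK₂' (q : HalfH1) :
    IsPrimitive (S.opd (HalfH1.val q) + S.opK₂' (HalfH1.val q))
      (-S.opr (HalfH1.val q) + S.opd (HalfH1.der q) - HalfH1.trace q • S.κ -
        S.opK₁' (HalfH1.der q) - S.opK' (S.opr (HalfH1.val q))) (S.K 0 0 * HalfH1.trace q) := by
  set f := HalfH1.val q
  set g := HalfH1.der q
  set t := HalfH1.trace q
  set R := -S.opr f + S.opd g - t • S.κ - S.opK₁' g - S.opK' (S.opr f) with hR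
  have hfg : f =ᵐ[halfLine] HalfH1.rep q := HalfH1.isPrimitive q
  have hcK := S.continuousK
  have hc₁ := S.hK.continuous₁
  have hc₁₁ := S.hK.continuous₁₁
  have hcr := S.hr.continuous
  have hd : Continuous fun s => S.K s s := by fun_prop
  have hRae : ∀ᵐ s ∂halfLine, R s = -(S.r s * f s) + S.K s s * g s - t * S.K₁ 0 s -
      (∫ y in (0 : ℝ)..s, S.K₁ y s * g y) - ∫ y in (0 : ℝ)..s, S.K y s * (S.r y * f y) := by
    filter_upwards [Lp.coeFn_sub (-S.opr f + S.opd g - t • S.κ - S.opK₁' g) (S.opK' (S.opr f)),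
      Lp.coeFn_sub (-S.opr f + S.opd g - t • S.κ) (S.opK₁' g),
      Lp.coeFn_sub (-S.opr f + S.opd g) (t • S.κ), Lp.coeFn_add (-S.opr f) (S.opd g),
      Lp.coeFn_neg (S.opr f), S.opr_coe f, S.opd_coe g, Lp.coeFn_smul t S.κ, S.κ_coe,
      S.opK₁'_coe g, S.opK'_coe (S.opr f), ae_restrict_mem measurableSet_Ioi]
      with s h1 h2 h3 h4 h5 h6 h7 h8 h9 h10 h11 hs
    rw [hR, h1, Pi.sub_apply, h2, Pi.sub_apply, h3, Pi.sub_apply, h4, Pi.add_apply, h5,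
      Pi.neg_apply, h6, h7, h8, Pi.smul_apply, h9, h10, h11, smul_eq_mul]
    congr 1
    refine integral_congr_halfLine ?_ le_rfl (le_of_lt hs)
    filter_upwards [S.opr_coe f] with y hy
    rw [hy]
  -- The subtracted bracket is the derivative of `K(s,s) q(s)`; after integration it cancels the
  -- contribution of `S.opd` up to its value at `0`.
  have hF2 : ∀ᵐ s ∂halfLine, S.K₂ s s * f s + ∫ y in (0 : ℝ)..s, S.K₂₂ y s * f y =
      R s - (-(S.r s / 2) * HalfH1.rep q s + S.K s s * g s) := by
    filter_upwards [hRae, hfg, ae_restrict_mem measurableSet_Ioi] with s h1 h2 hs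
    have hs' : (0 : ℝ) ≤ s := le_of_lt hs
    have i1 : IntervalIntegrable (fun y => S.K₁₁ y s * f y) volume 0 s :=
      (f.intervalIntegrable le_rfl hs').continuousOn_mul (by fun_prop)
    have i2 : IntervalIntegrable (fun y => S.K y s * (S.r y * f y)) volume 0 s :=
      ((f.intervalIntegrable le_rfl hs').continuousOn_mul (by fun_prop)).continuousOn_mul
        (by fun_prop)
    have i3 : IntervalIntegrable (fun y => S.K₁ y s * g y) volume 0 s :=
      (g.intervalIntegrable le_rfl hs').continuousOn_mul (by fun_prop)
    have e1 : ∫ y in (0 : ℝ)..s, S.K₂₂ y s * f y =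
        (∫ y in (0 : ℝ)..s, S.K₁₁ y s * f y) - ∫ y in (0 : ℝ)..s, S.K y s * (S.r y * f y) := by
      rw [← intervalIntegral.integral_sub i1 i2]
      refine intervalIntegral.integral_congr fun y _ => ?_
      have := S.hK.equation y s
      linear_combination (-f y) * this
    have hp : ∀ y, S.K₁ 0 s + ∫ z in (0 : ℝ)..y, S.K₁₁ z s = S.K₁ y s := fun y => by
      rw [intervalIntegral.integral_eq_sub_of_hasDerivAt (fun z _ => S.hK.hasDerivAt₁₁ z s)
        ((by fun_prop : Continuous fun z => S.K₁₁ z s).intervalIntegrable _ _)]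
      ring
    have e2 := integral_primitive_mul
      ((by fun_prop : Continuous fun z => S.K₁₁ z s).intervalIntegrable 0 s)
      (g.intervalIntegrable le_rfl hs') (S.K₁ 0 s) t
    simp only [hp] at e2
    have e3 : ∫ y in (0 : ℝ)..s, (S.K₁₁ y s * (t + ∫ t in (0 : ℝ)..y, g t) + S.K₁ y s * g y) =
        (∫ y in (0 : ℝ)..s, S.K₁₁ y s * f y) + ∫ y in (0 : ℝ)..s, S.K₁ y s * g y := by
      rw [← intervalIntegral.integral_add i1 i3]
      refine integral_congr_halfLine ?_ le_rfl hs'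
      filter_upwards [hfg] with y hy
      rw [hy, HalfH1.rep]
    have e4 := (S.hasDerivAt_diag s).2
    have e5 : t + ∫ t in (0 : ℝ)..s, g t = HalfH1.rep q s := rfl
    rw [h1, e1, h2]
    rw [e3, e5] at e2
    linear_combination e2 + HalfH1.rep q s * e4
  have hprim : ∀ x, S.K 0 0 + ∫ s in (0 : ℝ)..x, -(S.r s / 2) = S.K x x := fun x => by
    rw [intervalIntegral.integral_eq_sub_of_hasDerivAt (fun z _ => (S.hasDerivAt_diag z).1)
      ((by fun_prop : Continuous fun z => -(S.r z / 2)).intervalIntegrable _ _)]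
    ring
  filter_upwards [Lp.coeFn_add (S.opd f) (S.opK₂' f), S.opd_coe f, S.opK₂'_coe f, hfg,
    ae_restrict_mem measurableSet_Ioi] with x h1 h2 h3 h4 hx
  have hx' : (0 : ℝ) ≤ x := le_of_lt hx
  have i1 : IntervalIntegrable (fun s => -(S.r s / 2) * HalfH1.rep q s + S.K s s * g s)
      volume 0 x := by
    refine IntervalIntegrable.add ?_
      ((g.intervalIntegrable le_rfl hx').continuousOn_mul (by fun_prop))
    refine ContinuousOn.intervalIntegrable ?_
    rw [uIcc_of_le hx']
    exact (Continuous.continuousOn (by fun_prop)).mul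
      ((HalfH1.continuousOn_rep q).mono Icc_subset_Ici_self)
  have e1 := integral_primitive_mul
    ((by fun_prop : Continuous fun z => -(S.r z / 2)).intervalIntegrable 0 x)
    (g.intervalIntegrable le_rfl hx') (S.K 0 0) t
  simp only [hprim] at e1
  have e5 : ∀ s, t + ∫ t in (0 : ℝ)..s, g t = HalfH1.rep q s := fun _ => rfl
  simp only [e5] at e1
  rw [h1, Pi.add_apply, h2, h3, integral_leibniz S.hK.hasDerivAt₂₂ S.hK.continuous₂
    S.hK.continuous₂₂ hx' (f.intervalIntegrable le_rfl hx'),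
    integral_congr_halfLine hF2 le_rfl hx',
    intervalIntegral.integral_sub (R.intervalIntegrable le_rfl hx') i1, e1, h4]
  ring

/-- The transformation operator on `H¹(0,∞)`. -/
def equivT : HalfH1 ≃L[ℝ] HalfH1 :=
  HalfH1.oneAddEquiv (A := S.opK) (B := S.opK₁ - S.opd) (fun f => ⟨_, S.isPrimitive_opK f⟩)
    S.isUnit_opK

/-- The adjoint of the transformation operator, on `H¹(0,∞)`. -/
def equivT' : HalfH1 ≃L[ℝ] HalfH1 :=
  HalfH1.oneAddEquiv (A := S.opK') (B := S.opd + S.opK₂') (fun f => ⟨_, S.isPrimitive_opK' f⟩)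
    S.isUnit_opK'

/-- The functional relating the controls of the two systems. -/
def feedback : HalfH1 →L[ℝ] ℝ :=
  (innerSL ℝ S.κ).comp HalfH1.val - S.K 0 0 • HalfH1.trace

theorem val_equivT (p : HalfH1) :
    HalfH1.val (S.equivT p) = HalfH1.val p + S.opK (HalfH1.val p) :=
  HalfH1.val_oneAddEquiv _ _ p

theorem inner_val_equivT (p q : HalfH1) : inner ℝ (HalfH1.val (S.equivT p)) (HalfH1.val q) =
    inner ℝ (HalfH1.val p) (HalfH1.val (S.equivT' q)) := by
  rw [equivT', HalfH1.val_oneAddEquiv, val_equivT, inner_add_left, inner_add_right, inner_opK]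

/-- The correction is an integral over `(0,x)`, which vanishes at `x = 0`. Consequently the Neumann
datum passes through the transformation unchanged apart from the feedback term. -/
theorem trace_equivT' (q : HalfH1) : HalfH1.trace (S.equivT' q) = HalfH1.trace q := by
  have h : IsPrimitive (S.opK' (HalfH1.val q)) ((S.opd + S.opK₂') (HalfH1.val q)) 0 :=
    S.isPrimitive_opK' _
  rw [equivT', HalfH1.oneAddEquiv_apply, map_add, HalfH1.trace_lift _ h, add_zero]

/-- The derivative falling on `p` in `⟨p', (T'q - q)'⟩` is moved to the other side, where the second
derivative is available by `isPrimitive_opd_add_opK₂'`. The volume terms match `r T` and the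
derivative of `T` by adjointness. What remains is proportional to the trace of `q`: the boundary
value at `0` and the term with `∂₁K(0,·)` together are `S.feedback`. -/
theorem inner_der_equivT (p q : HalfH1) :
    inner ℝ (HalfH1.der (S.equivT p)) (HalfH1.der q) +
      inner ℝ (S.opr (HalfH1.val (S.equivT p))) (HalfH1.val q) + S.feedback p * HalfH1.trace q =
    inner ℝ (HalfH1.der p) (HalfH1.der (S.equivT' q)) := by
  have h := S.isPrimitive_opd_add_opK₂' q
  have h2 := HalfH1.inner_der_add_inner p (HalfH1.mk h)
  rw [HalfH1.trace_mk, HalfH1.val_mk, HalfH1.der_mk] at h2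
  have h5 : S.feedback p = inner ℝ S.κ (HalfH1.val p) - S.K 0 0 * HalfH1.trace p := rfl
  rw [h5, val_equivT, equivT, equivT', HalfH1.der_oneAddEquiv, HalfH1.der_oneAddEquiv]
  simp only [sub_apply, add_apply, map_add, inner_add_left, inner_sub_left,
    inner_add_right, inner_sub_right, inner_neg_right, inner_smul_right, inner_opK₁, inner_opK,
    inner_mul S.opr_coe, inner_mul S.opd_coe] at h2 ⊢
  rw [real_inner_comm (HalfH1.val p) S.κ]
  linear_combination (-1 : ℝ) * h2

end TransformData

/-! ### Distributional derivatives on the line -/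

theorem MeasureTheory.LocallyIntegrable.intervalIntegrable' {g : ℝ → ℝ} (hg : LocallyIntegrable g)
    (a b : ℝ) : IntervalIntegrable g volume a b :=
  (hg.integrableOn_isCompact isCompact_uIcc).intervalIntegrable

theorem exists_support_subset_Ioc {η : ℝ → ℝ} (h : HasCompactSupport η) :
    ∃ N, 0 < N ∧ ∀ M, N ≤ M → Function.support η ⊆ Ioo (-M) M := by
  obtain ⟨R, hR⟩ := h.isCompact.isBounded.subset_closedBall 0
  refine ⟨max R 0 + 1, by positivity, fun M hM x hx => ?_⟩
  have h1 := hR (subset_tsupport η hx)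
  rw [mem_closedBall_zero_iff, Real.norm_eq_abs] at h1
  have h2 : |x| < M := by linarith [le_max_left R 0]
  exact abs_lt.1 h2

theorem hasDistribDeriv_of_primitive {f g : ℝ → ℝ} (hg : LocallyIntegrable g) {c : ℝ}
    (h : f =ᵐ[volume] fun x => c + ∫ t in (0 : ℝ)..x, g t) : HasDistribDeriv f g := by
  have hi : ∀ a b, IntervalIntegrable g volume a b := hg.intervalIntegrable'
  refine HasDistribDeriv.congr (f := fun x => c + ∫ t in (0 : ℝ)..x, g t) ⟨?_, hg, ?_⟩ h.symm
    EventuallyEq.rfl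
  · exact (continuous_const.add (intervalIntegral.continuous_primitive hi 0)).locallyIntegrable
  intro η hη hc
  obtain ⟨N, hN, hs⟩ := exists_support_subset_Ioc hc
  obtain ⟨N', hN', hs'⟩ := exists_support_subset_Ioc hc.deriv
  set M := max N N'
  have hs1 := hs M (le_max_left _ _)
  have hs2 := hs' M (le_max_right _ _)
  have hM : 0 < M := lt_max_of_lt_left hN
  have hd : ∀ x, HasDerivAt η (deriv η x) x := fun x =>
    (hη.differentiable (by simp) x).hasDerivAt
  have hdc : Continuous (deriv η) := hη.continuous_deriv (by simp)
  have h0 : ∀ x, x ∉ Ioo (-M) M → η x = 0 := fun x hx => by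
    by_contra hne
    exact hx (hs1 hne)
  have hη' : ∀ x, (0 : ℝ) + ∫ t in (-M)..x, deriv η t = η x := fun x => by
    rw [intervalIntegral.integral_eq_sub_of_hasDerivAt (fun t _ => hd t)
      (hdc.intervalIntegrable _ _), h0 (-M) (by simp)]
    ring
  have key := integral_primitive_mul (hi (-M) M) (hdc.intervalIntegrable (-M) M)
    (c + ∫ t in (0 : ℝ)..(-M), g t) 0
  have hF : ∀ x, c + (∫ t in (0 : ℝ)..(-M), g t) + ∫ t in (-M)..x, g t =
      c + ∫ t in (0 : ℝ)..x, g t := fun x => by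
    rw [add_assoc, intervalIntegral.integral_add_adjacent_intervals (hi _ _) (hi _ _)]
  simp only [hη', hF] at key
  rw [h0 M (by simp), mul_zero, mul_zero, sub_zero, intervalIntegral.integral_add] at key
  · rw [← intervalIntegral.integral_eq_integral_of_support_subset (a := -M) (b := M),
      ← intervalIntegral.integral_eq_integral_of_support_subset (a := -M) (b := M)]
    · linarith
    · refine (Function.support_mul_subset_right _ _).trans (hs1.trans Ioo_subset_Ioc_self)
    · refine (Function.support_mul_subset_right _ _).trans (hs2.trans Ioo_subset_Ioc_self)
  · exact (hi _ _).mul_continuousOn hη.continuous.continuousOn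
  · exact (((continuous_const.add (intervalIntegral.continuous_primitive hi 0))).mul
      hdc).intervalIntegrable _ _

/-- Subtracting from a test function the multiple of a fixed normalized bump with the same integral
leaves mean zero, so the primitive has compact support and is itself a test function. -/
theorem ae_const_of_hasDistribDeriv_zero {f : ℝ → ℝ} (h : HasDistribDeriv f fun _ => 0) :
    ∃ c : ℝ, f =ᵐ[volume] fun _ => c := by
  obtain ⟨hf, -, h⟩ := h
  let b : ContDiffBump (0 : ℝ) := ⟨1, 2, one_pos, one_lt_two⟩
  set η₀ : ℝ → ℝ := b.normed volume with hη₀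
  have hc₀ : ContDiff ℝ ∞ η₀ := b.contDiff_normed
  have hs₀ : HasCompactSupport η₀ := b.hasCompactSupport_normed
  have hi₀ : ∫ x, η₀ x = 1 := b.integral_normed
  have hint : ∀ ψ : ℝ → ℝ, Continuous ψ → HasCompactSupport ψ →
      Integrable (fun x => f x * ψ x) := fun ψ h1 h2 => by
    simpa [smul_eq_mul] using hf.integrable_smul_right_of_hasCompactSupport h1 h2
  refine ⟨∫ x, f x * η₀ x, ?_⟩
  have hz : ∀ᵐ x, f x - (∫ x, f x * η₀ x) = 0 := by
    refine ae_eq_zero_of_integral_contDiff_smul_eq_zero (hf.sub (locallyIntegrable_const _))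
      fun ψ hψ hψs => ?_
    set I := ∫ x, ψ x with hI
    set φ : ℝ → ℝ := fun x => ψ x - I * η₀ x with hφ
    have hφc : ContDiff ℝ ∞ φ := hψ.sub (contDiff_const.mul hc₀)
    have hφi : ∫ x, φ x = 0 := by
      rw [hφ, integral_sub (hψ.continuous.integrable_of_hasCompactSupport hψs)
        ((hc₀.continuous.integrable_of_hasCompactSupport hs₀).const_mul I), integral_const_mul,
        hi₀]
      ring
    obtain ⟨N, hN, hs1⟩ := exists_support_subset_Ioc hψs
    obtain ⟨N', hN', hs2⟩ := exists_support_subset_Ioc hs₀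
    set M := max N N'
    have hz : ∀ x, x ∉ Ioo (-M) M → φ x = 0 := fun x hx => by
      have e1 : ψ x = 0 := by
        by_contra hne
        exact hx (hs1 M (le_max_left _ _) hne)
      have e2 : η₀ x = 0 := by
        by_contra hne
        exact hx (hs2 M (le_max_right _ _) hne)
      simp [hφ, e1, e2]
    have hM : 0 < M := lt_max_of_lt_left hN
    set η : ℝ → ℝ := fun x => ∫ t in (-M)..x, φ t with hη
    have hηd : ∀ x, HasDerivAt η (φ x) x := fun x =>
      intervalIntegral.integral_hasDerivAt_right (hφc.continuous.intervalIntegrable _ _)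
        (hφc.continuous.stronglyMeasurableAtFilter _ _) hφc.continuous.continuousAt
    have hηd' : deriv η = φ := funext fun x => (hηd x).deriv
    have hηc : ContDiff ℝ ∞ η := by
      rw [contDiff_infty_iff_deriv, hηd']
      exact ⟨fun x => (hηd x).differentiableAt, hφc⟩
    have hηs : HasCompactSupport η := by
      refine HasCompactSupport.intro (isCompact_Icc (a := -M) (b := M)) fun x hx => ?_
      rcases not_and_or.1 hx with h1 | h1
      · push Not at h1
        have : ∫ t in (-M)..x, φ t = ∫ t in (-M)..x, 0 := by
          refine intervalIntegral.integral_congr fun t ht => ?_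
          rw [uIcc_of_ge h1.le] at ht
          exact hz t fun h => by linarith [h.1, ht.2]
        simpa [hη] using this
      · push Not at h1
        have : ∫ t in (-M)..x, φ t = ∫ t, φ t := by
          refine intervalIntegral.integral_eq_integral_of_support_subset fun t ht => ?_
          by_contra hne
          exact ht (hz t fun h => hne ⟨h.1, by linarith [h.2]⟩)
        simp only [hη]
        rw [this, hφi]
    have h1 := h η hηc hηs
    rw [hηd'] at h1
    simp only [zero_mul, integral_zero, neg_zero, hφ, mul_sub] at h1
    have e : ∀ x, f x * (I * η₀ x) = I * (f x * η₀ x) := fun x => by ring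
    simp only [e] at h1
    rw [integral_sub (hint ψ hψ.continuous hψs)
      ((hint η₀ hc₀.continuous hs₀).const_mul I), integral_const_mul] at h1
    simp only [smul_eq_mul, mul_sub]
    rw [integral_sub, integral_mul_const, ← hI]
    · simp only [mul_comm (ψ _)]
      exact h1
    · simpa only [mul_comm (ψ _)] using hint ψ hψ.continuous hψs
    · exact (hψ.continuous.integrable_of_hasCompactSupport hψs).mul_const _
  filter_upwards [hz] with x hx
  exact sub_eq_zero.1 hx

/-- The du Bois-Reymond lemma. -/
theorem hasDistribDeriv_iff {f g : ℝ → ℝ} : HasDistribDeriv f g ↔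
    LocallyIntegrable g ∧ ∃ c : ℝ, f =ᵐ[volume] fun x => c + ∫ t in (0 : ℝ)..x, g t := by
  refine ⟨fun h => ⟨h.2.1, ?_⟩, fun ⟨hg, c, h⟩ => hasDistribDeriv_of_primitive hg h⟩
  have h1 := hasDistribDeriv_of_primitive h.2.1 (c := 0) (EventuallyEq.refl _ _)
  have h2 := h.add (h1.const_mul (-1))
  obtain ⟨c, hc⟩ := ae_const_of_hasDistribDeriv_zero (h2.congr EventuallyEq.rfl
    (Eventually.of_forall fun x => show g x + -1 * g x = 0 by ring))
  refine ⟨c, ?_⟩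
  filter_upwards [hc] with x hx
  linarith

theorem HasDistribDeriv.unique {f g g' : ℝ → ℝ} (h : HasDistribDeriv f g)
    (h' : HasDistribDeriv f g') : g =ᵐ[volume] g' := by
  refine ae_eq_of_integral_contDiff_smul_eq h.2.1 h'.2.1 fun η hη hs => ?_
  have := (h.2.2 η hη hs).symm.trans (h'.2.2 η hη hs)
  simp only [smul_eq_mul, mul_comm (η _)]
  linarith

/-- The product rule. -/
theorem primitive_mul {m m' f h : ℝ → ℝ} (hm : ∀ x, HasDerivAt m (m' x) x) (hm' : Continuous m')
    (hh : LocallyIntegrable h) {c : ℝ} (hf : f =ᵐ[volume] fun x => c + ∫ t in (0 : ℝ)..x, h t) :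
    (fun x => m x * f x) =ᵐ[volume]
      fun x => m 0 * c + ∫ t in (0 : ℝ)..x, (m' t * f t + m t * h t) := by
  filter_upwards [hf] with x hx
  have e : ∀ x, m 0 + ∫ t in (0 : ℝ)..x, m' t = m x := fun x => by
    rw [intervalIntegral.integral_eq_sub_of_hasDerivAt (fun t _ => hm t)
      (hm'.intervalIntegrable _ _)]
    ring
  have key := integral_primitive_mul (hm'.intervalIntegrable 0 x)
    (hh.intervalIntegrable' 0 x) (m 0) c
  simp only [e] at key
  have e2 : ∫ t in (0 : ℝ)..x, (m' t * f t + m t * h t) =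
      ∫ t in (0 : ℝ)..x, (m' t * (c + ∫ t in (0 : ℝ)..t, h t) + m t * h t) :=
    intervalIntegral.integral_congr_ae (by filter_upwards [hf] with t ht _; rw [ht])
  rw [e2, key, hx]
  ring

/-- An even function that is of class `C¹` on `[0,∞)` with vanishing derivative at `0` is of class
`C¹` on the line. -/
theorem Function.Even.contDiff_one {f : ℝ → ℝ} (he : Function.Even f)
    (hf : ContDiffOn ℝ 1 f (Ici 0)) (h0 : derivWithin f (Ici 0) 0 = 0) : ContDiff ℝ 1 f := by
  set g := derivWithin f (Ici 0) with hg
  have hgc : ContinuousOn g (Ici 0) :=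
    hf.continuousOn_derivWithin (uniqueDiffOn_Ici 0) le_rfl
  have hw : ∀ x, 0 ≤ x → HasDerivWithinAt f (g x) (Ici 0) x := fun x hx =>
    ((hf.differentiableOn one_ne_zero) x hx).hasDerivWithinAt
  have hpos : ∀ x, 0 < x → HasDerivAt f (g x) x := fun x hx =>
    (hw x hx.le).hasDerivAt (Ici_mem_nhds hx)
  have hfe : (fun x => f (-x)) = f := funext he
  set G : ℝ → ℝ := fun x => if 0 ≤ x then g x else -g (-x) with hG
  have hd : ∀ x, HasDerivAt f (G x) x := by
    intro x
    rcases lt_trichotomy x 0 with h | h | h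
    · have h1 : HasDerivAt (fun x => f (-x)) (g (-x) * -1) x :=
        (hpos (-x) (by linarith)).comp x (hasDerivAt_neg x)
      rw [hfe] at h1
      refine h1.congr_deriv ?_
      simp [hG, not_le.2 h]
    · subst h
      have e : G 0 = 0 := by simp [hG, h0]
      rw [e]
      have h1 : HasDerivWithinAt f 0 (Ici 0) 0 := by simpa only [h0] using hw 0 le_rfl
      have h2 : HasDerivWithinAt (fun x => f (-x)) (0 * -1) (Iic 0) 0 := by
        have h3 : HasDerivWithinAt f 0 (Ici 0) (-0) := by rwa [neg_zero]
        exact h3.comp (0 : ℝ) (hasDerivAt_neg (0 : ℝ)).hasDerivWithinAt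
          (fun y hy => by simpa using hy)
      rw [hfe, zero_mul] at h2
      have := h1.union h2
      rwa [Ici_union_Iic, hasDerivWithinAt_univ] at this
    · simpa [hG, h.le] using hpos x h
  have hGc : Continuous G := by
    refine continuous_if_le continuous_const continuous_id hgc ?_ ?_
    · exact (hgc.comp continuous_neg.continuousOn fun x hx => by simpa using hx).neg
    · rintro x rfl
      simp [h0]
  rw [contDiff_one_iff_deriv]
  exact ⟨fun x => (hd x).differentiableAt, (funext fun x => (hd x).deriv : deriv f = G) ▸ hGc⟩

namespace HeatData

variable (D : HeatData)

/-! ### The Liouville coordinate -/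

theorem k_pos (x : ℝ) : 0 < D.k x := by
  rcases le_total 0 x with h | h
  · exact D.pos_k x h
  · rw [← D.even_k x]; exact D.pos_k (-x) (by linarith)

theorem continuous_k : Continuous D.k := by
  have h : D.k = fun x => D.k |x| := by
    funext x
    rcases le_total 0 x with hx | hx
    · rw [abs_of_nonneg hx]
    · rw [abs_of_nonpos hx, D.even_k]
  rw [h]
  exact D.contDiff_k.continuousOn.comp_continuous continuous_abs (fun x => abs_nonneg x)

/-- The derivative `√(ρ/k)` of `σ`. -/
def dσ (x : ℝ) : ℝ := √(D.ρ x / D.k x)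

/-- The amplitude `⁴√(ρk)`. -/
def amp (x : ℝ) : ℝ := (D.ρ x * D.k x) ^ (1 / 4 : ℝ)

/-- The inverse of `σ`. -/
def τ : ℝ → ℝ := Function.invFun D.σ

theorem dσ_pos (x : ℝ) : 0 < D.dσ x := Real.sqrt_pos.2 (div_pos (D.ρ_pos x) (D.k_pos x))

theorem continuous_dσ : Continuous D.dσ :=
  (D.continuous_ρ.div D.continuous_k fun x => (D.k_pos x).ne').sqrt

theorem dσ_neg (x : ℝ) : D.dσ (-x) = D.dσ x := by rw [dσ, dσ, D.even_ρ, D.even_k]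

theorem amp_pos (x : ℝ) : 0 < D.amp x := Real.rpow_pos_of_pos (mul_pos (D.ρ_pos x) (D.k_pos x)) _

theorem amp_neg (x : ℝ) : D.amp (-x) = D.amp x := by rw [amp, amp, D.even_ρ, D.even_k]

theorem amp_sq (x : ℝ) : D.amp x ^ 2 = √(D.ρ x * D.k x) := by
  rw [amp, ← Real.rpow_natCast, ← Real.rpow_mul (mul_pos (D.ρ_pos x) (D.k_pos x)).le,
    Real.sqrt_eq_rpow]
  norm_num

/-- The pointwise identity that makes `f ↦ ⁴√(ρk) f` in the coordinate `σ` an isometry from `L²_ρ`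
to `L²`. -/
theorem amp_sq_mul_dσ (x : ℝ) : D.amp x ^ 2 * D.dσ x = D.ρ x := by
  have h1 := D.ρ_pos x
  have h2 := D.k_pos x
  rw [amp_sq, dσ, ← Real.sqrt_mul (mul_pos h1 h2).le]
  have : D.ρ x * D.k x * (D.ρ x / D.k x) = D.ρ x ^ 2 := by field_simp
  rw [this, Real.sqrt_sq h1.le]

/-- The condition `(ρk)'(0) = 0` enters here: without it the even extension has a corner at `0`, and
`Q₁` would jump there. -/
theorem contDiff_ρk' : ContDiff ℝ 1 fun x => D.ρ x * D.k x :=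
  Function.Even.contDiff_one (fun x => by rw [D.even_ρ, D.even_k])
    (D.contDiff_ρk.of_le (by norm_num)) D.deriv_ρk

theorem continuous_amp : Continuous D.amp :=
  D.contDiff_ρk'.continuous.rpow_const fun x => Or.inl (mul_pos (D.ρ_pos x) (D.k_pos x)).ne'

theorem continuous_Q₁ : Continuous D.Q₁ := by
  have h1 : Continuous (deriv fun y => D.k y * D.ρ y) := by
    simp only [mul_comm (D.k _)]
    exact D.contDiff_ρk'.continuous_deriv le_rfl
  have h2 := D.continuous_k
  have h3 := D.continuous_ρ
  have h4 : Continuous fun x => √(D.k x / D.ρ x) :=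
    (h2.div h3 fun x => (D.ρ_pos x).ne').sqrt
  exact (h4.mul h1).div (by fun_prop) fun x =>
    (mul_pos four_pos (mul_pos (D.k_pos x) (D.ρ_pos x))).ne'

/-- `Q₁` is the logarithmic derivative of the amplitude with respect to `σ`. Thus the amplitude is
an integrating factor and absorbs the zeroth order term of `𝔻`. -/
theorem hasDerivAt_amp (x : ℝ) : HasDerivAt D.amp (D.amp x * D.dσ x * D.Q₁ x) x := by
  have h1 := D.ρ_pos x
  have h2 := D.k_pos x
  have hP : 0 < D.ρ x * D.k x := mul_pos h1 h2
  have h3 := (D.contDiff_ρk'.differentiable one_ne_zero x).hasDerivAt.rpow_const (p := 1 / 4)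
    (Or.inl hP.ne')
  refine h3.congr_deriv ?_
  have e1 : D.dσ x * √(D.k x / D.ρ x) = 1 := by
    rw [dσ, ← Real.sqrt_mul (div_pos h1 h2).le]
    have : D.ρ x / D.k x * (D.k x / D.ρ x) = 1 := by field_simp
    rw [this, Real.sqrt_one]
  have e2 : D.Q₁ x = √(D.k x / D.ρ x) * deriv (fun y => D.ρ y * D.k y) x /
      (4 * (D.ρ x * D.k x)) := by
    rw [Q₁, heatQ₁]
    simp only [mul_comm (D.k _)]
  have e3 : (D.ρ x * D.k x) ^ ((1 / 4 : ℝ) - 1) = D.amp x / (D.ρ x * D.k x) := by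
    rw [Real.rpow_sub_one hP.ne', amp]
  rw [e2, e3]
  linear_combination (-D.amp x * deriv (fun y => D.ρ y * D.k y) x / (4 * (D.ρ x * D.k x))) * e1

theorem hasDerivAt_σ (x : ℝ) : HasDerivAt D.σ (D.dσ x) x :=
  intervalIntegral.integral_hasDerivAt_right (D.continuous_dσ.intervalIntegrable _ _)
    (D.continuous_dσ.stronglyMeasurableAtFilter _ _) D.continuous_dσ.continuousAt

theorem continuous_σ : Continuous D.σ :=
  continuous_iff_continuousAt.2 fun x => (D.hasDerivAt_σ x).continuousAt

theorem σ_zero : D.σ 0 = 0 := intervalIntegral.integral_same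

theorem σ_neg (x : ℝ) : D.σ (-x) = -D.σ x := by
  have h := intervalIntegral.integral_comp_neg (a := 0) (b := x) D.dσ
  simp only [dσ_neg, neg_zero] at h
  show ∫ ξ in (0 : ℝ)..(-x), D.dσ ξ = -∫ ξ in (0 : ℝ)..x, D.dσ ξ
  rw [h, intervalIntegral.integral_symm]

theorem strictMono_σ : StrictMono D.σ :=
  strictMono_of_deriv_pos fun x => (D.hasDerivAt_σ x).deriv ▸ D.dσ_pos x

theorem surjective_σ : Function.Surjective D.σ := by
  refine D.continuous_σ.surjective D.sigma_atTop ?_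
  have h := tendsto_neg_atTop_atBot.comp (D.sigma_atTop.comp tendsto_neg_atBot_atTop)
  refine h.congr fun x => ?_
  show -D.σ (-x) = D.σ x
  rw [σ_neg, neg_neg]

/-- `σ` as an order isomorphism. -/
def σIso : ℝ ≃o ℝ := D.strictMono_σ.orderIsoOfSurjective D.σ D.surjective_σ

theorem σIso_coe : ⇑D.σIso = D.σ := rfl

theorem σ_τ (l : ℝ) : D.σ (D.τ l) = l := Function.rightInverse_invFun D.surjective_σ l

theorem τ_σ (x : ℝ) : D.τ (D.σ x) = x := Function.leftInverse_invFun D.strictMono_σ.injective x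

theorem τ_eq : D.τ = D.σIso.symm :=
  funext fun l => D.strictMono_σ.injective ((D.σ_τ l).trans (D.σIso.apply_symm_apply l).symm)

theorem continuous_τ : Continuous D.τ := D.τ_eq ▸ D.σIso.symm.continuous

theorem strictMono_τ : StrictMono D.τ := D.τ_eq ▸ D.σIso.symm.strictMono

theorem hasDerivAt_τ (l : ℝ) : HasDerivAt D.τ (D.dσ (D.τ l))⁻¹ l :=
  (D.hasDerivAt_σ (D.τ l)).of_local_left_inverse D.continuous_τ.continuousAt (D.dσ_pos _).ne'
    (Eventually.of_forall D.σ_τ)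

theorem τ_zero : D.τ 0 = 0 := by
  rw [← D.σ_zero, τ_σ, σ_zero]

theorem τ_neg (l : ℝ) : D.τ (-l) = -D.τ l :=
  D.strictMono_σ.injective (by rw [σ_τ, σ_neg, σ_τ])

theorem σ_nonneg_iff {x : ℝ} : 0 ≤ D.σ x ↔ 0 ≤ x := by
  rw [← D.strictMono_σ.le_iff_le (a := 0) (b := x), σ_zero]

theorem σ_abs (x : ℝ) : D.σ |x| = |D.σ x| := by
  rcases le_total 0 x with h | h
  · rw [abs_of_nonneg h, abs_of_nonneg (D.σ_nonneg_iff.2 h)]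
  · rw [abs_of_nonpos h, σ_neg, abs_of_nonpos]
    exact D.σ_zero ▸ D.strictMono_σ.monotone h

theorem τ_abs (x : ℝ) : D.τ |D.σ x| = |x| := by rw [← σ_abs, τ_σ]

theorem lintegral_eq_σ (g : ℝ → ℝ≥0∞) :
    ∫⁻ l, g l = ∫⁻ x, ENNReal.ofReal (D.dσ x) * g (D.σ x) := by
  have h := lintegral_image_eq_lintegral_abs_deriv_mul MeasurableSet.univ
    (fun x _ => (D.hasDerivAt_σ x).hasDerivWithinAt) D.strictMono_σ.injective.injOn g
  rw [image_univ, D.surjective_σ.range_eq, Measure.restrict_univ] at h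
  simpa only [abs_of_pos (D.dσ_pos _)] using h

theorem integral_eq_σ (g : ℝ → ℝ) : ∫ l, g l = ∫ x, D.dσ x * g (D.σ x) := by
  have h := integral_image_eq_integral_abs_deriv_smul MeasurableSet.univ
    (fun x _ => (D.hasDerivAt_σ x).hasDerivWithinAt) D.strictMono_σ.injective.injOn g
  rw [image_univ, D.surjective_σ.range_eq, Measure.restrict_univ] at h
  simpa only [abs_of_pos (D.dσ_pos _), smul_eq_mul] using h

theorem intervalIntegral_eq_σ (g : ℝ → ℝ) (x : ℝ) :
    ∫ l in (0 : ℝ)..D.σ x, g l = ∫ y in (0 : ℝ)..x, D.dσ y * g (D.σ y) := by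
  have h : ∀ a b, ∫ l in Ioc (D.σ a) (D.σ b), g l = ∫ y in Ioc a b, D.dσ y * g (D.σ y) := by
    intro a b
    have h := integral_image_eq_integral_abs_deriv_smul (measurableSet_Ioc (a := a) (b := b))
      (fun x _ => (D.hasDerivAt_σ x).hasDerivWithinAt) D.strictMono_σ.injective.injOn g
    rw [← D.σIso_coe, D.σIso.image_Ioc] at h
    simpa only [σIso_coe, abs_of_pos (D.dσ_pos _), smul_eq_mul] using h
  rw [intervalIntegral, intervalIntegral]
  nth_rewrite 1 [← D.σ_zero]
  nth_rewrite 2 [← D.σ_zero]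
  rw [h, h]

theorem quasiMeasurePreserving_τ : Measure.QuasiMeasurePreserving D.τ volume volume := by
  refine ⟨D.continuous_τ.measurable, Measure.AbsolutelyContinuous.mk fun A hA h => ?_⟩
  rw [Measure.map_apply D.continuous_τ.measurable hA,
    ← lintegral_indicator_one (D.continuous_τ.measurable hA), D.lintegral_eq_σ]
  have : ∀ x, ENNReal.ofReal (D.dσ x) * (D.τ ⁻¹' A).indicator 1 (D.σ x) =
      A.indicator (fun x => ENNReal.ofReal (D.dσ x)) x := fun x => by
    by_cases hx : x ∈ A <;> simp [hx, τ_σ]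
  simp only [this]
  rw [lintegral_indicator hA, setLIntegral_measure_zero _ _ h]

theorem quasiMeasurePreserving_σ : Measure.QuasiMeasurePreserving D.σ volume volume := by
  refine ⟨D.continuous_σ.measurable, Measure.AbsolutelyContinuous.mk fun A hA h => ?_⟩
  rw [Measure.map_apply D.continuous_σ.measurable hA]
  have h1 := D.lintegral_eq_σ (A.indicator 1)
  rw [lintegral_indicator_one hA, h, eq_comm, lintegral_eq_zero_iff] at h1
  · refine measure_eq_zero_iff_ae_notMem.2 ?_
    filter_upwards [h1] with x hx hxA
    have hxA' : D.σ x ∈ A := hxA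
    have := D.dσ_pos x
    simp [hxA', this.not_ge] at hx
  · exact (D.continuous_dσ.measurable.ennreal_ofReal).mul
      ((measurable_const.indicator hA).comp D.continuous_σ.measurable)

/-! ### The operator `𝔻` in the Liouville coordinate -/

theorem ae_μ {p : ℝ → Prop} (h : ∀ᵐ x, p x) : ∀ᵐ x ∂D.μ, p x :=
  (withDensity_absolutelyContinuous volume _).ae_le h

theorem integral_μ (g : ℝ → ℝ) : ∫ x, g x ∂D.μ = ∫ x, D.ρ x * g x := by
  unfold HeatData.μ
  rw [integral_withDensity_eq_integral_toReal_smul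
    D.continuous_ρ.measurable.ennreal_ofReal (Eventually.of_forall fun x => ENNReal.ofReal_lt_top)]
  simp only [ENNReal.toReal_ofReal (D.ρ_pos _).le, smul_eq_mul]

theorem lintegral_μ {g : ℝ → ℝ≥0∞} (hg : Measurable g) :
    ∫⁻ x, g x ∂D.μ = ∫⁻ x, ENNReal.ofReal (D.ρ x) * g x :=
  lintegral_withDensity_eq_lintegral_mul _ D.continuous_ρ.measurable.ennreal_ofReal hg

theorem locallyIntegrable (f : D.L2ρ) : LocallyIntegrable f := by
  have h1 : Integrable (fun x => D.ρ x * f x ^ 2) := by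
    have h : Integrable (fun x => f x ^ 2) (volume.withDensity fun x => ENNReal.ofReal (D.ρ x)) :=
      (Lp.memLp f).integrable_sq
    rw [integrable_withDensity_iff_integrable_smul' D.continuous_ρ.measurable.ennreal_ofReal
      (Eventually.of_forall fun x => ENNReal.ofReal_lt_top)] at h
    simpa only [ENNReal.toReal_ofReal (D.ρ_pos _).le, smul_eq_mul] using h
  have h2 : LocallyIntegrable fun x => (D.ρ x)⁻¹ :=
    (D.continuous_ρ.inv₀ fun x => (D.ρ_pos x).ne').locallyIntegrable
  refine (h1.locallyIntegrable.add h2).mono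
    (Lp.stronglyMeasurable f).aestronglyMeasurable (Eventually.of_forall fun x => ?_)
  have hρ := D.ρ_pos x
  -- Completing the square compares `|f|` with the integrable `ρ f²` and the continuous `1/ρ`.
  have h3 : |f x| ≤ D.ρ x * f x ^ 2 + (D.ρ x)⁻¹ := by
    rw [← sq_abs (f x)]
    have h4 : 0 ≤ (D.ρ x)⁻¹ * ((D.ρ x * |f x| - 1) ^ 2 + D.ρ x * |f x|) := by positivity
    have h5 : (D.ρ x)⁻¹ * ((D.ρ x * |f x| - 1) ^ 2 + D.ρ x * |f x|) =
        D.ρ x * |f x| ^ 2 + (D.ρ x)⁻¹ - |f x| := by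
      field_simp
      ring
    linarith
  simp only [Pi.add_apply]
  rw [Real.norm_eq_abs, Real.norm_eq_abs]
  exact h3.trans (le_abs_self _)

theorem locallyIntegrable_flux (f g : D.L2ρ) :
    LocallyIntegrable fun x => √(D.ρ x / D.k x) * (g x - D.Q₁ x * f x) :=
  ((D.locallyIntegrable g).sub
    ((D.locallyIntegrable f).continuous_mul D.continuous_Q₁)).continuous_mul D.continuous_dσ

/-- Multiplication by the amplitude, or by its reciprocal for the converse, turns the first order
relation into a pure primitive by the product rule. -/
theorem hasD_iff {f g : D.L2ρ} : D.HasD f g ↔ ∃ c : ℝ,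
    (fun x => D.amp x * f x) =ᵐ[volume]
      fun x => c + ∫ t in (0 : ℝ)..x, D.amp t * D.dσ t * g t := by
  rw [HasD, hasDistribDeriv_iff, and_iff_right (D.locallyIntegrable_flux f g)]
  constructor
  · rintro ⟨c, h⟩
    have h1 := primitive_mul D.hasDerivAt_amp
      ((D.continuous_amp.mul D.continuous_dσ).mul D.continuous_Q₁)
      (D.locallyIntegrable_flux f g) h
    refine ⟨D.amp 0 * c, h1.trans (Eventually.of_forall fun x => ?_)⟩
    refine congrArg (D.amp 0 * c + ·) (intervalIntegral.integral_congr fun t _ => ?_)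
    show D.amp t * D.dσ t * D.Q₁ t * f t + D.amp t * (D.dσ t * (g t - D.Q₁ t * f t)) = _
    ring
  · rintro ⟨c, h⟩
    have hi : LocallyIntegrable fun x => D.amp x * D.dσ x * g x :=
      (D.locallyIntegrable g).continuous_mul (D.continuous_amp.mul D.continuous_dσ)
    have h1 := primitive_mul (m := fun x => (D.amp x)⁻¹)
      (m' := fun x => -(D.amp x * D.dσ x * D.Q₁ x) / D.amp x ^ 2)
      (fun x => (D.hasDerivAt_amp x).inv (D.amp_pos x).ne')
      ((((D.continuous_amp.mul D.continuous_dσ).mul D.continuous_Q₁).neg).div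
        (D.continuous_amp.pow 2) fun x => (pow_pos (D.amp_pos x) 2).ne') hi h
    refine ⟨(D.amp 0)⁻¹ * c, ?_⟩
    filter_upwards [h1] with x hx
    rw [inv_mul_cancel_left₀ (D.amp_pos x).ne'] at hx
    rw [hx]
    congr 1
    refine intervalIntegral.integral_congr fun t _ => ?_
    have := (D.amp_pos t).ne'
    show _ = D.dσ t * (g t - D.Q₁ t * f t)
    field_simp
    ring

theorem primitive_iff_τ {f g : ℝ → ℝ} (c : ℝ) :
    ((fun x => D.amp x * f x) =ᵐ[volume]
      fun x => c + ∫ t in (0 : ℝ)..x, D.amp t * D.dσ t * g t) ↔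
    ((fun l => D.amp (D.τ l) * f (D.τ l)) =ᵐ[volume]
      fun l => c + ∫ t in (0 : ℝ)..l, D.amp (D.τ t) * g (D.τ t)) := by
  have e : ∀ x, ∫ t in (0 : ℝ)..D.σ x, D.amp (D.τ t) * g (D.τ t) =
      ∫ t in (0 : ℝ)..x, D.amp t * D.dσ t * g t := fun x => by
    rw [intervalIntegral_eq_σ]
    refine intervalIntegral.integral_congr fun t _ => ?_
    simp only [τ_σ]
    ring
  refine ⟨fun h => ?_, fun h => ?_⟩
  · filter_upwards [D.quasiMeasurePreserving_τ.ae h] with l hl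
    rw [hl, ← e, σ_τ]
  · filter_upwards [D.quasiMeasurePreserving_σ.ae h] with x hx
    rw [τ_σ] at hx
    rw [hx, e]

theorem ext_val {w w' : D.H1} (h : D.val w = D.val w') : w = w' := by
  have h1 : D.HasD (D.val w) (D.der w) := w.2
  have h2 : D.HasD (D.val w) (D.der w') := h ▸ w'.2
  have h3 : D.der w = D.der w' := by
    refine Lp.ext (D.ae_μ ?_)
    filter_upwards [HasDistribDeriv.unique h1 h2] with x hx
    have := mul_left_cancel₀ (D.dσ_pos x).ne' hx
    linarith
  refine Subtype.ext ?_
  have h4 : (w : WithLp 2 (D.L2ρ × D.L2ρ)).fst = (w' : WithLp 2 (D.L2ρ × D.L2ρ)).fst := h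
  have h5 : (w : WithLp 2 (D.L2ρ × D.L2ρ)).snd = (w' : WithLp 2 (D.L2ρ × D.L2ρ)).snd := h3
  exact (WithLp.ofLp_injective 2) (Prod.ext h4 h5)

end HeatData

/-! ### Integrals of even functions -/

theorem lintegral_eq_halfLine {h : ℝ → ℝ≥0∞} (hh : Measurable h) :
    ∫⁻ l, h l = ∫⁻ l, (h l + h (-l)) ∂halfLine := by
  rw [← lintegral_add_compl h (measurableSet_Ioi (a := (0 : ℝ))), compl_Ioi,
    lintegral_add_left hh]
  congr 1
  rw [← restrict_Iio_eq_restrict_Iic, ← lintegral_indicator measurableSet_Iio,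
    ← lintegral_indicator measurableSet_Ioi,
    ← (Measure.measurePreserving_neg (volume : Measure ℝ)).lintegral_comp
      (hh.indicator measurableSet_Iio)]
  refine lintegral_congr fun l => ?_
  by_cases hl : 0 < l <;> simp [hl]

theorem integral_eq_halfLine {h : ℝ → ℝ} (hh : Integrable h) :
    ∫ l, h l = ∫ l, (h l + h (-l)) ∂halfLine := by
  rw [integral_add hh.restrict hh.comp_neg.restrict, integral_comp_neg_Ioi, neg_zero,
    ← integral_add_compl (measurableSet_Ioi (a := (0 : ℝ))) hh, compl_Ioi]

theorem quasiMeasurePreserving_abs :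
    Measure.QuasiMeasurePreserving (fun l : ℝ => |l|) volume halfLine := by
  refine ⟨continuous_abs.measurable, Measure.AbsolutelyContinuous.mk fun A hA h => ?_⟩
  have hm : Measurable (((fun l : ℝ => |l|) ⁻¹' A).indicator (1 : ℝ → ℝ≥0∞)) :=
    measurable_one.indicator (continuous_abs.measurable hA)
  rw [Measure.map_apply continuous_abs.measurable hA,
    ← lintegral_indicator_one (continuous_abs.measurable hA), lintegral_eq_halfLine hm]
  refine (lintegral_eq_zero_iff' (hm.add (hm.comp measurable_neg)).aemeasurable).2 ?_
  filter_upwards [measure_eq_zero_iff_ae_notMem.1 h, ae_restrict_mem measurableSet_Ioi]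
    with l h1 h2
  simp [abs_of_pos (mem_Ioi.1 h2), h1]

/-- The function equal to `1` on `[0,∞)` and to `ε` on `(-∞,0)`. -/
def parity (ε x : ℝ) : ℝ := if 0 ≤ x then 1 else ε

theorem measurable_parity (ε : ℝ) : Measurable (parity ε) :=
  Measurable.ite measurableSet_Ici measurable_const measurable_const

theorem abs_parity_le (ε x : ℝ) : |parity ε x| ≤ 1 + |ε| := by
  unfold parity
  split_ifs
  · rw [abs_one]; linarith [abs_nonneg ε]
  · linarith

theorem parity_of_pos (ε : ℝ) {x : ℝ} (hx : 0 < x) : parity ε x = 1 := if_pos hx.le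

theorem parity_of_neg (ε : ℝ) {x : ℝ} (hx : x < 0) : parity ε x = ε := if_neg hx.not_ge

theorem parity_one (x : ℝ) : parity 1 x = 1 := by simp [parity]

namespace HeatData

variable (D : HeatData)

theorem parity_τ (ε l : ℝ) : parity ε (D.τ l) = parity ε l := by
  have h : 0 ≤ D.τ l ↔ 0 ≤ l := by rw [← D.σ_nonneg_iff, σ_τ]
  simp only [parity, h]

/-! ### Functions in the Liouville coordinate -/

/-- The function `⁴√(ρk) f` in the Liouville coordinate. -/
def pull (f : ℝ → ℝ) (l : ℝ) : ℝ := D.amp (D.τ l) * f (D.τ l)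

theorem volume_absolutelyContinuous_μ : volume ≪ D.μ := fun _ h => by
  rw [measure_eq_zero_iff_ae_notMem] at h ⊢
  exact D.ae_volume h

theorem quasiMeasurePreserving_τ_halfLine : Measure.QuasiMeasurePreserving D.τ halfLine D.μ :=
  (D.quasiMeasurePreserving_τ.mono_left Measure.restrict_le_self.absolutelyContinuous).mono_right
    D.volume_absolutelyContinuous_μ

theorem quasiMeasurePreserving_τ_neg :
    Measure.QuasiMeasurePreserving (fun l => D.τ (-l)) halfLine D.μ :=
  ((D.quasiMeasurePreserving_τ.comp
    (Measure.measurePreserving_neg (volume : Measure ℝ)).quasiMeasurePreserving).mono_left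
      Measure.restrict_le_self.absolutelyContinuous).mono_right D.volume_absolutelyContinuous_μ

/-- The isometry property in folded form: both halves of the line are recorded on `(0,∞)`, so each
half alone is a contraction. -/
theorem lintegral_pull {g : ℝ → ℝ≥0∞} (hg : Measurable g) :
    ∫⁻ l, (‖D.amp (D.τ l)‖ₑ ^ 2 * g (D.τ l) + ‖D.amp (D.τ (-l))‖ₑ ^ 2 * g (D.τ (-l))) ∂halfLine =
      ∫⁻ x, g x ∂D.μ := by
  have hm : Measurable fun l => ‖D.amp (D.τ l)‖ₑ ^ 2 * g (D.τ l) :=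
    (((D.continuous_amp.comp D.continuous_τ).measurable.enorm).pow_const 2).mul
      (hg.comp D.continuous_τ.measurable)
  rw [← lintegral_eq_halfLine hm, D.lintegral_eq_σ, D.lintegral_μ hg]
  refine lintegral_congr fun x => ?_
  rw [τ_σ, ← mul_assoc, ← amp_sq_mul_dσ, Real.enorm_eq_ofReal (D.amp_pos x).le,
    ← ENNReal.ofReal_pow (D.amp_pos x).le, ← ENNReal.ofReal_mul (D.dσ_pos x).le, mul_comm]
  ring_nf

theorem exists_opRight : ∃ A : D.L2ρ →L[ℝ] HalfL2, ∀ f, A f =ᵐ[halfLine] D.pull f := by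
  refine exists_weightedComp (C := 1) (D.continuous_amp.comp D.continuous_τ).measurable
    D.quasiMeasurePreserving_τ_halfLine zero_le_one fun g hg => ?_
  rw [← D.lintegral_pull hg, ENNReal.ofReal_one, one_pow, one_mul]
  exact lintegral_mono fun l => le_self_add

theorem exists_opLeft : ∃ A : D.L2ρ →L[ℝ] HalfL2, ∀ f,
    A f =ᵐ[halfLine] fun l => D.pull f (-l) := by
  refine exists_weightedComp (C := 1) (m := fun l => D.amp (D.τ (-l)))
    ((D.continuous_amp.comp D.continuous_τ).comp continuous_neg).measurable
    D.quasiMeasurePreserving_τ_neg zero_le_one fun g hg => ?_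
  rw [← D.lintegral_pull hg, ENNReal.ofReal_one, one_pow, one_mul]
  exact lintegral_mono fun l => le_add_self

/-- The restriction of a function in the Liouville coordinate to `(0,∞)`. -/
def opRight : D.L2ρ →L[ℝ] HalfL2 := D.exists_opRight.choose

theorem opRight_coe (f : D.L2ρ) : D.opRight f =ᵐ[halfLine] D.pull f :=
  D.exists_opRight.choose_spec f

/-- The restriction of a reflected function in the Liouville coordinate to `(0,∞)`. -/
def opLeft : D.L2ρ →L[ℝ] HalfL2 := D.exists_opLeft.choose

theorem opLeft_coe (f : D.L2ρ) : D.opLeft f =ᵐ[halfLine] fun l => D.pull f (-l) :=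
  D.exists_opLeft.choose_spec f

/-- The even part (`ε = 1`) and the odd part (`ε = -1`) in the Liouville coordinate. -/
def opE (ε : ℝ) : D.L2ρ →L[ℝ] HalfL2 := (1 / 2 : ℝ) • (D.opRight + ε • D.opLeft)

theorem opE_apply (ε : ℝ) (f : D.L2ρ) :
    D.opE ε f = (1 / 2 : ℝ) • (D.opRight f + ε • D.opLeft f) := rfl

theorem opE_coe (ε : ℝ) (f : D.L2ρ) :
    D.opE ε f =ᵐ[halfLine] fun l => (D.pull f l + ε * D.pull f (-l)) / 2 := by
  filter_upwards [Lp.coeFn_smul (1 / 2 : ℝ) (D.opRight f + ε • D.opLeft f),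
    Lp.coeFn_add (D.opRight f) (ε • D.opLeft f), Lp.coeFn_smul ε (D.opLeft f),
    D.opRight_coe f, D.opLeft_coe f] with l h1 h2 h3 h4 h5
  rw [opE_apply, h1, Pi.smul_apply, h2, Pi.add_apply, h3, Pi.smul_apply, h4, h5, smul_eq_mul,
    smul_eq_mul]
  ring

theorem quasiMeasurePreserving_abs_σ :
    Measure.QuasiMeasurePreserving (fun x => |D.σ x|) D.μ halfLine :=
  (quasiMeasurePreserving_abs.comp D.quasiMeasurePreserving_σ).mono_left
    (withDensity_absolutelyContinuous volume _)

theorem exists_opX₀ : ∃ A : HalfL2 →L[ℝ] D.L2ρ, ∀ f,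
    A f =ᵐ[D.μ] fun x => (D.amp x)⁻¹ * f |D.σ x| := by
  refine exists_weightedComp (C := √2) (m := fun x => (D.amp x)⁻¹)
    (D.continuous_amp.inv₀ fun x => (D.amp_pos x).ne').measurable
    D.quasiMeasurePreserving_abs_σ (Real.sqrt_nonneg 2) fun g hg => le_of_eq ?_
  have hm : Measurable fun x => ‖(D.amp x)⁻¹‖ₑ ^ 2 * g |D.σ x| :=
    (((D.continuous_amp.inv₀ fun x => (D.amp_pos x).ne').measurable.enorm).pow_const 2).mul
      (hg.comp D.continuous_σ.abs.measurable)
  have h2 : ENNReal.ofReal √2 ^ 2 = 2 := by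
    rw [← ENNReal.ofReal_pow (Real.sqrt_nonneg 2), Real.sq_sqrt two_pos.le]
    simp
  have h3 : ∫⁻ l, g |l| = 2 * ∫⁻ l, g l ∂halfLine := by
    rw [lintegral_eq_halfLine (h := fun l => g |l|) (hg.comp continuous_abs.measurable), ← lintegral_const_mul _ hg]
    refine lintegral_congr_ae ?_
    filter_upwards [ae_restrict_mem measurableSet_Ioi] with l hl
    rw [abs_neg, abs_of_pos hl, two_mul]
  rw [D.lintegral_μ hm, h2, ← h3, D.lintegral_eq_σ fun l => g |l|]
  refine lintegral_congr fun x => ?_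
  have ha := D.amp_pos x
  rw [← mul_assoc, ← amp_sq_mul_dσ, Real.enorm_eq_ofReal (inv_pos.2 ha).le,
    ← ENNReal.ofReal_pow (inv_pos.2 ha).le, ← ENNReal.ofReal_mul
      (mul_pos (pow_pos ha 2) (D.dσ_pos x)).le]
  congr 2
  field_simp

theorem exists_opX (ε : ℝ) : ∃ A : HalfL2 →L[ℝ] D.L2ρ, ∀ f,
    A f =ᵐ[D.μ] fun x => parity ε x * (D.amp x)⁻¹ * f |D.σ x| := by
  obtain ⟨A, hA⟩ := D.exists_opX₀
  obtain ⟨B, hB⟩ := exists_mulOp (μ := D.μ) (measurable_parity ε)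
    (Eventually.of_forall (abs_parity_le ε))
  refine ⟨B.comp A, fun f => ?_⟩
  filter_upwards [hB (A f), hA f] with x h1 h2
  rw [ContinuousLinearMap.comp_apply, h1, h2, mul_assoc]

/-- The even (`ε = 1`) or odd (`ε = -1`) function on the line given by a function on `(0,∞)` in the
Liouville coordinate. -/
def opX (ε : ℝ) : HalfL2 →L[ℝ] D.L2ρ := (D.exists_opX ε).choose

theorem opX_coe (ε : ℝ) (f : HalfL2) :
    D.opX ε f =ᵐ[volume] fun x => parity ε x * (D.amp x)⁻¹ * f |D.σ x| :=
  D.ae_volume ((D.exists_opX ε).choose_spec f)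

theorem pull_opX (ε : ℝ) (f : HalfL2) :
    D.pull (D.opX ε f) =ᵐ[volume] fun l => parity ε l * f |l| := by
  filter_upwards [D.quasiMeasurePreserving_τ.ae (D.opX_coe ε f)] with l hl
  have := (D.amp_pos (D.τ l)).ne'
  rw [pull, hl, parity_τ, σ_τ]
  field_simp

theorem ae_halfLine_neg {p : ℝ → Prop} (h : ∀ᵐ l, p l) : ∀ᵐ l ∂halfLine, p (-l) :=
  ae_restrict_of_ae
    ((Measure.measurePreserving_neg (volume : Measure ℝ)).quasiMeasurePreserving.ae h)

theorem opE_opX {ε : ℝ} (hε : ε * ε = 1) (f : HalfL2) : D.opE ε (D.opX ε f) = f := by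
  ext1
  filter_upwards [D.opE_coe ε (D.opX ε f), ae_restrict_of_ae (D.pull_opX ε f),
    ae_halfLine_neg (D.pull_opX ε f), ae_restrict_mem measurableSet_Ioi] with l h1 h2 h3 hl
  have hl' : 0 < l := hl
  rw [h1, h2, h3, abs_neg, abs_of_pos hl', parity_of_pos ε hl', parity_of_neg ε (by linarith)]
  linear_combination f l / 2 * hε

theorem opX_opE {f : D.L2ρ} (h : ∀ᵐ x, f (-x) = f x) : D.opX 1 (D.opE 1 f) = f := by
  refine Lp.ext (D.ae_μ ?_)
  filter_upwards [D.opX_coe 1 (D.opE 1 f), D.ae_volume (D.quasiMeasurePreserving_abs_σ.ae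
    (D.opE_coe 1 f)), h] with x h1 h2 h3
  have := (D.amp_pos x).ne'
  rw [h1, h2, parity_one, pull, pull, τ_neg, amp_neg, τ_abs]
  rcases abs_choice x with h4 | h4
  · rw [h4, h3]
    field_simp
    ring
  · rw [h4, neg_neg, h3, amp_neg]
    field_simp
    ring

/-- Pairing with an even or odd function sees only the part of `φ` of the same parity, and the two
half-lines contribute equally. Hence general test functions in `ℍ¹` reduce to test functions on the
half-line at the cost of a factor `2`. -/
theorem inner_opX (ε : ℝ) (f : HalfL2) (φ : D.L2ρ) :
    inner ℝ (D.opX ε f) φ = 2 * inner ℝ f (D.opE ε φ) := by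
  have hi : Integrable (fun x => D.opX ε f x * φ x) D.μ :=
    (Lp.memLp (D.opX ε f)).integrable_mul (Lp.memLp φ)
  set h : ℝ → ℝ := fun l => parity ε l * f |l| * D.pull φ l with hh
  have e1 : ∀ᵐ x, D.ρ x * (D.opX ε f x * φ x) = D.dσ x * h (D.σ x) := by
    filter_upwards [D.opX_coe ε f] with x hx
    have := (D.amp_pos x).ne'
    rw [hx, hh]
    simp only
    rw [pull, τ_σ, ← D.parity_τ ε (D.σ x), τ_σ, ← amp_sq_mul_dσ]
    field_simp
  have hint : Integrable h := by
    have h1 : Integrable fun x => D.ρ x * (D.opX ε f x * φ x) := by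
      have h2 : Integrable (fun x => D.opX ε f x * φ x)
        (volume.withDensity fun x => ENNReal.ofReal (D.ρ x)) := hi
      rw [integrable_withDensity_iff_integrable_smul' D.continuous_ρ.measurable.ennreal_ofReal
        (Eventually.of_forall fun x => ENNReal.ofReal_lt_top)] at h2
      simpa only [ENNReal.toReal_ofReal (D.ρ_pos _).le, smul_eq_mul] using h2
    have h3 := integrableOn_image_iff_integrableOn_abs_deriv_smul MeasurableSet.univ
      (fun x _ => (D.hasDerivAt_σ x).hasDerivWithinAt) D.strictMono_σ.injective.injOn h
    rw [image_univ, D.surjective_σ.range_eq, integrableOn_univ, integrableOn_univ] at h3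
    simp only [abs_of_pos (D.dσ_pos _), smul_eq_mul] at h3
    exact h3.2 (h1.congr e1)
  rw [inner_eq_integral, D.integral_μ, integral_congr_ae e1, ← D.integral_eq_σ,
    integral_eq_halfLine hint, inner_eq_integral, ← integral_const_mul]
  refine integral_congr_ae ?_
  filter_upwards [D.opE_coe ε φ, ae_restrict_mem measurableSet_Ioi] with l h1 hl
  have hl' : 0 < l := hl
  rw [h1, hh]
  simp only
  rw [abs_neg, abs_of_pos hl', parity_of_pos ε hl', parity_of_neg ε (by linarith)]
  ring

end HeatData

namespace HeatData

variable (D : HeatData)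

/-! ### Even states as functions on the half-line -/

theorem isPrimitive_opRight {f g : D.L2ρ} {c : ℝ}
    (h : D.pull f =ᵐ[volume] fun l => c + ∫ t in (0 : ℝ)..l, D.pull g t) :
    IsPrimitive (D.opRight f) (D.opRight g) c := by
  filter_upwards [D.opRight_coe f, ae_restrict_of_ae h, ae_restrict_mem measurableSet_Ioi]
    with l h1 h2 hl
  rw [h1, h2, integral_congr_halfLine (D.opRight_coe g) le_rfl (le_of_lt hl)]

theorem isPrimitive_opLeft {f g : D.L2ρ} {c : ℝ}
    (h : D.pull f =ᵐ[volume] fun l => c + ∫ t in (0 : ℝ)..l, D.pull g t) :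
    IsPrimitive (D.opLeft f) ((-1 : ℝ) • D.opLeft g) c := by
  have h0 : ((-1 : ℝ) • D.opLeft g : HalfL2) =ᵐ[halfLine] fun l => -D.pull g (-l) := by
    filter_upwards [Lp.coeFn_smul (-1 : ℝ) (D.opLeft g), D.opLeft_coe g] with l h1 h2
    rw [h1, Pi.smul_apply, h2, smul_eq_mul, neg_one_mul]
  filter_upwards [D.opLeft_coe f, ae_halfLine_neg h, ae_restrict_mem measurableSet_Ioi]
    with l h1 h2 hl
  rw [h1, h2, integral_congr_halfLine h0 le_rfl (le_of_lt hl), intervalIntegral.integral_neg,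
    intervalIntegral.integral_comp_neg, neg_zero, intervalIntegral.integral_symm]

/-- The derivative of the even part is the odd part of the derivative, which explains the two signs.
-/
theorem isPrimitive_opE {f g : D.L2ρ} {c : ℝ}
    (h : D.pull f =ᵐ[volume] fun l => c + ∫ t in (0 : ℝ)..l, D.pull g t) :
    IsPrimitive (D.opE 1 f) (D.opE (-1) g) c := by
  rw [opE_apply, opE_apply, one_smul]
  have := ((D.isPrimitive_opRight h).add (D.isPrimitive_opLeft h)).smul (1 / 2)
  rwa [show 1 / 2 * (c + c) = c by ring] at this

theorem exists_pull_primitive (w : D.H1) : ∃ c : ℝ,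
    D.pull (D.val w) =ᵐ[volume] fun l => c + ∫ t in (0 : ℝ)..l, D.pull (D.der w) t := by
  obtain ⟨c, hc⟩ := D.hasD_iff.1 (show D.HasD (D.val w) (D.der w) from w.2)
  exact ⟨c, (D.primitive_iff_τ c).1 hc⟩

/-- The even part of a function in `ℍ¹`, in the Liouville coordinate on `(0,∞)`. -/
def toHalf : D.H1 →L[ℝ] HalfH1 :=
  (((D.opE 1).comp D.val).prod ((D.opE (-1)).comp D.der)).codRestrict HalfH1 fun w =>
    let ⟨c, hc⟩ := D.exists_pull_primitive w
    ⟨c, D.isPrimitive_opE hc⟩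

theorem val_toHalf (w : D.H1) : HalfH1.val (D.toHalf w) = D.opE 1 (D.val w) := rfl

theorem der_toHalf (w : D.H1) : HalfH1.der (D.toHalf w) = D.opE (-1) (D.der w) := rfl

theorem pull_opX_isPrimitive (p : HalfH1) :
    D.pull (D.opX 1 (HalfH1.val p)) =ᵐ[volume] fun l =>
      HalfH1.trace p + ∫ t in (0 : ℝ)..l, D.pull (D.opX (-1) (HalfH1.der p)) t := by
  filter_upwards [D.pull_opX 1 (HalfH1.val p),
    quasiMeasurePreserving_abs.ae (HalfH1.isPrimitive p)] with l h1 h2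
  rw [h1, h2, parity_one, one_mul]
  congr 1
  have h3 : ∫ t in (0 : ℝ)..l, D.pull (D.opX (-1) (HalfH1.der p)) t =
      ∫ t in (0 : ℝ)..l, parity (-1) t * HalfH1.der p |t| :=
    intervalIntegral.integral_congr_ae (by
      filter_upwards [D.pull_opX (-1) (HalfH1.der p)] with t ht _ using ht)
  rw [h3]
  rcases le_total 0 l with hl | hl
  · rw [abs_of_nonneg hl]
    refine integral_congr_halfLine ?_ le_rfl hl
    filter_upwards [ae_restrict_mem measurableSet_Ioi] with t ht
    rw [parity_of_pos _ ht, abs_of_pos ht, one_mul]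
  · rw [abs_of_nonpos hl]
    have h4 := intervalIntegral.integral_comp_neg (a := 0) (b := -l)
      fun t => parity (-1) t * HalfH1.der p |t|
    rw [neg_neg, neg_zero] at h4
    rw [intervalIntegral.integral_symm l 0, ← h4, ← intervalIntegral.integral_neg]
    refine integral_congr_halfLine ?_ le_rfl (by linarith)
    filter_upwards [ae_restrict_mem measurableSet_Ioi] with t ht
    have ht' : 0 < t := ht
    rw [parity_of_neg _ (by linarith : -t < 0), abs_neg, abs_of_pos ht']
    ring

theorem hasD_opX (p : HalfH1) : D.HasD (D.opX 1 (HalfH1.val p)) (D.opX (-1) (HalfH1.der p)) :=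
  D.hasD_iff.2 ⟨HalfH1.trace p, (D.primitive_iff_τ _).2 (D.pull_opX_isPrimitive p)⟩

/-- The even function in `ℍ¹` given by a function in `H¹(0,∞)` in the Liouville coordinate. -/
def ofHalf : HalfH1 →L[ℝ] D.H1 :=
  ((WithLp.prodContinuousLinearEquiv 2 ℝ D.L2ρ D.L2ρ).symm.toContinuousLinearMap.comp
    (((D.opX 1).comp HalfH1.val).prod ((D.opX (-1)).comp HalfH1.der))).codRestrict D.H1
      D.hasD_opX

theorem val_ofHalf (p : HalfH1) : D.val (D.ofHalf p) = D.opX 1 (HalfH1.val p) := rfl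

theorem der_ofHalf (p : HalfH1) : D.der (D.ofHalf p) = D.opX (-1) (HalfH1.der p) := rfl

theorem ofHalf_mem (p : HalfH1) : D.ofHalf p ∈ D.EvenH1 := by
  have h := D.opX_coe 1 (HalfH1.val p)
  have h' := (Measure.measurePreserving_neg (volume : Measure ℝ)).quasiMeasurePreserving.ae h
  show ∀ᵐ x, D.val (D.ofHalf p) (-x) = D.val (D.ofHalf p) x
  rw [val_ofHalf]
  filter_upwards [h, h'] with x h1 h2
  rw [h1, h2, parity_one, parity_one, amp_neg, σ_neg, abs_neg]

theorem toHalf_ofHalf (p : HalfH1) : D.toHalf (D.ofHalf p) = p :=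
  HalfH1.ext_val (by rw [val_toHalf, val_ofHalf, opE_opX D (mul_one 1)])

theorem ofHalf_toHalf {w : D.H1} (h : w ∈ D.EvenH1) : D.ofHalf (D.toHalf w) = w :=
  D.ext_val (by rw [val_ofHalf, val_toHalf, D.opX_opE h])

/-- The state space is isomorphic to `H¹(0,∞)`. -/
def stateEquiv : HalfH1 ≃L[ℝ] D.EvenH1 :=
  ContinuousLinearEquiv.equivOfInverse (D.ofHalf.codRestrict D.EvenH1 D.ofHalf_mem)
    (D.toHalf.comp D.EvenH1.subtypeL) D.toHalf_ofHalf
    fun w => Subtype.ext (D.ofHalf_toHalf w.2)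

theorem stateEquiv_coe (p : HalfH1) : (D.stateEquiv p : D.H1) = D.ofHalf p := rfl

/-- A continuous representative exists by the primitive formula, so the choice in `atZero` is
meaningful. Two continuous functions that agree almost everywhere agree at `0`. -/
theorem atZero_eq (φ : D.H1) : D.amp 0 * D.atZero φ = HalfH1.trace (D.toHalf φ) := by
  obtain ⟨c, hc⟩ := D.hasD_iff.1 (show D.HasD (D.val φ) (D.der φ) from φ.2)
  have hi : LocallyIntegrable fun x => D.amp x * D.dσ x * D.der φ x :=
    (D.locallyIntegrable (D.der φ)).continuous_mul (D.continuous_amp.mul D.continuous_dσ)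
  have htr : HalfH1.trace (D.toHalf φ) = c :=
    HalfH1.trace_eq (p := D.toHalf φ) (D.isPrimitive_opE ((D.primitive_iff_τ c).1 hc))
  have hex : ∃ f : ℝ → ℝ, Continuous f ∧ D.val φ =ᵐ[volume] f := by
    refine ⟨fun x => (D.amp x)⁻¹ * (c + ∫ t in (0 : ℝ)..x, D.amp t * D.dσ t * D.der φ t),
      (D.continuous_amp.inv₀ fun x => (D.amp_pos x).ne').mul (continuous_const.add
        (intervalIntegral.continuous_primitive hi.intervalIntegrable' 0)), ?_⟩
    filter_upwards [hc] with x hx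
    rw [← hx, inv_mul_cancel_left₀ (D.amp_pos x).ne']
  have hs := Classical.epsilon_spec hex
  set f := Classical.epsilon fun f : ℝ → ℝ => Continuous f ∧ D.val φ =ᵐ[volume] f with hf
  have h1 : (fun x => D.amp x * f x) =
      fun x => c + ∫ t in (0 : ℝ)..x, D.amp t * D.dσ t * D.der φ t := by
    refine (D.continuous_amp.mul hs.1).ae_eq_iff_eq volume (continuous_const.add
        (intervalIntegral.continuous_primitive hi.intervalIntegrable' 0)) |>.1 ?_
    filter_upwards [hs.2, hc] with x h1 h2
    rw [Pi.mul_apply, ← h1, h2]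
    rfl
  have h2 := congrFun h1 0
  rw [intervalIntegral.integral_same, add_zero] at h2
  rw [htr, ← h2]
  rfl

theorem embed_ofHalf (p : HalfH1) (φ : D.H1) : D.embed (D.ofHalf p) φ =
    2 * inner ℝ (HalfH1.val p) (HalfH1.val (D.toHalf φ)) :=
  D.inner_opX 1 (HalfH1.val p) (D.val φ)

/-- Reflection commutes with `deriv` up to sign even where the derivative takes its default value,
so no differentiability of `Q₁` has to be checked. -/
theorem q_even (x : ℝ) : D.q (-x) = D.q x := by
  have hQ₁ : ∀ x, heatQ₁ D.ρ D.k (-x) = -heatQ₁ D.ρ D.k x := by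
    intro x
    have h1 : (fun y => D.k (-y) * D.ρ (-y)) = fun y => D.k y * D.ρ y := by
      funext y
      rw [D.even_k, D.even_ρ]
    have h2 := deriv_comp_neg (fun y => D.k y * D.ρ y) x
    rw [h1] at h2
    unfold heatQ₁
    rw [D.even_k, D.even_ρ, h2, mul_neg, neg_div, neg_neg]
  have h3 : deriv (heatQ₁ D.ρ D.k) (-x) = deriv (heatQ₁ D.ρ D.k) x := by
    have h4 := deriv_comp_neg (heatQ₁ D.ρ D.k) x
    rw [funext hQ₁, deriv.fun_neg] at h4
    linarith
  unfold q heatQ₂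
  rw [h3, hQ₁, D.even_k, D.even_ρ, D.even_γ]
  ring

/-- The coefficient `√((ρk)(0))` is the square of the amplitude at `0`. One factor converts `φ(0)`
into the trace and the other rescales the control; the `2` is the folding factor common to all
terms. -/
theorem rhs_ofHalf {M : HalfL2 →L[ℝ] HalfL2} (hM : ∀ f, M f =ᵐ[halfLine] fun l => D.r l * f l)
    (p : HalfH1) (u : ℝ) (φ : D.H1) : D.rhs (D.ofHalf p) u φ =
    2 * (-inner ℝ (HalfH1.der p) (HalfH1.der (D.toHalf φ)) -
      inner ℝ (M (HalfH1.val p)) (HalfH1.val (D.toHalf φ)) -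
      D.amp 0 * u * HalfH1.trace (D.toHalf φ)) := by
  have h1 : ∫ x, D.der (D.ofHalf p) x * D.der φ x ∂D.μ =
      2 * inner ℝ (HalfH1.der p) (HalfH1.der (D.toHalf φ)) := by
    rw [← inner_eq_integral, der_ofHalf, inner_opX, der_toHalf]
  have h2 : ∫ x, D.q x * D.val (D.ofHalf p) x * D.val φ x ∂D.μ =
      2 * inner ℝ (M (HalfH1.val p)) (HalfH1.val (D.toHalf φ)) := by
    rw [val_toHalf, ← inner_opX, inner_eq_integral]
    refine integral_congr_ae (D.ae_μ ?_)
    filter_upwards [D.opX_coe 1 (HalfH1.val p), D.opX_coe 1 (M (HalfH1.val p)),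
      D.ae_volume (D.quasiMeasurePreserving_abs_σ.ae (hM (HalfH1.val p)))] with x e1 e2 e3
    have e4 : D.r |D.σ x| = D.q x := by
      show D.q (D.τ |D.σ x|) = D.q x
      rw [τ_abs]
      rcases abs_choice x with h | h <;> rw [h]
      exact D.q_even x
    rw [val_ofHalf, e1, e2, e3, e4]
    ring
  rw [rhs, h1, h2, ← amp_sq, ← atZero_eq]
  ring

end HeatData

/-! ### The potential in the Liouville coordinate -/

theorem integrable_comp_abs {f : ℝ → ℝ} (hf : IntegrableOn f (Ioi 0)) :
    Integrable fun x => f |x| := by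
  have h1 : IntegrableOn (fun x => f |x|) (Ioi 0) :=
    hf.congr_fun (fun x hx => by rw [abs_of_pos hx]) measurableSet_Ioi
  have h2 : IntegrableOn (fun x => f |x|) (Iio 0) := by
    have h := (Measure.measurePreserving_neg (volume : Measure ℝ)).integrableOn_comp_preimage
      (MeasurableEquiv.neg ℝ).measurableEmbedding (f := fun x => f |x|) (s := Ioi 0)
    have h3 := h.2 h1
    rw [show (Neg.neg ⁻¹' Ioi (0 : ℝ)) = Iio 0 by ext x; simp] at h3
    simpa [Function.comp_def] using h3
  rw [← integrableOn_univ, ← Iic_union_Ioi (a := (0 : ℝ)), integrableOn_union,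
    integrableOn_Iic_iff_integrableOn_Iio]
  exact ⟨h2, h1⟩

/-- The even extension of `f` may have a corner at `0`. A compactly supported function with the
value and slope of `f` at `0` is removed first, the flat remainder is extended evenly, and the
removed piece is put back. Integrability near `0` comes from continuity and away from `0` from the
first moment. -/
theorem exists_momentPotential {f : ℝ → ℝ} (hf : ContDiffOn ℝ 1 f (Ici 0)) {M : ℝ}
    (hM : ∀ x, 0 ≤ x → |f x| ≤ M) (hm : IntegrableOn (fun x => x * f x) (Ioi 0)) :
    ∃ g, MomentPotential g ∧ EqOn f g (Ici 0) := by
  have hfi : IntegrableOn f (Ioi 0) := by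
    rw [← Ioc_union_Ioi_eq_Ioi zero_le_one]
    refine IntegrableOn.union ?_ ?_
    · exact ((hf.continuousOn.mono Icc_subset_Ici_self).integrableOn_Icc).mono_set
        Ioc_subset_Icc_self
    · refine Integrable.mono (hm.mono_set (Ioi_subset_Ioi zero_le_one)) ?_ ?_
      · exact (hf.continuousOn.mono (Ioi_subset_Ici zero_le_one)).aestronglyMeasurable
          measurableSet_Ioi
      · filter_upwards [ae_restrict_mem measurableSet_Ioi] with x hx
        have hx' : (1 : ℝ) < x := hx
        rw [norm_mul]
        refine le_mul_of_one_le_left (norm_nonneg _) ?_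
        rw [Real.norm_eq_abs]
        exact hx'.le.trans (le_abs_self x)
  let b : ContDiffBump (0 : ℝ) := ⟨1, 2, one_pos, one_lt_two⟩
  set f' := derivWithin f (Ici 0) 0
  set h : ℝ → ℝ := fun x => (f 0 + f' * x) * b x with hh
  have hhc : ContDiff ℝ 1 h := by
    have : ContDiff ℝ 1 b := b.contDiff
    fun_prop
  have hhs : HasCompactSupport h := b.hasCompactSupport.mul_left
  have hb0 : b =ᶠ[𝓝 0] 1 := b.eventuallyEq_one
  have hh0 : h 0 = f 0 := by simp [hh, hb0.self_of_nhds]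
  have hh1 : HasDerivAt h f' 0 := by
    have h1 : HasDerivAt (fun x : ℝ => f 0 + f' * x) f' 0 := by
      simpa using ((hasDerivAt_id (0 : ℝ)).const_mul f').const_add (f 0)
    refine h1.congr_of_eventuallyEq ?_
    filter_upwards [hb0] with x hx
    simp [hh, hx]
  set F : ℝ → ℝ := fun x => f |x| - h |x| with hF
  have hFeq : EqOn F (fun x => f x - h x) (Ici 0) := fun x hx => by
    simp only [hF, abs_of_nonneg (mem_Ici.1 hx)]
  have hFc : ContDiff ℝ 1 F := by
    refine Function.Even.contDiff_one (fun x => by simp only [hF, abs_neg])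
      ((hf.sub hhc.contDiffOn).congr hFeq) ?_
    rw [derivWithin_congr hFeq (hFeq self_mem_Ici)]
    have h1 : HasDerivWithinAt f f' (Ici 0) 0 :=
      (hf.differentiableOn one_ne_zero 0 self_mem_Ici).hasDerivWithinAt
    exact ((h1.sub hh1.hasDerivWithinAt).derivWithin (uniqueDiffOn_Ici (0 : ℝ) 0 self_mem_Ici)).trans
      (sub_self _)
  have hhi : Integrable h := hhc.continuous.integrable_of_hasCompactSupport hhs
  obtain ⟨C, hC⟩ := hhs.exists_bound_of_continuous hhc.continuous
  have heq : EqOn f (fun x => F x + h x) (Ici 0) := fun x hx => by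
    simp only [hFeq hx, sub_add_cancel]
  refine ⟨fun x => F x + h x, ⟨hFc.add hhc, ?_, ⟨M + C + C, fun x => ?_⟩, ?_⟩, heq⟩
  · exact (integrable_comp_abs (f := fun x => f x - h x) (hfi.sub hhi.integrableOn)).add hhi
  · have h1 := hM |x| (abs_nonneg x)
    have h2 := hC |x|
    have h3 := hC x
    rw [Real.norm_eq_abs] at h2 h3
    exact (abs_add_le _ _).trans (add_le_add ((abs_sub _ _).trans (add_le_add h1 h2)) h3)
  · exact hm.congr_fun (fun x hx => congrArg (x * ·) (heq (mem_Ici.2 (le_of_lt hx)))) measurableSet_Ioi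

namespace HeatData

variable (D : HeatData)

theorem contDiff_τ : ContDiff ℝ 1 D.τ := by
  rw [contDiff_one_iff_deriv]
  refine ⟨fun l => (D.hasDerivAt_τ l).differentiableAt, ?_⟩
  rw [funext fun l => (D.hasDerivAt_τ l).deriv]
  exact (D.continuous_dσ.comp D.continuous_τ).inv₀ fun l => (D.dσ_pos _).ne'

/-- By continuity on `[0,∞)` the essential bound holds at every point. -/
theorem exists_bound_q : ∃ M, ∀ x, 0 ≤ x → |D.q x| ≤ M := by
  have hc : ContinuousOn D.q (Ici 0) := D.contDiff_q.continuousOn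
  set C := (eLpNormEssSup D.q halfLine).toReal
  have hlt : eLpNormEssSup D.q halfLine < ⊤ := by
    have := D.bounded_q.2
    rwa [eLpNorm_exponent_top] at this
  have h1 : (fun x => max |D.q x| C) =ᵐ[halfLine] fun _ => C := by
    filter_upwards [enorm_ae_le_eLpNormEssSup D.q halfLine] with x hx
    refine max_eq_right ?_
    have := ENNReal.toReal_mono hlt.ne hx
    rwa [toReal_enorm, Real.norm_eq_abs] at this
  have h2 := eqOn_Ici_of_ae_halfLine (ContinuousOn.sup hc.abs continuousOn_const) continuousOn_const h1
  exact ⟨C, fun x hx => max_eq_right_iff.1 (h2 hx)⟩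

/-- The change of variables `l = σ(x)` turns the integrability of `√(ρ/k) q σ` into a finite first
moment of `r`. -/
theorem exists_momentPotential_r : ∃ g, MomentPotential g ∧ EqOn D.r g (Ici 0) := by
  obtain ⟨M, hM⟩ := D.exists_bound_q
  have hpos : ∀ l, 0 ≤ l → 0 ≤ D.τ l := fun l hl => D.τ_zero ▸ D.strictMono_τ.monotone hl
  refine exists_momentPotential (M := M) ?_ (fun l hl => hM _ (hpos l hl)) ?_
  · exact D.contDiff_q.comp D.contDiff_τ.contDiffOn hpos
  · have h := integrableOn_image_iff_integrableOn_abs_deriv_smul (measurableSet_Ioi (a := (0 : ℝ)))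
      (fun x _ => (D.hasDerivAt_σ x).hasDerivWithinAt) D.strictMono_σ.injective.injOn
      fun l => l * D.r l
    rw [← D.σIso_coe, D.σIso.image_Ioi, D.σIso_coe, σ_zero] at h
    refine h.2 (D.integrable_q.congr_fun (fun x _ => ?_) measurableSet_Ioi)
    show D.dσ x * D.q x * D.σ x = |D.dσ x| • (D.σ x * D.q (D.τ (D.σ x)))
    rw [τ_σ, abs_of_pos (D.dσ_pos x), smul_eq_mul]
    ring

end HeatData

/-! ### Weak solutions of evolution equations -/

theorem AbsolutelyContinuousOnInterval.of_dist_le {X Y : Type*} [PseudoMetricSpace X]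
    [PseudoMetricSpace Y] {f : ℝ → X} {g : ℝ → Y} {a b C : ℝ}
    (hf : AbsolutelyContinuousOnInterval f a b)
    (h : ∀ s ∈ uIcc a b, ∀ t ∈ uIcc a b, dist (g s) (g t) ≤ C * dist (f s) (f t)) :
    AbsolutelyContinuousOnInterval g a b := by
  have h1 := Tendsto.const_mul C hf
  rw [mul_zero] at h1
  refine squeeze_zero' (Eventually.of_forall fun E => Finset.sum_nonneg fun _ _ => dist_nonneg)
    ?_ h1
  filter_upwards [mem_inf_of_right (mem_principal_self _)] with E hE
  rw [Finset.mul_sum]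
  exact Finset.sum_le_sum fun i hi => h _ (hE.1 i hi).1 _ (hE.1 i hi).2

section WeakSolution

variable {V V' U U' : Type*} [NormedAddCommGroup V] [NormedAddCommGroup V'] [NormedSpace ℝ V']
  [NormedAddCommGroup U] [NormedAddCommGroup U'] [NormedSpace ℝ U']

/-- Continuous functions `w` on `[0,T]` such that `e ∘ w` is absolutely continuous in the dual space
and has the derivative `R t` for almost every `t`. -/
structure IsWeakSolution (e : V → StrongDual ℝ V') (T : ℝ) (R : ℝ → V' → ℝ) (w : ℝ → V) : Prop where
  continuousOn : ContinuousOn w (Icc 0 T)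
  absCont : AbsolutelyContinuousOnInterval (fun t => e (w t)) 0 T
  equation : ∀ᵐ t ∂(volume.restrict (Ioo 0 T)),
    ∃ F : StrongDual ℝ V', HasDerivAt (fun s => e (w s)) F t ∧ ∀ φ, F φ = R t φ

/-- States move by `L` and test functions by the adjoint map `A`. The induced map of dual spaces is
bounded and linear, hence preserves absolute continuity and derivatives in time. -/
theorem IsWeakSolution.map {e : V → StrongDual ℝ V'} {e' : U → StrongDual ℝ U'} {T : ℝ}
    {R : ℝ → V' → ℝ} {R' : ℝ → U' → ℝ} {w : ℝ → V} (h : IsWeakSolution e T R w) {L : V → U}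
    (hL : Continuous L) (A : U' →L[ℝ] V') (c : ℝ) (he : ∀ p φ, e' (L p) φ = c * e p (A φ))
    (hR : ∀ t φ, R' t φ = c * R t (A φ)) : IsWeakSolution e' T R' fun t => L (w t) := by
  set Λ : StrongDual ℝ V' →L[ℝ] StrongDual ℝ U' :=
    c • (ContinuousLinearMap.compL ℝ U' V' ℝ).flip A with hΛ
  have hΛa : ∀ F φ, Λ F φ = c * F (A φ) := fun _ _ => rfl
  have he' : ∀ p, e' (L p) = Λ (e p) := fun p => by
    ext φ
    rw [he, hΛa]
  refine ⟨hL.comp_continuousOn h.continuousOn, ?_, ?_⟩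
  · refine h.absCont.of_dist_le (C := ‖Λ‖) fun s _ t _ => ?_
    rw [he', he', dist_eq_norm, dist_eq_norm, ← map_sub]
    exact Λ.le_opNorm _
  · filter_upwards [h.equation] with t ⟨F, hF, hFR⟩
    refine ⟨Λ F, ?_, fun φ => ?_⟩
    · simp only [he']
      exact Λ.hasFDerivAt.comp_hasDerivAt t hF
    · rw [hΛa, hFR, hR]

end WeakSolution

/-- A product rule with one nondifferentiable factor: `A s - A t` vanishes at `s = t`, so continuity
of `c` suffices. The energy argument needs this because trajectories are only continuous in `H¹`. -/
theorem HasDerivAt.clm_sub_apply {V : Type*} [NormedAddCommGroup V] [NormedSpace ℝ V]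
    {A : ℝ → StrongDual ℝ V} {F : StrongDual ℝ V} {c : ℝ → V} {t : ℝ} (hA : HasDerivAt A F t)
    (hc : ContinuousAt c t) : HasDerivAt (fun s => (A s - A t) (c s)) (F (c t)) t := by
  rw [hasDerivAt_iff_tendsto_slope] at hA ⊢
  have h := (isBoundedBilinearMap_apply (𝕜 := ℝ) (E := V) (F := ℝ)).continuous.tendsto (F, c t)
  refine (h.comp (hA.prodMk_nhds (hc.tendsto.mono_left nhdsWithin_le_nhds))).congr fun s => ?_
  simp [slope]

namespace HalfH1

/-- The embedding of `H¹(0,∞)` into its dual. -/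
def embed (p : HalfH1) : StrongDual ℝ HalfH1 := (innerSL ℝ (val p)).comp val

theorem embed_apply (p q : HalfH1) : embed p q = inner ℝ (val p) (val q) := rfl

theorem embed_sub (p q : HalfH1) : embed (p - q) = embed p - embed q := by
  ext φ
  rw [sub_apply, embed_apply, embed_apply, embed_apply, map_sub, inner_sub_left]

end HalfH1

/-- Solutions of `w' = ∂²w - M w` on the half-line, where the derivative of `w` at `0` is `v`. -/
def IsHalfSolution (M : HalfL2 →L[ℝ] HalfL2) (T : ℝ) (v : ℝ → ℝ) (w : ℝ → HalfH1) : Prop :=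
  IsWeakSolution HalfH1.embed T (fun t ψ => -inner ℝ (HalfH1.der (w t)) (HalfH1.der ψ) -
    inner ℝ (M (HalfH1.val (w t))) (HalfH1.val ψ) - v t * HalfH1.trace ψ) w

namespace IsHalfSolution

variable {M : HalfL2 →L[ℝ] HalfL2} {T : ℝ} {v : ℝ → ℝ} {w w' : ℝ → HalfH1}

theorem sub (h : IsHalfSolution M T v w) (h' : IsHalfSolution M T v w') :
    IsHalfSolution M T (fun _ => 0) fun t => w t - w' t := by
  refine ⟨h.continuousOn.sub h'.continuousOn, ?_, ?_⟩
  · simp only [HalfH1.embed_sub]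
    exact h.absCont.fun_sub h'.absCont
  · filter_upwards [h.equation, h'.equation] with t ⟨F, hF, hFR⟩ ⟨F', hF', hFR'⟩
    refine ⟨F - F', ?_, fun φ => ?_⟩
    · simp only [HalfH1.embed_sub]
      exact hF.fun_sub hF'
    · rw [sub_apply, hFR, hFR']
      simp only [map_sub, inner_sub_left]
      ring

/-- The energy `‖w‖²` has derivative `2 F(w) ≤ 2 ‖M‖ ‖w‖²` almost everywhere, the gradient term
having the good sign. Being absolutely continuous, it satisfies Gronwall's inequality: multiplied by
`exp (-2‖M‖ s)` it cannot increase from `0`. -/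
theorem eq_zero (h : IsHalfSolution M T (fun _ => 0) w) (h0 : w 0 = 0) {t : ℝ}
    (ht : t ∈ Icc 0 T) : w t = 0 := by
  set y : ℝ → ℝ := fun t => ‖HalfH1.val (w t)‖ ^ 2 with hy
  -- The difference of squares puts all time increments into the dual norm, where `w` is absolutely
  -- continuous and differentiable, and leaves a factor that is bounded and continuous in `H¹`.
  have hyd : ∀ s t, y s - y t =
      (HalfH1.embed (w s) - HalfH1.embed (w t)) (w s + w t) := fun s t => by
    rw [sub_apply, HalfH1.embed_apply, HalfH1.embed_apply, map_add, inner_add_right,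
      inner_add_right, hy]
    simp only
    rw [← real_inner_self_eq_norm_sq, ← real_inner_self_eq_norm_sq,
      real_inner_comm (HalfH1.val (w s)) (HalfH1.val (w t))]
    ring
  have hsub : uIcc 0 t ⊆ Icc 0 T := by
    rw [uIcc_of_le ht.1]
    exact Icc_subset_Icc_right ht.2
  have h0T : (0 : ℝ) ≤ T := ht.1.trans ht.2
  obtain ⟨B, hB⟩ := isCompact_Icc.exists_bound_of_continuousOn h.continuousOn
  have hyac : AbsolutelyContinuousOnInterval y 0 t := by
    have h1 := h.absCont.mono (c := 0) (d := t) (by rwa [uIcc_of_le h0T])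
    refine h1.of_dist_le (C := B + B) fun a ha b hb => ?_
    rw [Real.dist_eq, hyd, dist_eq_norm, mul_comm]
    refine ((HalfH1.embed (w a) - HalfH1.embed (w b)).le_opNorm (w a + w b)).trans ?_
    gcongr
    exact (norm_add_le _ _).trans (add_le_add (hB a (hsub ha)) (hB b (hsub hb)))
  set C := 2 * ‖M‖ with hC
  set G : ℝ → ℝ := fun s => y s * Real.exp (-C * s) with hG
  have hexp : ∀ s, HasDerivAt (fun s => Real.exp (-C * s)) (Real.exp (-C * s) * (-C)) s :=
    fun s => by simpa using ((hasDerivAt_id s).const_mul (-C)).exp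
  have hGac : AbsolutelyContinuousOnInterval G 0 t :=
    hyac.mul ((by fun_prop : ContDiff ℝ 1 fun s => Real.exp (-C * s)).contDiffOn
      |>.absolutelyContinuousOnInterval)
  have hGd : ∀ᵐ s ∂(volume.restrict (Ioo 0 T)), deriv G s ≤ 0 := by
    filter_upwards [h.equation, ae_restrict_mem measurableSet_Ioo] with s ⟨F, hF, hFR⟩ hs
    have hc : ContinuousAt w s := h.continuousOn.continuousAt (Icc_mem_nhds hs.1 hs.2)
    have h1 := hF.clm_sub_apply (hc.add (continuousAt_const (y := w s)))
    have h2 : HasDerivAt y (F (w s + w s)) s := by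
      refine (h1.add_const (y s)).congr_of_eventuallyEq (Eventually.of_forall fun r => ?_)
      exact (sub_eq_iff_eq_add.1 (hyd r s))
    have h3 := (h2.fun_mul (hexp s)).deriv
    have h4 : F (w s) ≤ ‖M‖ * y s := by
      rw [hFR, real_inner_self_eq_norm_sq, zero_mul, sub_zero]
      have h5 := abs_real_inner_le_norm (M (HalfH1.val (w s))) (HalfH1.val (w s))
      have h6 := mul_le_mul_of_nonneg_right (M.le_opNorm (HalfH1.val (w s)))
        (norm_nonneg (HalfH1.val (w s)))
      have h7 := (abs_le.1 (h5.trans h6)).1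
      have h8 : ‖M‖ * y s = ‖M‖ * ‖HalfH1.val (w s)‖ * ‖HalfH1.val (w s)‖ := by
        rw [hy]
        ring
      rw [h8]
      linarith [sq_nonneg ‖HalfH1.der (w s)‖]
    show deriv (fun s => y s * Real.exp (-C * s)) s ≤ 0
    rw [h3, map_add]
    have h9 : (F (w s) + F (w s)) * Real.exp (-C * s) + y s * (Real.exp (-C * s) * (-C)) =
        2 * (F (w s) - ‖M‖ * y s) * Real.exp (-C * s) := by
      rw [hC]
      ring
    rw [h9]
    exact mul_nonpos_of_nonpos_of_nonneg (by linarith) (Real.exp_pos _).le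
  have hint := hGac.integral_deriv_eq_sub
  have hle : ∫ s in (0 : ℝ)..t, deriv G s ≤ 0 := by
    rw [intervalIntegral.integral_of_le ht.1, integral_Ioc_eq_integral_Ioo]
    exact integral_nonpos_of_ae (ae_restrict_of_ae_restrict_of_subset
      (Ioo_subset_Ioo_right ht.2) hGd)
  have hG0 : G 0 = 0 := by simp [hG, hy, h0]
  rw [hint, hG0, sub_zero] at hle
  have h1 : y t ≤ 0 := by
    by_contra hne
    push Not at hne
    exact (mul_pos hne (Real.exp_pos (-C * t))).not_ge hle
  refine HalfH1.ext_val ?_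
  rw [map_zero, ← norm_eq_zero]
  exact pow_eq_zero_iff two_ne_zero |>.1 (le_antisymm h1 (sq_nonneg _))

theorem unique (h : IsHalfSolution M T v w) (h' : IsHalfSolution M T v w') (h0 : w 0 = w' 0) :
    EqOn w w' (Icc 0 T) := fun _ ht =>
  sub_eq_zero.1 ((h.sub h').eq_zero (sub_eq_zero.2 h0) ht)

/-- Test functions are moved by `S.equivT'`; since it fixes the trace, the datum is changed only by
the feedback of the trajectory. -/
theorem equivT (S : TransformData) (h : IsHalfSolution 0 T v w) :
    IsHalfSolution S.opr T (fun t => v t + S.feedback (w t)) fun t => S.equivT (w t) := by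
  refine IsWeakSolution.map h S.equivT.continuous (S.equivT' : HalfH1 →L[ℝ] HalfH1) 1
    (fun p φ => ?_) fun t φ => ?_
  · rw [one_mul]
    exact S.inner_val_equivT p φ
  · have h1 := S.inner_der_equivT (w t) φ
    have h2 := S.trace_equivT' φ
    simp only [ContinuousLinearEquiv.coe_coe, zero_apply, inner_zero_left, h2]
    linear_combination -h1

theorem equivT_symm (S : TransformData) (h : IsHalfSolution S.opr T v w) :
    IsHalfSolution 0 T (fun t => v t - S.feedback (S.equivT.symm (w t)))
      fun t => S.equivT.symm (w t) := by
  refine IsWeakSolution.map h S.equivT.symm.continuous (S.equivT'.symm : HalfH1 →L[ℝ] HalfH1) 1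
    (fun p φ => ?_) fun t φ => ?_
  · have h1 := S.inner_val_equivT (S.equivT.symm p) (S.equivT'.symm φ)
    rw [ContinuousLinearEquiv.apply_symm_apply, ContinuousLinearEquiv.apply_symm_apply] at h1
    rw [one_mul]
    exact h1.symm
  · have h1 := S.inner_der_equivT (S.equivT.symm (w t)) (S.equivT'.symm φ)
    have h2 := S.trace_equivT' (S.equivT'.symm φ)
    rw [ContinuousLinearEquiv.apply_symm_apply, ContinuousLinearEquiv.apply_symm_apply] at h1
    rw [ContinuousLinearEquiv.apply_symm_apply] at h2
    simp only [ContinuousLinearEquiv.coe_coe, zero_apply, inner_zero_left]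
    rw [h2]
    linear_combination h1

end IsHalfSolution

/-- The states reachable from `p` by the controlled equation on the half-line. -/
def halfReachable (M : HalfL2 →L[ℝ] HalfL2) (T : ℝ) (p : HalfH1) : Set HalfH1 :=
  {pT | ∃ v : ℝ → ℝ, MemLp v ⊤ (volume.restrict (Ioo 0 T)) ∧
    ∃ w : ℝ → HalfH1, IsHalfSolution M T v w ∧ w 0 = p ∧ w T = pT}

theorem memLp_top_of_continuousOn {f : ℝ → ℝ} {T : ℝ} (hf : ContinuousOn f (Icc 0 T)) :
    MemLp f ⊤ (volume.restrict (Ioo 0 T)) := by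
  obtain ⟨C, hC⟩ := isCompact_Icc.exists_bound_of_continuousOn hf
  refine memLp_top_of_bound ((hf.mono Ioo_subset_Icc_self).aestronglyMeasurable
    measurableSet_Ioo) C ?_
  filter_upwards [ae_restrict_mem measurableSet_Ioo] with t ht
  exact hC t (Ioo_subset_Icc_self ht)

/-- The feedback along a given trajectory is a continuous function on `[0,T]`, so adding or
subtracting it keeps the control in `L^∞`. -/
theorem halfReachable_equivT (S : TransformData) (T : ℝ) (p : HalfH1) :
    halfReachable S.opr T (S.equivT p) = S.equivT '' halfReachable 0 T p := by
  ext pT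
  constructor
  · rintro ⟨v, hv, w, hw, h0, rfl⟩
    have h1 := hw.equivT_symm S
    refine ⟨S.equivT.symm (w T), ⟨_, ?_, _, h1, ?_, rfl⟩, S.equivT.apply_symm_apply _⟩
    · exact hv.sub (memLp_top_of_continuousOn
        (S.feedback.continuous.comp_continuousOn h1.continuousOn))
    · rw [h0, ContinuousLinearEquiv.symm_apply_apply]
  · rintro ⟨_, ⟨v, hv, w, hw, rfl, rfl⟩, rfl⟩
    exact ⟨_, hv.add (memLp_top_of_continuousOn
      (S.feedback.continuous.comp_continuousOn hw.continuousOn)), _, hw.equivT S, rfl, rfl⟩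

/-! ### Reachable sets -/

namespace HeatData

variable (D : HeatData)

/-- Going down, the test functions on the half-line are extended evenly; going up, arbitrary ones
are replaced by their even parts. The constants `1/2` and `2` undo and restore the folding factor.
-/
theorem isSolution_iff {M : HalfL2 →L[ℝ] HalfL2}
    (hM : ∀ f, M f =ᵐ[halfLine] fun l => D.r l * f l) {T : ℝ} {u : ℝ → ℝ} {W0 : D.EvenH1}
    {W : ℝ → D.EvenH1} : D.IsSolution T u W0 W ↔
      IsHalfSolution M T (fun t => D.amp 0 * u t) (fun t => D.stateEquiv.symm (W t)) ∧
        W 0 = W0 := by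
  constructor
  · rintro ⟨h1, h2, h3, h4⟩
    have hw : IsWeakSolution (fun w : D.EvenH1 => D.embed w) T
      (fun t φ => D.rhs (W t) (u t) φ) W := ⟨h1, h2, h3⟩
    refine ⟨hw.map D.stateEquiv.symm.continuous D.ofHalf (1 / 2) (fun W φ => ?_)
      fun t φ => ?_, h4⟩
    · obtain ⟨p, rfl⟩ := D.stateEquiv.surjective W
      rw [stateEquiv_coe, embed_ofHalf, toHalf_ofHalf, ContinuousLinearEquiv.symm_apply_apply,
        HalfH1.embed_apply]
      ring
    · obtain ⟨p, hp⟩ := D.stateEquiv.surjective (W t)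
      beta_reduce
      rw [← hp, stateEquiv_coe, D.rhs_ofHalf hM, toHalf_ofHalf,
        ContinuousLinearEquiv.symm_apply_apply]
      ring
  · rintro ⟨h, h0⟩
    have hw : IsWeakSolution (fun w : D.EvenH1 => D.embed w) T
        (fun t φ => D.rhs (W t) (u t) φ) fun t => D.stateEquiv (D.stateEquiv.symm (W t)) := by
      refine IsWeakSolution.map h D.stateEquiv.continuous D.toHalf 2 (fun p φ => ?_)
        fun t φ => ?_
      · rw [stateEquiv_coe, embed_ofHalf, HalfH1.embed_apply]
      · obtain ⟨p, hp⟩ := D.stateEquiv.surjective (W t)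
        beta_reduce
        rw [← hp, stateEquiv_coe, D.rhs_ofHalf hM, ContinuousLinearEquiv.symm_apply_apply]
    simp only [ContinuousLinearEquiv.apply_symm_apply] at hw
    exact ⟨hw.continuousOn, hw.absCont, hw.equation, h0⟩

theorem reachable_eq {M : HalfL2 →L[ℝ] HalfL2}
    (hM : ∀ f, M f =ᵐ[halfLine] fun l => D.r l * f l) (T : ℝ) (p : HalfH1) :
    D.reachable T (D.stateEquiv p) = D.stateEquiv '' halfReachable M T p := by
  have ha := (D.amp_pos 0).ne'
  ext WT
  constructor
  · rintro ⟨u, hu, W, hW, -, rfl⟩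
    obtain ⟨h1, h2⟩ := (D.isSolution_iff hM).1 hW
    refine ⟨_, ⟨_, hu.const_mul _, _, h1, ?_, rfl⟩, D.stateEquiv.apply_symm_apply _⟩
    rw [h2, ContinuousLinearEquiv.symm_apply_apply]
  · rintro ⟨_, ⟨v, hv, w, hw, rfl, rfl⟩, rfl⟩
    have hW : D.IsSolution T (fun t => (D.amp 0)⁻¹ * v t) (D.stateEquiv (w 0))
        fun t => D.stateEquiv (w t) := by
      rw [D.isSolution_iff hM]
      simp only [mul_inv_cancel_left₀ ha, ContinuousLinearEquiv.symm_apply_apply, and_true]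
      exact hw
    -- The uniqueness clause of the reachable set is discharged by the energy estimate on the
    -- half-line, for every control.
    refine ⟨_, hv.const_mul _, _, hW, fun W' hW' t ht => ?_, rfl⟩
    obtain ⟨h1, h2⟩ := (D.isSolution_iff hM).1 hW
    obtain ⟨h3, h4⟩ := (D.isSolution_iff hM).1 hW'
    exact D.stateEquiv.symm.injective (h3.unique h1 (by rw [h4]) ht)

/-! ### The transformation operator -/

theorem exists_transformData : ∃ S : TransformData, EqOn D.r S.r (Ioi 0) ∧
    ∀ x y, 0 < x → x < y → transformKernel D.r x y = S.K x y := by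
  obtain ⟨g, hg, h⟩ := D.exists_momentPotential_r
  have h' : EqOn D.r g (Ioi 0) := h.mono Ioi_subset_Ici_self
  obtain ⟨K, K₁, K₂, K₁₁, K₂₂, hK, hKe⟩ := exists_smoothKernel_eq_transformKernel hg h'
  exact ⟨⟨g, K, K₁, K₂, K₁₁, K₂₂, hg, hK⟩, h', hKe⟩

/-- The potential and the smooth kernel of the transformation operator. -/
def transformData : TransformData := D.exists_transformData.choose

theorem opr_transformData (f : HalfL2) :
    D.transformData.opr f =ᵐ[halfLine] fun l => D.r l * f l := by
  filter_upwards [D.transformData.opr_coe f, ae_restrict_mem measurableSet_Ioi] with l h1 hl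
  rw [h1, D.exists_transformData.choose_spec.1 hl]
  rfl

theorem toFun_injective {W W' : D.EvenH1} (h : D.toFun W =ᵐ[volume] D.toFun W') : W = W' :=
  Subtype.ext (D.ext_val (Lp.ext (D.ae_μ h)))

theorem flat_amp (x : ℝ) : flat.amp x = 1 := by simp [amp, flat]

theorem flat_r (l : ℝ) : flat.r l = 0 := by
  simp [r, q, flat, heatQ₂_one]

theorem toFun_flat_stateEquiv (p : HalfH1) :
    flat.toFun (flat.stateEquiv p) =ᵐ[volume] fun x => HalfH1.val p |x| := by
  filter_upwards [flat.opX_coe 1 (HalfH1.val p)] with x hx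
  have h : flat.σ = fun x => x := heatSigma_one
  refine hx.trans ?_
  rw [parity_one, flat_amp, h, inv_one, one_mul, one_mul]

/-- The transformation operator as an isomorphism. -/
def transformEquiv : flat.EvenH1 ≃L[ℝ] D.EvenH1 :=
  (flat.stateEquiv.symm.trans D.transformData.equivT).trans D.stateEquiv

/-- Only kernel values with `0 < |σ x| < ξ` are integrated, for almost every `x`, and there
`transformKernel` coincides with the smooth kernel defining the isomorphism. -/
theorem toFun_transformEquiv (Z : flat.EvenH1) :
    D.toFun (D.transformEquiv Z) =ᵐ[volume] D.transformFun (flat.toFun Z) := by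
  obtain ⟨p, rfl⟩ := flat.stateEquiv.surjective Z
  set S := D.transformData
  have h1 : D.transformEquiv (flat.stateEquiv p) = D.stateEquiv (S.equivT p) :=
    congrArg (fun p => D.stateEquiv (S.equivT p)) (flat.stateEquiv.symm_apply_apply p)
  have hval : HalfH1.val (S.equivT p) =ᵐ[halfLine] fun l => HalfH1.val p l +
      ∫ ξ, upperPart S.K l ξ * HalfH1.val p ξ ∂halfLine := by
    rw [S.val_equivT]
    filter_upwards [Lp.coeFn_add (HalfH1.val p) (S.opK (HalfH1.val p)),
      hsOp_coe S.memLpK (HalfH1.val p)] with l h2 h3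
    rw [h2, Pi.add_apply]
    exact congrArg (HalfH1.val p l + ·) h3
  have hZ := toFun_flat_stateEquiv p
  have hpos : ∀ᵐ x, 0 < |D.σ x| := D.ae_volume (D.quasiMeasurePreserving_abs_σ.ae
    (ae_restrict_mem measurableSet_Ioi))
  rw [h1]
  filter_upwards [D.opX_coe 1 (HalfH1.val (S.equivT p)),
    D.ae_volume (D.quasiMeasurePreserving_abs_σ.ae hval),
    D.quasiMeasurePreserving_σ.ae hZ, hpos] with x h2 h3 h4 h5
  have h6 : ∫ ξ in Ioi |D.σ x|, transformKernel D.r |D.σ x| ξ *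
      flat.toFun (flat.stateEquiv p) ξ =
      ∫ ξ, upperPart S.K |D.σ x| ξ * HalfH1.val p ξ ∂halfLine := by
    have h7 : ∀ ξ, upperPart S.K |D.σ x| ξ * HalfH1.val p ξ =
        (Ioi |D.σ x|).indicator (fun ξ => S.K |D.σ x| ξ * HalfH1.val p ξ) ξ := fun ξ => by
      by_cases h : |D.σ x| < ξ <;> simp [upperPart, h]
    simp only [h7]
    rw [integral_indicator measurableSet_Ioi, Measure.restrict_restrict measurableSet_Ioi,
      inter_eq_left.2 (Ioi_subset_Ioi h5.le)]
    refine integral_congr_ae ?_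
    filter_upwards [ae_restrict_of_ae hZ, ae_restrict_mem measurableSet_Ioi] with ξ h8 h9
    rw [h8, D.exists_transformData.choose_spec.2 _ _ h5 h9, abs_of_pos (h5.trans h9)]
    rfl
  refine h2.trans ?_
  show _ = (flat.toFun (flat.stateEquiv p) (D.σ x) + ∫ ξ in Ioi |D.σ x|,
    transformKernel D.r |D.σ x| ξ * flat.toFun (flat.stateEquiv p) ξ) / D.amp x
  rw [parity_one, h3, h4, h6]
  ring

/-- The isomorphism exhibits an element with the required representative, so the choice defining
`transform` satisfies its specification. -/
theorem toFun_transform (Z : flat.EvenH1) :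
    D.toFun (D.transform Z) =ᵐ[volume] D.transformFun (flat.toFun Z) :=
  Classical.epsilon_spec (p := fun W : D.EvenH1 => D.toFun W =ᵐ[volume]
    D.transformFun (flat.toFun Z)) ⟨_, D.toFun_transformEquiv Z⟩

theorem transform_eq : D.transform = D.transformEquiv := funext fun Z =>
  D.toFun_injective ((D.toFun_transform Z).trans (D.toFun_transformEquiv Z).symm)

theorem reachable_transformEquiv (T : ℝ) (Z : flat.EvenH1) :
    D.reachable T (D.transformEquiv Z) = D.transformEquiv '' flat.reachable T Z := by
  obtain ⟨p, rfl⟩ := flat.stateEquiv.surjective Z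
  have h1 : ∀ p, D.transformEquiv (flat.stateEquiv p) =
      D.stateEquiv (D.transformData.equivT p) := fun p =>
    congrArg (fun p => D.stateEquiv (D.transformData.equivT p))
      (flat.stateEquiv.symm_apply_apply p)
  have h0 : ∀ f : HalfL2, (0 : HalfL2 →L[ℝ] HalfL2) f =ᵐ[halfLine] fun l => flat.r l * f l := by
    intro f
    filter_upwards [Lp.coeFn_zero ℝ 2 halfLine] with l hl
    rw [flat_r, zero_mul]
    exact hl
  rw [h1, D.reachable_eq D.opr_transformData, halfReachable_equivT, flat.reachable_eq h0,
    image_image, image_image]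
  simp only [h1]

end HeatData

theorem mainTheorem3 (D : HeatData) :
    (∀ Z : HeatData.flat.EvenH1,
      D.toFun (D.transform Z) =ᵐ[volume] D.transformFun (HeatData.flat.toFun Z)) ∧
    Function.Bijective D.transform ∧
    ∀ (T : ℝ), 0 < T → ∀ (W0 WT : D.EvenH1) (Z0 ZT : HeatData.flat.EvenH1),
      Z0 = D.transformInv W0 → ZT = D.transformInv WT →
        D.reachable T W0 = D.transform '' HeatData.flat.reachable T Z0 ∧
        (HeatData.flat.Controllable T Z0 ZT ↔ D.Controllable T W0 WT) ∧
        (HeatData.flat.ApproxControllable T Z0 ZT ↔ D.ApproxControllable T W0 WT) := by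
  have hb : Function.Bijective D.transform := D.transform_eq ▸ D.transformEquiv.bijective
  refine ⟨D.toFun_transform, hb, fun T _ W0 WT Z0 ZT h0 hT => ?_⟩
  have e0 : D.transformEquiv Z0 = W0 := by
    rw [h0, ← D.transform_eq]
    exact Function.rightInverse_invFun hb.surjective W0
  have eT : D.transformEquiv ZT = WT := by
    rw [hT, ← D.transform_eq]
    exact Function.rightInverse_invFun hb.surjective WT
  have hR := D.reachable_transformEquiv T Z0
  rw [e0] at hR
  refine ⟨by rw [hR, D.transform_eq], ?_, ?_⟩
  · rw [HeatData.Controllable, HeatData.Controllable, hR, ← eT,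
      D.transformEquiv.injective.mem_set_image]
  · have hcl : closure (D.transformEquiv '' HeatData.flat.reachable T Z0) =
        D.transformEquiv '' closure (HeatData.flat.reachable T Z0) :=
      (D.transformEquiv.toHomeomorph.image_closure _).symm
    rw [HeatData.ApproxControllable, HeatData.ApproxControllable, hR, hcl, ← eT,
      D.transformEquiv.injective.mem_set_image]

end
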